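/- Let $n\ge 1$ and let $x_1,\dots,x_n$ be positive real numbers. For $I\subset\{1,\dots,n\}$ put $x_I=\sum_{i\in I}x_i$. Let $\zeta(z)=e^{z/2}-e^{-z/2}$, let $P_1(a_1;x_1)=1/x_1$ and, for $n\ge 2$, \[ P_n(a_1,\dots,a_n;x_1,\dots,x_n)=\sum_{\substack{\tau\in S_n\\ \tau(1)=1}}\frac{\prod_{j=2}^{n-1}x_{\tau(j)}\ \prod_{j=1}^{n-1}\zeta\Bigl(\bigl(\sum_{k=1}^{j}a_{\tau(k)}\bigr)x_{\tau(j+1)}-a_{\tau(j+1)}\bigl(\sum_{k=1}^{j}x_{\tau(k)}\bigr)\Bigr)}{\prod_{j=1}^{n-1}\bigl(a_{\tau(j)}x_{\tau(j+1)}-a_{\tau(j+1)}x_{\tau(j)}\bigr)} , \] and define \[ \mathcal F_n^{\mathsf{Bur}}(x_1,\dots,x_n)=\frac{e^{(\sum_{j=1}^n x_j)^3/24}}{\bigl(\sum_{j=1}^n x_j\bigr)\prod_{j=1}^n\sqrt{2\pi x_j}}\int_{\mathbb R^n}\Bigl[\prod_{j=1}^n e^{-\frac{a_j^2}{2x_j}}\,da_j\Bigr]\,P_n(\mathsf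 i a_1,\dots,\mathsf i a_n;x_1,\dots,x_n). \] For $\ell\ge 1$ and $y_1,\dots,y_\ell>0$ define \[ \mathcal E(y_1,\dots,y_\ell)=\frac{e^{(\sum_{j=1}^\ell y_j^3)/12}}{\prod_{j=1}^\ell\sqrt{4\pi y_j}}\int_{\mathbb R_{\ge0}^\ell}\Bigl[\prod_{j=1}^\ell ds_j\Bigr]\exp\Bigl(-\sum_{j=1}^\ell\Bigl(\frac{(s_j-s_{j+1})^2}{4y_j}+\frac{(s_j+s_{j+1})y_j}{2}\Bigr)\Bigr),\qquad s_{\ell+1}=s_1 , \] \[ \mathcal C(y_1,\dots,y_\ell)=\frac{e^{\frac1{24}\sum_{j=1}^\ell y_j^3}}{(2\pi)^\ell}\int_{\mathbb R^\ell}\frac{\prod_{j=1}^\ell e^{-\frac{f_j^2}{2y_j}}\frac{df_j}{y_j}}{\prod_{j=1}^\ell\Bigl[\mathsf i\Bigl(\frac{f_j}{y_j}-\frac{f_{j+1}}{y_{j+1}}\Bigr)-\frac{y_j+y_{j+1}}2\Bigr]},\qquad f_{\ell+1}=f_1,\ y_{\ell+1}=y_1 . \] A cyclically ordered partition $[I_1\sqcup\cdots\sqcup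 I_\ell]$ of $\{1,\dots,n\}$ is an ordered partition into $\ell$ nonempty blocks, considered up to the identification of $[I_1\sqcup\cdots\sqcup I_\ell]$ with $[I_2\sqcup\cdots\sqcup I_\ell\sqcup I_1]$; the number $\mathcal C(x_{I_1},\dots,x_{I_\ell})$ depends only on this class. Then: (1) The integral defining $\mathcal F_n^{\mathsf{Bur}}$ converges absolutely, and \[ \mathcal F_n^{\mathsf{Bur}}(x_1,\dots,x_n)=\frac{(2\pi)^{n/2}}{\prod_{j=1}^n x_j^{1/2}}\ \sum_{\ell=1}^n\ \sum_{[I_1\sqcup\cdots\sqcup I_\ell]=\{1,\dots,n\}}-\,\mathcal C(x_{I_1},\dots,x_{I_\ell}), \] where the inner sum runs over the cyclically ordered partitions of $\{1,\dots,n\}$ into $\ell$ blocks. (2) For every cyclically ordered partition $[I_1\sqcup\cdots\sqcup I_\ell]$ of $\{1,\dots,n\}$, the integrals below converge absolutely, and \[ \mathcal C(x_{I_1},\dots,x_{I_\ell})=(-1)^\ell\,\mathcal E\Bigl(\frac{x_{I_1}}{2^{1/3}},\dots,\frac{x_{I_\ell}}{2^{1/3}}\Bigr). \] -/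

import Mathlib

open MeasureTheory

noncomputable section

/-! ### Buryak's formula -/

/-- `ζ(z) = e^{z/2} - e^{-z/2}`. -/
def buryakZeta (z : ℂ) : ℂ :=
  Complex.exp (z / 2) - Complex.exp (-z / 2)

/-- The function `P_n(a_1, …, a_n; x_1, …, x_n)`, with indices starting at `0`. For `n ≥ 2` it is
given by a sum of fractions, whose denominators vanish only on finitely many hyperplanes in `a`
when the `x_j` are nonzero. The value for `n = 0` plays no role. -/
def buryakP : (n : ℕ) → (Fin n → ℂ) → (Fin n → ℂ) → ℂ
  | 0, _, _ => 0
  | 1, _, x => 1 / x 0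
  | m + 2, a, x =>
    ∑ τ : Equiv.Perm (Fin (m + 2)) with τ 0 = 0,
      ((∏ j ∈ Finset.Ioo 0 (Fin.last (m + 1)), x (τ j)) *
        ∏ j : Fin (m + 1),
          buryakZeta
            ((∑ k ∈ Finset.Iic j.castSucc, a (τ k)) * x (τ j.succ) -
              a (τ j.succ) * ∑ k ∈ Finset.Iic j.castSucc, x (τ k))) /
      ∏ j : Fin (m + 1),
        (a (τ j.castSucc) * x (τ j.succ) - a (τ j.succ) * x (τ j.castSucc))

/-- The integrand `∏_j e^{-a_j²/(2x_j)} · P_n(i a_1, …, i a_n; x_1, …, x_n)`. -/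
def buryakIntegrand (n : ℕ) (x a : Fin n → ℝ) : ℂ :=
  ((∏ j, Real.exp (-(a j) ^ 2 / (2 * x j)) : ℝ) : ℂ) *
    buryakP n (fun j => Complex.I * (a j : ℂ)) (fun j => (x j : ℂ))

/-- Buryak's `n`-point function. -/
def buryakF (n : ℕ) (x : Fin n → ℝ) : ℂ :=
  ((Real.exp ((∑ j, x j) ^ 3 / 24) /
      ((∑ j, x j) * ∏ j, Real.sqrt (2 * Real.pi * x j)) : ℝ) : ℂ) *
    ∫ a : Fin n → ℝ, buryakIntegrand n x a

/-! ### Okounkov's function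

Indices in `Fin ℓ` are cyclic: the successor of `j` is `finRotate ℓ j`. -/

/-- The integrand `exp(-∑_j ((s_j - s_{j+1})²/(4x_j) + (s_j + s_{j+1}) x_j/2))`. -/
def okounkovIntegrand {ℓ : ℕ} (x s : Fin ℓ → ℝ) : ℝ :=
  Real.exp (-∑ j, ((s j - s (finRotate ℓ j)) ^ 2 / (4 * x j) +
    (s j + s (finRotate ℓ j)) * x j / 2))

/-- The function `𝓔(x_1, …, x_ℓ)`. -/
def okounkovE {ℓ : ℕ} (x : Fin ℓ → ℝ) : ℝ :=
  Real.exp ((∑ j, x j ^ 3) / 12) / (∏ j, Real.sqrt (4 * Real.pi * x j)) *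
    ∫ s in {s : Fin ℓ → ℝ | ∀ j, 0 ≤ s j}, okounkovIntegrand x s

/-! ### The cyclic Gaussian integrals -/

/-- The integrand
`∏_j e^{-f_j²/(2y_j)} / y_j / ∏_j (i (f_j/y_j - f_{j+1}/y_{j+1}) - (y_j + y_{j+1})/2)`. -/
def cyclicIntegrand {ℓ : ℕ} (y f : Fin ℓ → ℝ) : ℂ :=
  ((∏ j, Real.exp (-(f j) ^ 2 / (2 * y j)) / y j : ℝ) : ℂ) /
    ∏ j, (Complex.I * ((f j / y j - f (finRotate ℓ j) / y (finRotate ℓ j) : ℝ) : ℂ) -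
      (((y j + y (finRotate ℓ j)) / 2 : ℝ) : ℂ))

/-- `e^{∑ y_j³/24} / (2π)^ℓ` times the integral over `ℝ^ℓ` of the cyclic integrand. -/
def cyclicIntegral {ℓ : ℕ} (y : Fin ℓ → ℝ) : ℂ :=
  ((Real.exp ((∑ j, y j ^ 3) / 24) / (2 * Real.pi) ^ ℓ : ℝ) : ℂ) *
    ∫ f : Fin ℓ → ℝ, cyclicIntegrand y f

/-! ### Ordered and cyclically ordered set partitions -/

/-- Ordered partitions `I_1 ⊔ … ⊔ I_ℓ` of an `n`-element set into `ℓ` nonempty blocks. -/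
def OrderedSetPartition (n ℓ : ℕ) : Type :=
  {I : Fin ℓ → Finset (Fin n) //
    (∀ j, (I j).Nonempty) ∧ (∀ j k, j ≠ k → Disjoint (I j) (I k)) ∧
      ∀ i, ∃ j, i ∈ I j}

/-- The block sums `x_{I_j} = ∑_{i ∈ I_j} x_i`. -/
def OrderedSetPartition.blockSum {n ℓ : ℕ} (I : OrderedSetPartition n ℓ) (x : Fin n → ℝ) :
    Fin ℓ → ℝ :=
  fun j => ∑ i ∈ I.1 j, x i

/-- Two ordered partitions are identified when they differ by a rotation of the blocks. -/
instance OrderedSetPartition.rotationSetoid (n ℓ : ℕ) : Setoid (OrderedSetPartition n ℓ) where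
  r I I' := ∃ m : ℕ, ∀ j, I'.1 j = I.1 ((finRotate ℓ ^ m) j)
  iseqv :=
    { refl := fun _ => ⟨0, fun _ => rfl⟩
      symm := by
        rintro I I' ⟨m, hm⟩
        have hpos : 0 < orderOf (finRotate ℓ) := orderOf_pos _
        refine ⟨m * (orderOf (finRotate ℓ) - 1), fun j => ?_⟩
        rw [hm, ← Equiv.Perm.mul_apply, ← pow_add]
        have : m + m * (orderOf (finRotate ℓ) - 1) = orderOf (finRotate ℓ) * m := by
          obtain ⟨k, hk⟩ : ∃ k, orderOf (finRotate ℓ) = k + 1 := ⟨_, (Nat.sub_add_cancel hpos).symm⟩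
          rw [hk, Nat.add_sub_cancel]
          ring
        rw [this, pow_mul, pow_orderOf_eq_one, one_pow, Equiv.Perm.one_apply]
      trans := by
        rintro I I' I'' ⟨m, hm⟩ ⟨k, hk⟩
        refine ⟨m + k, fun j => ?_⟩
        rw [hk, hm, pow_add, Equiv.Perm.mul_apply] }

/-- Cyclically ordered partitions `[I_1 ⊔ … ⊔ I_ℓ]` of an `n`-element set. -/
def CyclicSetPartition (n ℓ : ℕ) : Type :=
  Quotient (OrderedSetPartition.rotationSetoid n ℓ)

open Classical in
instance OrderedSetPartition.instFintype (n ℓ : ℕ) : Fintype (OrderedSetPartition n ℓ) :=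
  inferInstanceAs (Fintype {I : Fin ℓ → Finset (Fin n) //
    (∀ j, (I j).Nonempty) ∧ (∀ j k, j ≠ k → Disjoint (I j) (I k)) ∧
      ∀ i, ∃ j, i ∈ I j})

open Classical in
instance CyclicSetPartition.instFintype (n ℓ : ℕ) : Fintype (CyclicSetPartition n ℓ) :=
  inferInstanceAs (Fintype (Quotient (OrderedSetPartition.rotationSetoid n ℓ)))

theorem cyclicIntegral_rotate {ℓ : ℕ} (y : Fin ℓ → ℝ) (m : ℕ) :
    cyclicIntegral (fun j => y ((finRotate ℓ ^ m) j)) = cyclicIntegral y := by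
  set ρ : Equiv.Perm (Fin ℓ) := finRotate ℓ ^ m with hρ
  have hcomm : ∀ j, ρ (finRotate ℓ j) = finRotate ℓ (ρ j) := by
    intro j
    rw [hρ, ← Equiv.Perm.mul_apply, ← Equiv.Perm.mul_apply, ← pow_succ, ← pow_succ']
  have hmp := volume_measurePreserving_piCongrLeft (fun _ : Fin ℓ => ℝ) ρ.symm
  have hint : ∫ f : Fin ℓ → ℝ, cyclicIntegrand (fun j => y (ρ j)) f
      = ∫ f : Fin ℓ → ℝ, cyclicIntegrand y f := by
    rw [← hmp.integral_comp' (g := cyclicIntegrand (fun j => y (ρ j)))]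
    congr 1
    funext f
    have hf : ∀ j, (MeasurableEquiv.piCongrLeft (fun _ : Fin ℓ => ℝ) ρ.symm) f j = f (ρ j) := by
      intro j
      have := Equiv.piCongrLeft_apply_apply (fun _ : Fin ℓ => ℝ) ρ.symm f (ρ j)
      simp only [Equiv.symm_apply_apply] at this
      exact this
    simp only [cyclicIntegrand, hf, hcomm]
    congr 1
    · rw [Equiv.prod_comp ρ (fun j => Real.exp (-(f j) ^ 2 / (2 * y j)) / y j)]
    · exact Equiv.prod_comp ρ (fun j =>
        (Complex.I * ((f j / y j - f (finRotate ℓ j) / y (finRotate ℓ j) : ℝ) : ℂ) -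
          (((y j + y (finRotate ℓ j)) / 2 : ℝ) : ℂ)))
  have hsum : ∑ j, y (ρ j) ^ 3 = ∑ j, y j ^ 3 := Equiv.sum_comp ρ (fun j => y j ^ 3)
  simp only [cyclicIntegral, hint, hsum]

/-- The cyclic Gaussian integral attached to a cyclically ordered partition: its value at the block
sums `x_{I_1}, …, x_{I_ℓ}` of any representative. -/
def CyclicSetPartition.integral {n ℓ : ℕ} (x : Fin n → ℝ) (c : CyclicSetPartition n ℓ) : ℂ :=
  Quotient.lift (fun I : OrderedSetPartition n ℓ => cyclicIntegral (I.blockSum x))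
    (by
      rintro I I' ⟨m, hm⟩
      have h : I'.blockSum x = fun j => I.blockSum x ((finRotate ℓ ^ m) j) := by
        funext j
        simp only [OrderedSetPartition.blockSum, hm]
      show cyclicIntegral (I.blockSum x) = cyclicIntegral (I'.blockSum x)
      rw [h, cyclicIntegral_rotate]) c

end

/-! Put z_j = i a_j / x_j and ω(a,b) = x_a x_b (z_a - z_b) / 2. The ζ-factor of a letter is 2 sinh
of its total ω-pairing with the letters before it. Expanding each sinh puts the letter at the right
end, or with a minus sign at the left end, of the word built so far. A shuffle identity for chains
of simple fractions then turns ∏ x_j · P_n into the sum over all n! orderings of e^{∑_{a before b}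
ω(a,b)} ∏ 1/(z_a - z_{a+1}) (`sum_chainProd_mul_sinhProd`, `buryakP_eq_symSum`).

Single terms have poles, their sum has none: scaling ω by θ ∈ [0,1] gives a differential equation
whose right side involves only smaller sets, hence a uniform bound (`hasDerivAt_symSum`,
`exists_norm_symSum_le`). This yields absolute convergence and allows z_j to be shifted to z_j + ε j
with ε → 0+. For ε > 0 each fraction is a Laplace integral over the half-line selected by the sign
of its real part, and the Gaussian integral over a becomes a product of Airy heat kernels K along a
path from 0 to 0 (`integral_gaussian_div`, `prod_exp_chainShift`, `integral_gaussian_symSum`).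

In the limit an ascent carries the weight -1_{[0,∞)}, a descent 1_{(-∞,0]} = 1 - 1_{[0,∞)} almost
everywhere. Expanding the descents, the constant 1 fuses two kernels by K_x K_y = K_{x+y}. Fused
letters form decreasing runs, which are the same thing as sets, so orderings turn into ordered set
partitions with -1_{[0,∞)} at every junction (`sum_headIntegral_eq`, `sum_pathIntegral_orderings`).

On the cyclic side the ℓ denominators add up to -∑ y_j. Multiplying by this sum removes one
denominator in all ℓ ways, which cuts the cycle open at each place (`neg_cyclicIntegral_eq`). Block
sums always total ∑ x_i and a cyclic partition has exactly ℓ rotations; this gives (1). For (2) the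
half-line representation is applied to all ℓ denominators, followed by the dilation s ↦ 2^{1/3} s
(`cyclicIntegral_eq_okounkovE`). -/

noncomputable section

/-! ### The Airy heat kernel -/

/-- The kernel `e^{x³/24} (2πx)^{-1/2} exp(-(r-s)²/(2x) - (r+s)x/2)` of the Airy semigroup. -/
def airyKernel (x r s : ℝ) : ℝ :=
  Real.exp (x ^ 3 / 24) / Real.sqrt (2 * Real.pi * x) *
    Real.exp (-(r - s) ^ 2 / (2 * x) - (r + s) * x / 2)

theorem airyKernel_nonneg (x r s : ℝ) : 0 ≤ airyKernel x r s := by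
  unfold airyKernel; positivity

theorem measurable_airyKernel {α : Type*} [MeasurableSpace α] (x : ℝ) {f g : α → ℝ}
    (hf : Measurable f) (hg : Measurable g) : Measurable fun a => airyKernel x (f a) (g a) := by
  unfold airyKernel; fun_prop

/-- Completing the square in `s` leaves a Gaussian of total mass 1. The defect xy(x+y)/8 between
(x+y)³/24 and x³/24 + y³/24 is absorbed by the completion; this is what the cubic normalisation is
for. -/
theorem airyKernel_mul {x y : ℝ} (hx : 0 < x) (hy : 0 < y) (r s t : ℝ) :
    airyKernel x r s * airyKernel y s t =
      airyKernel (x + y) r t * (Real.sqrt ((x + y) / (2 * Real.pi * x * y)) *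
        Real.exp (-((x + y) / (2 * x * y)) *
          (s - (r * y + t * x - x * y * (x + y) / 2) / (x + y)) ^ 2)) := by
  have hpi := Real.pi_pos
  have h1 : Real.sqrt ((x + y) / (2 * Real.pi * x * y)) =
      Real.sqrt (2 * Real.pi * (x + y)) /
        (Real.sqrt (2 * Real.pi * x) * Real.sqrt (2 * Real.pi * y)) := by
    rw [← Real.sqrt_mul (by positivity), ← Real.sqrt_div (by positivity)]
    congr 1; field_simp
  have h2 : Real.sqrt (2 * Real.pi * (x + y)) ≠ 0 := by positivity
  unfold airyKernel
  rw [h1]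
  have h3 : ∀ A B C D E F : ℝ, A / B * C * (D / E * F) = A * C * D * F / (B * E) := by
    intros; ring
  rw [h3, ← Real.exp_add, ← Real.exp_add, ← Real.exp_add]
  have h4 : ∀ A B C D E F : ℝ, B ≠ 0 → A / B * C * (B / D * E) = (A * C * E) / D := by
    intro A B C D E _ h; field_simp
  rw [h4 _ _ _ _ _ 0 h2, ← Real.exp_add, ← Real.exp_add]
  congr 2
  field_simp
  ring

theorem integrable_airyKernel_mul {x y : ℝ} (hx : 0 < x) (hy : 0 < y) (r t : ℝ) :
    Integrable fun s => airyKernel x r s * airyKernel y s t := by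
  simp_rw [airyKernel_mul hx hy]
  have h := (integrable_exp_neg_mul_sq (b := (x + y) / (2 * x * y)) (by positivity)).comp_sub_right
    ((r * y + t * x - x * y * (x + y) / 2) / (x + y))
  exact (h.const_mul _).const_mul _

theorem integral_airyKernel_mul {x y : ℝ} (hx : 0 < x) (hy : 0 < y) (r t : ℝ) :
    ∫ s, airyKernel x r s * airyKernel y s t = airyKernel (x + y) r t := by
  have hpi := Real.pi_pos
  simp_rw [airyKernel_mul hx hy]
  rw [integral_const_mul, integral_const_mul,
    integral_sub_right_eq_self (fun s => Real.exp (-((x + y) / (2 * x * y)) * s ^ 2)),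
    integral_gaussian, ← Real.sqrt_mul (by positivity)]
  have : (x + y) / (2 * Real.pi * x * y) * (Real.pi / ((x + y) / (2 * x * y))) = 1 := by
    field_simp
  rw [this, Real.sqrt_one, mul_one]

/-! ### Iterated integrals along a path -/

section Path

variable {ι : Type*} (x : ι → ℝ) (h : ι → ι → ℝ → ℝ)

/-- For a list `i₀, …, i_m`, the iterated integral of
`K_{x_{i₀}}(r, s₁) h_{i₀ i₁}(s₁) K_{x_{i₁}}(s₁, s₂) ⋯ K_{x_{i_m}}(s_m, 0)` over `s₁, …, s_m`. -/
def pathIntegral : List ι → ℝ → ℝ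
  | [], _ => 0
  | [i], r => airyKernel (x i) r 0
  | i :: j :: l, r => ∫ s, h i j s * (airyKernel (x i) r s * pathIntegral (j :: l) s)

variable {x h}

theorem sum_map_pos (hx : ∀ i, 0 < x i) (i : ι) (l : List ι) : 0 < ((i :: l).map x).sum := by
  rw [List.map_cons, List.sum_cons]
  have : 0 ≤ (l.map x).sum := List.sum_nonneg (by simpa using fun a _ => (hx a).le)
  linarith [hx i]

/-- With all weights bounded by 1, the semigroup law collapses the path to one kernel of the total
parameter. This is the majorant behind every later integrability claim. -/
theorem pathIntegral_measurable_and_abs_le (hx : ∀ i, 0 < x i) (hm : ∀ i j, Measurable (h i j))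
    (h1 : ∀ i j s, |h i j s| ≤ 1) (l : List ι) :
    ∀ i, Measurable (pathIntegral x h (i :: l)) ∧
      ∀ r, |pathIntegral x h (i :: l) r| ≤ airyKernel ((i :: l).map x).sum r 0 := by
  induction l with
  | nil =>
    intro i
    simp only [pathIntegral, List.map_cons, List.map_nil, List.sum_cons, List.sum_nil, add_zero]
    exact ⟨measurable_airyKernel _ measurable_id measurable_const,
      fun r => (abs_of_nonneg (airyKernel_nonneg _ _ _)).le⟩
  | cons j l ih =>
    intro i
    obtain ⟨ihm, ihb⟩ := ih j
    constructor
    · have : StronglyMeasurable (Function.uncurry fun r s =>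
          h i j s * (airyKernel (x i) r s * pathIntegral x h (j :: l) s)) := by
        apply Measurable.stronglyMeasurable
        have h1 := measurable_airyKernel (x i) (measurable_fst (α := ℝ) (β := ℝ)) measurable_snd
        have h2 := ihm.comp (measurable_snd : Measurable (Prod.snd : ℝ × ℝ → ℝ))
        have h3 := (hm i j).comp (measurable_snd : Measurable (Prod.snd : ℝ × ℝ → ℝ))
        exact h3.mul (h1.mul h2)
      exact this.integral_prod_right.measurable
    · intro r
      rw [pathIntegral, List.map_cons, List.sum_cons,
        ← integral_airyKernel_mul (hx i) (sum_map_pos hx j l), ← Real.norm_eq_abs]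
      refine norm_integral_le_of_norm_le
        (integrable_airyKernel_mul (hx i) (sum_map_pos hx j l) r 0) (ae_of_all _ fun s => ?_)
      rw [norm_mul, norm_mul, Real.norm_eq_abs, Real.norm_eq_abs, Real.norm_eq_abs,
        abs_of_nonneg (airyKernel_nonneg _ _ _)]
      calc |h i j s| * (airyKernel (x i) r s * |pathIntegral x h (j :: l) s|)
          ≤ 1 * (airyKernel (x i) r s * airyKernel ((j :: l).map x).sum s 0) := by
            gcongr
            · exact mul_nonneg (airyKernel_nonneg _ _ _) (abs_nonneg _)
            · exact h1 i j s
            · exact airyKernel_nonneg _ _ _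
            · exact ihb s
        _ = _ := one_mul _

theorem integrable_pathIntegral_step (hx : ∀ i, 0 < x i) (hm : ∀ i j, Measurable (h i j))
    (h1 : ∀ i j s, |h i j s| ≤ 1) {g : ℝ → ℝ} (hg : Measurable g) (hg1 : ∀ s, |g s| ≤ 1)
    {y : ℝ} (hy : 0 < y) (j : ι) (l : List ι) (r : ℝ) :
    Integrable fun s => g s * (airyKernel y r s * pathIntegral x h (j :: l) s) := by
  obtain ⟨hpm, hpb⟩ := pathIntegral_measurable_and_abs_le hx hm h1 l j
  refine (integrable_airyKernel_mul hy (sum_map_pos hx j l) r 0).mono'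
    (hg.mul ((measurable_airyKernel _ measurable_const measurable_id).mul hpm)).aestronglyMeasurable
    (ae_of_all _ fun s => ?_)
  rw [norm_mul, norm_mul, Real.norm_eq_abs, Real.norm_eq_abs, Real.norm_eq_abs,
    abs_of_nonneg (airyKernel_nonneg _ _ _)]
  calc |g s| * (airyKernel y r s * |pathIntegral x h (j :: l) s|)
      ≤ 1 * (airyKernel y r s * airyKernel ((j :: l).map x).sum s 0) := by
        gcongr
        · exact mul_nonneg (airyKernel_nonneg _ _ _) (abs_nonneg _)
        · exact hg1 s
        · exact airyKernel_nonneg _ _ _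
        · exact hpb s
    _ = _ := one_mul _

/-- The integrand whose iterated integral is `pathIntegral`. -/
def pathIntegrand {m : ℕ} (x : ι → ℝ) (h : ι → ι → ℝ → ℝ) (v : Fin (m + 1) → ι) (r : ℝ)
    (s : Fin m → ℝ) : ℝ :=
  (∏ k : Fin m, h (v k.castSucc) (v k.succ) (s k)) *
    ∏ k : Fin (m + 1),
      airyKernel (x (v k)) ((Fin.cons r s : Fin (m + 1) → ℝ) k) ((Fin.snoc s 0 : Fin (m + 1) → ℝ) k)

theorem pathIntegrand_cons {m : ℕ} (v : Fin (m + 2) → ι) (r s₀ : ℝ) (s : Fin m → ℝ) :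
    pathIntegrand x h v r (Fin.cons s₀ s : Fin (m + 1) → ℝ) =
      h (v 0) (v 1) s₀ * (airyKernel (x (v 0)) r s₀ * pathIntegrand x h (Fin.tail v) s₀ s) := by
  unfold pathIntegrand
  rw [Fin.prod_univ_succ, Fin.prod_univ_succ (n := m + 1)]
  have hs : (Fin.snoc (Fin.cons s₀ s : Fin (m + 1) → ℝ) (0 : ℝ) : Fin (m + 2) → ℝ) =
      Fin.cons s₀ (Fin.snoc s 0 : Fin (m + 1) → ℝ) := (Fin.cons_snoc_eq_snoc_cons s₀ s 0).symm
  rw [hs]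
  simp only [Fin.cons_zero, Fin.cons_succ, Fin.castSucc_zero, Fin.succ_zero_eq_one, Fin.tail,
    Fin.succ_castSucc]
  ring

theorem measurable_pathIntegrand (hm : ∀ i j, Measurable (h i j)) {m : ℕ} (v : Fin (m + 1) → ι) :
    Measurable fun p : ℝ × (Fin m → ℝ) => pathIntegrand x h v p.1 p.2 := by
  unfold pathIntegrand
  refine Measurable.mul ?_ ?_
  · refine Finset.measurable_prod _ fun k _ => (hm _ _).comp ?_
    fun_prop
  · refine Finset.measurable_prod _ fun k _ => measurable_airyKernel _ ?_ ?_
    · refine Fin.cases ?_ (fun j => ?_) k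
      · simpa using measurable_fst
      · simp only [Fin.cons_succ]; fun_prop
    · refine Fin.lastCases ?_ (fun j => ?_) k
      · simp
      · simp only [Fin.snoc_castSucc]; fun_prop

theorem pathIntegrand_abs {m : ℕ} (v : Fin (m + 1) → ι) (r : ℝ) (s : Fin m → ℝ) :
    |pathIntegrand x h v r s| = pathIntegrand x (fun i j s => |h i j s|) v r s := by
  unfold pathIntegrand
  rw [abs_mul, Finset.abs_prod, Finset.abs_prod]
  congr 1
  exact Finset.prod_congr rfl fun k _ => abs_of_nonneg (airyKernel_nonneg _ _ _)

/-- Fubini, one variable at a time. The weight is quantified inside the induction because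
integrability on the product needs the hypothesis for |h| as well as for h. -/
theorem integrable_and_integral_pathIntegrand (hx : ∀ i, 0 < x i) {m : ℕ} :
    ∀ (h : ι → ι → ℝ → ℝ) (_ : ∀ i j, Measurable (h i j)) (_ : ∀ i j s, |h i j s| ≤ 1)
      (v : Fin (m + 1) → ι) (r : ℝ), Integrable (pathIntegrand x h v r) ∧
      ∫ s, pathIntegrand x h v r s = pathIntegral x h (List.ofFn v) r := by
  induction m with
  | zero =>
    intro h hm h1 v r
    have : pathIntegrand x h v r = fun _ => airyKernel (x (v 0)) r 0 := by
      funext s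
      simp [pathIntegrand, Fin.snoc]
    rw [this]
    refine ⟨?_, ?_⟩
    · have : IsFiniteMeasure (volume : Measure (Fin 0 → ℝ)) := by
        rw [volume_pi, Measure.pi_of_empty _ (fun i => i.elim0)]; infer_instance
      exact integrable_const _
    · rw [integral_const]
      simp [pathIntegral, measureReal_def, volume_pi]
  | succ m ih =>
    intro h hm h1 v r
    have hmp := (volume_preserving_piFinSuccAbove (fun _ : Fin (m + 1) => ℝ) 0).symm
    have hcomp : ∀ p : ℝ × (Fin m → ℝ),
        pathIntegrand x h v r
            ((MeasurableEquiv.piFinSuccAbove (fun _ : Fin (m + 1) => ℝ) 0).symm p) =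
          h (v 0) (v 1) p.1 * (airyKernel (x (v 0)) r p.1 *
            pathIntegrand x h (Fin.tail v) p.1 p.2) := by
      intro p
      rw [← pathIntegrand_cons]
      congr 1
      exact Fin.insertNth_zero' p.1 p.2
    have hinteg : Integrable (fun p : ℝ × (Fin m → ℝ) =>
        h (v 0) (v 1) p.1 * (airyKernel (x (v 0)) r p.1 *
            pathIntegrand x h (Fin.tail v) p.1 p.2)) := by
      have hmeas : Measurable (fun p : ℝ × (Fin m → ℝ) =>
          h (v 0) (v 1) p.1 * (airyKernel (x (v 0)) r p.1 *
            pathIntegrand x h (Fin.tail v) p.1 p.2)) :=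
        ((hm _ _).comp measurable_fst).mul
          ((measurable_airyKernel _ measurable_const measurable_fst).mul
            (measurable_pathIntegrand hm _))
      refine (integrable_prod_iff hmeas.aestronglyMeasurable).2 ⟨ae_of_all _ fun s₀ => ?_, ?_⟩
      · exact (((ih h hm h1 (Fin.tail v) s₀).1).const_mul (airyKernel (x (v 0)) r s₀)).const_mul
          (h (v 0) (v 1) s₀)
      · have habs := ih (fun i j s => |h i j s|) (fun i j => (hm i j).abs)
          (fun i j s => by rw [abs_abs]; exact h1 i j s) (Fin.tail v)
        have : (fun s₀ => ∫ s, ‖h (v 0) (v 1) s₀ * (airyKernel (x (v 0)) r s₀ *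
            pathIntegrand x h (Fin.tail v) s₀ s)‖) =
            fun s₀ => |h (v 0) (v 1) s₀| * (airyKernel (x (v 0)) r s₀ *
              pathIntegral x (fun i j s => |h i j s|) (List.ofFn (Fin.tail v)) s₀) := by
          funext s₀
          simp_rw [norm_mul, Real.norm_eq_abs, pathIntegrand_abs]
          rw [integral_const_mul, integral_const_mul, (habs s₀).2,
            abs_of_nonneg (airyKernel_nonneg _ _ _)]
        rw [this, List.ofFn_succ]
        exact integrable_pathIntegral_step hx (fun i j => (hm i j).abs)
          (fun i j s => by rw [abs_abs]; exact h1 i j s) ((hm _ _).abs)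
          (fun s => by rw [abs_abs]; exact h1 _ _ s) (hx _) _ _ r
    constructor
    · rw [← hmp.integrable_comp_emb (MeasurableEquiv.measurableEmbedding _)]
      exact hinteg.congr (ae_of_all _ fun p => (hcomp p).symm)
    · rw [← hmp.integral_comp']
      simp_rw [hcomp]
      rw [Measure.volume_eq_prod] at hinteg ⊢
      rw [integral_prod _ hinteg]
      simp_rw [integral_const_mul, (ih h hm h1 (Fin.tail v) _).2]
      simp only [List.ofFn_succ, Fin.tail, pathIntegral]
      rfl

end Path

/-! ### Gaussian integrals of products of simple fractions -/

/-- The weight with `∫ halfLineWeight δ s e^{s z} ds = 1 / z` when `Re z = δ ≠ 0`. -/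
def halfLineWeight (δ s : ℝ) : ℝ :=
  if δ < 0 then (if 0 ≤ s then -1 else 0) else (if s ≤ 0 then 1 else 0)

theorem measurable_halfLineWeight (δ : ℝ) : Measurable (halfLineWeight δ) := by
  unfold halfLineWeight
  split_ifs
  · exact Measurable.ite measurableSet_Ici measurable_const measurable_const
  · exact Measurable.ite measurableSet_Iic measurable_const measurable_const

theorem abs_halfLineWeight_le (δ s : ℝ) : |halfLineWeight δ s| ≤ 1 := by
  unfold halfLineWeight
  split_ifs <;> simp

theorem halfLineWeight_of_neg {δ : ℝ} (hδ : δ < 0) :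
    halfLineWeight δ = fun s => if 0 ≤ s then -1 else 0 := by
  funext s; simp [halfLineWeight, hδ]

theorem halfLineWeight_of_pos {δ : ℝ} (hδ : 0 < δ) :
    halfLineWeight δ = fun s => if s ≤ 0 then 1 else 0 := by
  funext s; simp [halfLineWeight, hδ.not_gt]

theorem halfLineWeight_const_mul {ε : ℝ} (hε : 0 < ε) (δ : ℝ) :
    halfLineWeight (ε * δ) = halfLineWeight δ := by
  funext s
  simp only [halfLineWeight, mul_neg_iff, hε, hε.not_gt, true_and, false_and, or_false]

/-- On the support of the weight, `s` and `δ` have opposite signs, so the exponential is at most 1.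
This gives the domination as ε → 0. -/
theorem halfLineWeight_mul_exp_abs_le (δ s : ℝ) :
    |halfLineWeight δ s * Real.exp (s * δ)| ≤ |halfLineWeight δ s| := by
  rw [abs_mul, abs_of_pos (Real.exp_pos _)]
  unfold halfLineWeight
  split_ifs with h1 h2 h2
  · simp only [abs_neg, abs_one, one_mul, Real.exp_le_one_iff]
    nlinarith
  · simp
  · simp only [abs_one, one_mul, Real.exp_le_one_iff]
    nlinarith
  · simp

theorem integrable_and_integral_halfLineWeight {δ : ℝ} (hδ : δ ≠ 0) (β : ℝ) :
    Integrable (fun s : ℝ => (halfLineWeight δ s : ℂ) *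
        Complex.exp ((s : ℂ) * (Complex.I * β + δ))) ∧
      ∫ s : ℝ, (halfLineWeight δ s : ℂ) * Complex.exp ((s : ℂ) * (Complex.I * β + δ)) =
        (Complex.I * β + δ)⁻¹ := by
  have hre : (Complex.I * β + δ).re = δ := by simp
  rcases lt_or_gt_of_ne hδ with h | h
  · have hf : (fun s : ℝ => (halfLineWeight δ s : ℂ) *
        Complex.exp ((s : ℂ) * (Complex.I * β + δ))) =
        (Set.Ici 0).indicator fun s : ℝ => -Complex.exp ((Complex.I * β + δ) * s) := by
      funext s
      rw [halfLineWeight_of_neg h]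
      by_cases hs : 0 ≤ s <;> simp [Set.indicator, hs, mul_comm]
    have hi := integrableOn_exp_mul_complex_Ioi (a := Complex.I * β + δ) (by rwa [hre]) 0
    rw [hf, integrable_indicator_iff measurableSet_Ici, integral_indicator measurableSet_Ici,
      integrableOn_Ici_iff_integrableOn_Ioi, integral_Ici_eq_integral_Ioi, integral_neg,
      integral_exp_mul_complex_Ioi (by rwa [hre])]
    exact ⟨hi.neg, by simp [neg_div]⟩
  · have hf : (fun s : ℝ => (halfLineWeight δ s : ℂ) *
        Complex.exp ((s : ℂ) * (Complex.I * β + δ))) =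
        (Set.Iic 0).indicator fun s : ℝ => Complex.exp ((Complex.I * β + δ) * s) := by
      funext s
      rw [halfLineWeight_of_pos h]
      by_cases hs : s ≤ 0 <;> simp [Set.indicator, hs, mul_comm]
    have hi := integrableOn_exp_mul_complex_Iic (a := Complex.I * β + δ) (by rwa [hre]) 0
    rw [hf, integrable_indicator_iff measurableSet_Iic, integral_indicator measurableSet_Iic,
      integral_exp_mul_complex_Iic (by rwa [hre])]
    exact ⟨hi, by simp⟩

theorem integrable_exp_neg_sq_div {x : ℝ} (hx : 0 < x) :
    Integrable fun a : ℝ => Real.exp (-a ^ 2 / (2 * x)) := by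
  convert integrable_exp_neg_mul_sq (b := 1 / (2 * x)) (by positivity) using 3
  ring

theorem integral_exp_neg_sq_div_mul_cexp {x : ℝ} (hx : 0 < x) (c : ℝ) :
    ∫ a : ℝ, (Real.exp (-a ^ 2 / (2 * x)) : ℂ) * Complex.exp (Complex.I * c * a) =
      (Real.sqrt (2 * Real.pi * x) * Real.exp (-x * c ^ 2 / 2) : ℝ) := by
  have h := fourierIntegral_gaussian (b := ((1 / (2 * x) : ℝ) : ℂ))
    (by rw [Complex.ofReal_re]; positivity) c
  have h1 : (Real.pi : ℂ) / ((1 / (2 * x) : ℝ) : ℂ) = ((2 * Real.pi * x : ℝ) : ℂ) := by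
    push_cast; field_simp
  rw [h1, show (1 / 2 : ℂ) = ((1 / 2 : ℝ) : ℂ) by push_cast; rfl,
    ← Complex.ofReal_cpow (by have := Real.pi_pos; positivity), ← Real.sqrt_eq_rpow] at h
  rw [Complex.ofReal_mul]
  refine Eq.trans ?_ (h.trans ?_)
  · congr 1
    funext a
    rw [mul_comm]
    congr 1
    push_cast
    congr 1
    have : (x : ℂ) ≠ 0 := by exact_mod_cast hx.ne'
    field_simp
  · congr 1
    push_cast
    congr 1
    have : (x : ℂ) ≠ 0 := by exact_mod_cast hx.ne'
    field_simp
    ring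

section Fourier

variable {ι κ : Type*} [Fintype ι] [Fintype κ] {x : ι → ℝ} (c : ι → ℝ) (M : κ → ι → ℝ) {δ : κ → ℝ}

/-- Every exponent containing `a` is purely imaginary, so the modulus factors into a Gaussian in `a`
and decaying half-line exponentials in `s`. -/
theorem integrable_gaussian_mul_weights (hx : ∀ j, 0 < x j) (hδ : ∀ q, δ q ≠ 0) :
    Integrable (fun p : (ι → ℝ) × (κ → ℝ) =>
      ((∏ j, Real.exp (-(p.1 j) ^ 2 / (2 * x j)) : ℝ) : ℂ) *
        Complex.exp (Complex.I * (∑ j, c j * p.1 j : ℝ)) *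
        ∏ q, (halfLineWeight (δ q) (p.2 q) : ℂ) *
          Complex.exp ((p.2 q : ℂ) * (Complex.I * (∑ j, M q j * p.1 j : ℝ) + δ q))) := by
  have h1 : Integrable fun a : ι → ℝ => ∏ j, Real.exp (-(a j) ^ 2 / (2 * x j)) :=
    Integrable.fintype_prod (f := fun j (a : ℝ) => Real.exp (-a ^ 2 / (2 * x j)))
      fun j => integrable_exp_neg_sq_div (hx j)
  have h2 : Integrable fun s : κ → ℝ => ∏ q, (halfLineWeight (δ q) (s q) : ℂ) *
      Complex.exp ((s q : ℂ) * (Complex.I * (0 : ℝ) + δ q)) :=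
    Integrable.fintype_prod (f := fun q (s : ℝ) => (halfLineWeight (δ q) s : ℂ) *
      Complex.exp ((s : ℂ) * (Complex.I * (0 : ℝ) + δ q)))
      fun q => (integrable_and_integral_halfLineWeight (hδ q) 0).1
  refine (h1.mul_prod h2.norm).mono' ?_ (ae_of_all _ fun p => ?_)
  · refine Measurable.aestronglyMeasurable ?_
    refine Measurable.mul (by fun_prop) (Finset.measurable_prod _ fun q _ => ?_)
    have := (measurable_halfLineWeight (δ q)).comp
      ((measurable_pi_apply q).comp
        (measurable_snd : Measurable (Prod.snd : (ι → ℝ) × (κ → ℝ) → _)))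
    refine Measurable.mul (Complex.measurable_ofReal.comp this) (by fun_prop)
  · simp only [norm_mul, norm_prod, Complex.norm_real, Complex.norm_exp]
    refine le_of_eq ?_
    simp

theorem integrable_gaussian_div (hx : ∀ j, 0 < x j) (hδ : ∀ q, δ q ≠ 0) :
    Integrable (fun a : ι → ℝ =>
      ((∏ j, Real.exp (-(a j) ^ 2 / (2 * x j)) : ℝ) : ℂ) *
        Complex.exp (Complex.I * (∑ j, c j * a j : ℝ)) *
        ∏ q, (Complex.I * (∑ j, M q j * a j : ℝ) + δ q)⁻¹) := by
  have h := (integrable_gaussian_mul_weights c M hx hδ).integral_prod_left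
  simp_rw [integral_const_mul] at h
  convert h using 3 with a
  rw [integral_fintype_prod_volume_eq_prod (fun q (s : ℝ) => (halfLineWeight (δ q) s : ℂ) *
          Complex.exp ((s : ℂ) * (Complex.I * (∑ j, M q j * a j : ℝ) + δ q)))]
  exact Finset.prod_congr rfl fun q _ => (integrable_and_integral_halfLineWeight (hδ q) _).2.symm

/-- The common engine for Buryak's side and the cyclic side: each fraction becomes a half-line
integral, the order of integration is exchanged, and the `a`-integral splits into one-dimensional
Gaussian Fourier transforms. -/
theorem integral_gaussian_div (hx : ∀ j, 0 < x j) (hδ : ∀ q, δ q ≠ 0) :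
    ∫ a : ι → ℝ, ((∏ j, Real.exp (-(a j) ^ 2 / (2 * x j)) : ℝ) : ℂ) *
        Complex.exp (Complex.I * (∑ j, c j * a j : ℝ)) *
        ∏ q, (Complex.I * (∑ j, M q j * a j : ℝ) + δ q)⁻¹ =
      ((∏ j, Real.sqrt (2 * Real.pi * x j)) * ∫ s : κ → ℝ,
        (∏ q, halfLineWeight (δ q) (s q) * Real.exp (s q * δ q)) *
          ∏ j, Real.exp (-x j * (c j + ∑ q, s q * M q j) ^ 2 / 2) : ℝ) := by
  have hswap := integral_integral_swap (μ := volume) (ν := volume)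
    (f := fun (a : ι → ℝ) (s : κ → ℝ) =>
      ((∏ j, Real.exp (-(a j) ^ 2 / (2 * x j)) : ℝ) : ℂ) *
        Complex.exp (Complex.I * (∑ j, c j * a j : ℝ)) *
        ∏ q, (halfLineWeight (δ q) (s q) : ℂ) *
          Complex.exp ((s q : ℂ) * (Complex.I * (∑ j, M q j * a j : ℝ) + δ q)))
    (integrable_gaussian_mul_weights c M hx hδ)
  calc _ = _ := ?_
    _ = _ := hswap
    _ = _ := ?_
  · refine integral_congr_ae (ae_of_all _ fun a => ?_)
    simp only
    rw [integral_const_mul, integral_fintype_prod_volume_eq_prod (fun q (s : ℝ) =>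
      (halfLineWeight (δ q) s : ℂ) *
          Complex.exp ((s : ℂ) * (Complex.I * (∑ j, M q j * a j : ℝ) + δ q)))]
    congr 1
    exact Finset.prod_congr rfl fun q _ => (integrable_and_integral_halfLineWeight (hδ q) _).2.symm
  · rw [← integral_const_mul, ← integral_complex_ofReal]
    refine integral_congr_ae (ae_of_all _ fun s => ?_)
    simp only
    have hpt : ∀ a : ι → ℝ, ((∏ j, Real.exp (-(a j) ^ 2 / (2 * x j)) : ℝ) : ℂ) *
        Complex.exp (Complex.I * (∑ j, c j * a j : ℝ)) *
        (∏ q, (halfLineWeight (δ q) (s q) : ℂ) *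
          Complex.exp ((s q : ℂ) * (Complex.I * (∑ j, M q j * a j : ℝ) + δ q))) =
        ((∏ q, halfLineWeight (δ q) (s q) * Real.exp (s q * δ q) : ℝ) : ℂ) *
        ∏ j, ((Real.exp (-(a j) ^ 2 / (2 * x j)) : ℂ) *
          Complex.exp (Complex.I * (c j + ∑ q, s q * M q j : ℝ) * a j)) := by
      intro a
      simp only [Finset.prod_mul_distrib, Complex.ofReal_prod, Complex.ofReal_mul,
        Complex.ofReal_exp, ← Complex.exp_sum]
      -- The exponent is regrouped by the coordinates `a j`, with the real part of each fraction
      -- split off.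
      have : (∑ q, (s q : ℂ) * (Complex.I * ((∑ j, M q j * a j : ℝ) : ℂ) + δ q)) +
          Complex.I * ((∑ j, c j * a j : ℝ) : ℂ) =
          (∑ q, (s q : ℂ) * δ q) + ∑ j, Complex.I * ((c j + ∑ q, s q * M q j : ℝ) : ℂ) * a j := by
        simp only [mul_add, Finset.sum_add_distrib]
        push_cast
        simp only [mul_add, add_mul, Finset.sum_add_distrib, Finset.mul_sum, Finset.sum_mul]
        rw [Finset.sum_comm, add_comm (∑ y, ∑ x, _) (∑ x, _), add_assoc]
        congr 1
        rw [add_comm]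
        congr 1
        · exact Finset.sum_congr rfl fun j _ => by ring
        · exact Finset.sum_congr rfl fun j _ => Finset.sum_congr rfl fun q _ => by ring
      have h2 := congrArg Complex.exp this
      rw [Complex.exp_add, Complex.exp_add] at h2
      linear_combination ((∏ q, (halfLineWeight (δ q) (s q) : ℂ)) *
        Complex.exp (∑ j, ((-(a j) ^ 2 / (2 * x j) : ℝ) : ℂ))) * h2
    simp_rw [hpt]
    rw [integral_const_mul, integral_fintype_prod_volume_eq_prod (fun j (a : ℝ) =>
      (Real.exp (-a ^ 2 / (2 * x j)) : ℂ) *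
          Complex.exp (Complex.I * (c j + ∑ q, s q * M q j : ℝ) * a))]
    simp_rw [fun j => integral_exp_neg_sq_div_mul_cexp (hx j) (c j + ∑ q, s q * M q j)]
    rw [← Complex.ofReal_prod, ← Complex.ofReal_mul,
      Finset.prod_mul_distrib (f := fun j => Real.sqrt (2 * Real.pi * x j))]
    congr 1
    rw [mul_left_comm]

end Fourier

/-! ### Orderings of a finite set -/

section Orderings

variable {ι : Type*}

/-- The lists that enumerate the finite set `S` without repetition. -/
def orderings (S : Finset ι) : Finset (List ι) := ⟨S.val.lists, Multiset.lists_nodup_finset S⟩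

theorem mem_orderings {S : Finset ι} {l : List ι} :
    l ∈ orderings S ↔ S.val = (l : Multiset ι) := by
  change l ∈ S.val.lists ↔ _
  rw [Multiset.mem_lists_iff]
  rfl

theorem sum_map_of_mem_orderings {M : Type*} [AddCommMonoid M] {S : Finset ι} {l : List ι}
    (hl : l ∈ orderings S) (f : ι → M) : (l.map f).sum = ∑ i ∈ S, f i := by
  rw [mem_orderings] at hl
  rw [Finset.sum, hl, Multiset.map_coe, Multiset.sum_coe]

theorem orderings_empty : orderings (∅ : Finset ι) = {[]} := by
  ext l
  rw [mem_orderings, Finset.mem_singleton, Finset.empty_val, eq_comm, Multiset.coe_eq_zero]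

theorem reverse_mem_orderings {S : Finset ι} {l : List ι} (hl : l ∈ orderings S) :
    l.reverse ∈ orderings S := by
  rw [mem_orderings] at hl ⊢
  rw [hl, Multiset.coe_reverse]

theorem sum_orderings_reverse {M : Type*} [AddCommMonoid M] (S : Finset ι) (f : List ι → M) :
    ∑ l ∈ orderings S, f l.reverse = ∑ l ∈ orderings S, f l :=
  Finset.sum_nbij' List.reverse List.reverse (fun _ => reverse_mem_orderings)
    (fun _ => reverse_mem_orderings) (by simp) (by simp) (by simp)

theorem nil_mem_orderings {S : Finset ι} : [] ∈ orderings S ↔ S = ∅ := by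
  rw [mem_orderings, Multiset.coe_nil, Finset.val_eq_zero]

variable [DecidableEq ι]

theorem cons_mem_orderings {S : Finset ι} {i : ι} {l : List ι} :
    i :: l ∈ orderings S ↔ i ∈ S ∧ l ∈ orderings (S.erase i) := by
  rw [mem_orderings, mem_orderings, Finset.erase_val, ← Multiset.cons_coe]
  constructor
  · intro h
    have hi : i ∈ S := by
      rw [← Finset.mem_val, h]
      exact Multiset.mem_cons_self _ _
    exact ⟨hi, by rw [h, Multiset.erase_cons_head]⟩
  · rintro ⟨hi, h⟩
    rw [← h, Multiset.cons_erase hi]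

/-- Sums over orderings, decomposed according to the first element. -/
theorem sum_orderings {M : Type*} [AddCommMonoid M] (S : Finset ι) (f : List ι → M) :
    ∑ l ∈ orderings S, f l =
      (if S = ∅ then f [] else 0) + ∑ i ∈ S, ∑ l ∈ orderings (S.erase i), f (i :: l) := by
  split_ifs with hS
  · simp [hS, orderings_empty]
  · rw [zero_add, Finset.sum_sigma']
    refine (Finset.sum_bij' (fun p _ => p.1 :: p.2)
      (fun l hl => ⟨l.head (by rintro rfl; exact hS (nil_mem_orderings.1 hl)), l.tail⟩)
      ?_ ?_ ?_ ?_ ?_).symm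
    · rintro ⟨i, l⟩ h
      exact cons_mem_orderings.2 (Finset.mem_sigma.1 h)
    · intro l hl
      match l with
      | [] => exact absurd (nil_mem_orderings.1 hl) hS
      | i :: l => exact Finset.mem_sigma.2 (cons_mem_orderings.1 hl)
    · intros; rfl
    · intro l hl
      match l with
      | [] => exact absurd (nil_mem_orderings.1 hl) hS
      | i :: l => rfl
    · intros; rfl

/-- A set with a marked element corresponds to the element together with the rest. Below, the marked
element is the first letter of one of two complementary words. -/
theorem sum_powerset_sum_mem {M : Type*} [AddCommMonoid M] (S : Finset ι)
    (f : ι → Finset ι → M) :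
    ∑ A ∈ S.powerset, ∑ a ∈ A, f a (A.erase a) =
      ∑ a ∈ S, ∑ A ∈ (S.erase a).powerset, f a A := by
  rw [Finset.sum_sigma', Finset.sum_sigma']
  refine Finset.sum_bij' (fun p _ => ⟨p.2, p.1.erase p.2⟩) (fun p _ => ⟨insert p.1 p.2, p.1⟩)
    ?_ ?_ ?_ ?_ ?_
  · rintro ⟨A, a⟩ h
    simp only [Finset.mem_sigma, Finset.mem_powerset] at h ⊢
    exact ⟨h.1 h.2, Finset.erase_subset_erase _ h.1⟩
  · rintro ⟨a, A⟩ h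
    simp only [Finset.mem_sigma, Finset.mem_powerset] at h ⊢
    exact ⟨Finset.insert_subset h.1 (h.2.trans (Finset.erase_subset _ _)),
      Finset.mem_insert_self _ _⟩
  · rintro ⟨A, a⟩ h
    simp only [Finset.mem_sigma, Finset.mem_powerset] at h ⊢
    rw [Finset.insert_erase h.2]
  · rintro ⟨a, A⟩ h
    simp only [Finset.mem_sigma, Finset.mem_powerset] at h ⊢
    rw [Finset.erase_insert fun ha => (Finset.mem_erase.1 (h.2 ha)).1 rfl]
  · intros; rfl

theorem sum_powerset_sum_notMem {M : Type*} [AddCommMonoid M] (S : Finset ι)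
    (f : ι → Finset ι → M) :
    ∑ A ∈ S.powerset, ∑ a ∈ S \ A, f a A = ∑ a ∈ S, ∑ A ∈ (S.erase a).powerset, f a A := by
  refine Finset.sum_comm' fun A a => ?_
  simp only [Finset.mem_powerset, Finset.mem_sdiff, Finset.subset_erase]
  tauto

theorem sdiff_eq_erase_sdiff_erase {S A : Finset ι} {a : ι} (ha : a ∈ A) :
    S \ A = S.erase a \ A.erase a := by
  ext b
  simp only [Finset.mem_sdiff, Finset.mem_erase]
  by_cases hb : b = a
  · simp [hb, ha]
  · simp [hb]

/-- Sums over orderings, decomposed according to the position of the element `i`. -/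
theorem sum_orderings_of_mem {M : Type*} [AddCommMonoid M] (S : Finset ι) :
    ∀ i ∈ S, ∀ f : List ι → M, ∑ l ∈ orderings S, f l =
      ∑ A ∈ (S.erase i).powerset, ∑ l ∈ orderings A, ∑ l' ∈ orderings (S.erase i \ A),
        f (l ++ i :: l') := by
  induction S using Finset.strongInduction with
  | H S ih =>
    intro i hi f
    rw [sum_orderings, if_neg (Finset.ne_empty_of_mem hi), zero_add, ← Finset.add_sum_erase _ _ hi]
    simp_rw [fun A : Finset ι => sum_orderings A fun l =>
      ∑ l' ∈ orderings (S.erase i \ A), f (l ++ i :: l')]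
    rw [Finset.sum_add_distrib]
    congr 1
    · rw [Finset.sum_ite_eq']
      simp
    · refine Eq.trans ?_ ((sum_powerset_sum_mem (S.erase i) fun a A => ∑ l ∈ orderings A,
        ∑ l' ∈ orderings ((S.erase i).erase a \ A), f (a :: l ++ i :: l')).symm.trans ?_)
      · refine Finset.sum_congr rfl fun a ha => ?_
        rw [ih _ (Finset.erase_ssubset (Finset.mem_of_mem_erase ha)) i
          (Finset.mem_erase.2 ⟨(Finset.ne_of_mem_erase ha).symm, hi⟩), Finset.erase_right_comm]
        rfl
      · refine Finset.sum_congr rfl fun A _ => Finset.sum_congr rfl fun a ha => ?_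
        rw [sdiff_eq_erase_sdiff_erase ha]

theorem sum_orderings_univ {M : Type*} [AddCommMonoid M] {n : ℕ} (f : List (Fin n) → M) :
    ∑ l ∈ orderings (Finset.univ : Finset (Fin n)), f l =
      ∑ σ : Equiv.Perm (Fin n), f (List.ofFn σ) := by
  symm
  refine Finset.sum_bij (fun σ _ => List.ofFn σ) ?_ ?_ ?_ (fun _ _ => rfl)
  · intro σ _
    rw [mem_orderings]
    refine (Multiset.Nodup.ext Finset.univ.nodup ?_).2 ?_
    · exact List.nodup_ofFn.2 σ.injective
    · intro a
      simp only [Finset.mem_val, Finset.mem_univ, Multiset.mem_coe, List.mem_ofFn, true_iff]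
      exact σ.surjective a
  · intro σ _ τ _ h
    exact DFunLike.coe_injective (List.ofFn_injective h)
  · intro l hl
    rw [mem_orderings] at hl
    have hn : l.Nodup := by
      rw [← Multiset.coe_nodup, ← hl]; exact Finset.univ.nodup
    have hlen : l.length = n := by
      rw [← Multiset.coe_card, ← hl]; simp
    have hinj : Function.Injective fun k : Fin n => l.get (k.cast hlen.symm) :=
      (List.nodup_iff_injective_get.1 hn).comp (Fin.cast_injective _)
    refine ⟨Equiv.ofBijective _ (Finite.injective_iff_bijective.1 hinj), Finset.mem_univ _, ?_⟩
    refine List.ext_get (by simp [hlen]) fun k h1 h2 => ?_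
    simp

end Orderings

/-! ### Chains of simple fractions and the shuffle identity -/

section Chain

variable {ι : Type*}

/-- The product of `1 / (z_a - z_b)` over consecutive elements of a list. -/
def chainProd (z : ι → ℂ) : List ι → ℂ
  | [] => 1
  | [_] => 1
  | a :: b :: l => (z a - z b)⁻¹ * chainProd z (b :: l)

/-- The sum of `ω a b` over all pairs with `a` before `b` in a list. -/
def pairSum (ω : ι → ι → ℂ) : List ι → ℂ
  | [] => 0
  | a :: l => (l.map (ω a)).sum + pairSum ω l

/-- The sum of `ω a b` over `a` in the first list and `b` in the second. -/
def crossSum (ω : ι → ι → ℂ) (l l' : List ι) : ℂ := (l.map fun a => (l'.map (ω a)).sum).sum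

/-- The product over the elements `j` of a list of `2 sinh (α j + ∑ ω k j)`, where `k` runs over
the elements that precede `j`. -/
def sinhProd (ω : ι → ι → ℂ) : (ι → ℂ) → List ι → ℂ
  | _, [] => 1
  | α, j :: l => (Complex.exp (α j) - Complex.exp (-α j)) * sinhProd ω (fun k => α k + ω j k) l

/-- The contribution of the word `l.reverse ++ i :: l'`. -/
def wordTerm (z : ι → ℂ) (ω : ι → ι → ℂ) (α : ι → ℂ) (i : ι) (l l' : List ι) : ℂ :=
  (-1) ^ l.length *
    Complex.exp (-(l.map α).sum + (l'.map α).sum + crossSum ω l l' - pairSum ω l + pairSum ω l') *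
    (chainProd z (i :: l) * chainProd z (i :: l'))

theorem sum_map_add_fun (l : List ι) (f g : ι → ℂ) :
    (l.map fun k => f k + g k).sum = (l.map f).sum + (l.map g).sum := by
  induction l with
  | nil => simp
  | cons a l ih => simp only [List.map_cons, List.sum_cons, ih]; ring

theorem crossSum_cons_left (ω : ι → ι → ℂ) (a : ι) (l l' : List ι) :
    crossSum ω (a :: l) l' = (l'.map (ω a)).sum + crossSum ω l l' := by
  simp [crossSum]

theorem crossSum_cons_right {ω : ι → ι → ℂ} (hω : ∀ a b, ω b a = -ω a b) (b : ι) (l l' : List ι) :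
    crossSum ω l (b :: l') = -(l.map (ω b)).sum + crossSum ω l l' := by
  induction l with
  | nil => simp [crossSum]
  | cons a l ih =>
    rw [crossSum_cons_left, crossSum_cons_left, ih]
    simp only [List.map_cons, List.sum_cons, hω b a]
    ring

/-- Reading the left half outwards from `i` reverses each of its links, and every reversed link
costs a sign. -/
theorem chainProd_reverse_append (z : ι → ℂ) (l : List ι) :
    ∀ i l', chainProd z (l.reverse ++ i :: l') =
      (-1) ^ l.length * (chainProd z (i :: l) * chainProd z (i :: l')) := by
  induction l with
  | nil => intro i l'; simp [chainProd]
  | cons a l ih =>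
    intro i l'
    rw [List.reverse_cons, List.append_assoc, List.singleton_append, ih, List.length_cons]
    simp only [chainProd]
    rw [← neg_sub (z i) (z a), inv_neg]
    ring

theorem pairSum_reverse_append {ω : ι → ι → ℂ} (hω : ∀ a b, ω b a = -ω a b) (l : List ι) :
    ∀ i l', pairSum ω (l.reverse ++ i :: l') =
      -(l.map (ω i)).sum + (l'.map (ω i)).sum + crossSum ω l l' - pairSum ω l + pairSum ω l' := by
  induction l with
  | nil => intro i l'; simp [pairSum, crossSum]
  | cons a l ih =>
    intro i l'
    rw [List.reverse_cons, List.append_assoc, List.singleton_append, ih, crossSum_cons_left,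
      crossSum_cons_right hω]
    simp only [pairSum, List.map_cons, List.sum_cons, hω a i]
    ring

theorem exp_pairSum_mul_chainProd {ω : ι → ι → ℂ} (hω : ∀ a b, ω b a = -ω a b) (z : ι → ℂ)
    (i : ι) (l l' : List ι) :
    Complex.exp (pairSum ω (l.reverse ++ i :: l')) * chainProd z (l.reverse ++ i :: l') =
      wordTerm z ω (ω i) i l l' := by
  rw [pairSum_reverse_append hω, chainProd_reverse_append, wordTerm]
  ring

theorem exp_mul_mul_exp_mul {u v w : ℂ} (h : w = u + v) (A C : ℂ) :
    Complex.exp u * (A * Complex.exp v * C) = A * Complex.exp w * C := by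
  rw [h, Complex.exp_add]
  ring

theorem wordTerm_right_aux {ω : ι → ι → ℂ} (hω : ∀ a b, ω b a = -ω a b) (z : ι → ℂ) (α : ι → ℂ)
    (b : ι) (l l' : List ι) :
    Complex.exp (α b) * wordTerm z ω (fun k => α k + ω b k) b l l' =
      (-1) ^ l.length * Complex.exp (-(l.map α).sum + ((b :: l').map α).sum +
        crossSum ω l (b :: l') - pairSum ω l + pairSum ω (b :: l')) *
        (chainProd z (b :: l) * chainProd z (b :: l')) := by
  rw [wordTerm, crossSum_cons_right hω]
  simp only [sum_map_add_fun, pairSum, List.map_cons, List.sum_cons]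
  refine exp_mul_mul_exp_mul ?_ _ _
  ring

theorem wordTerm_left_aux (ω : ι → ι → ℂ) (z : ι → ℂ) (α : ι → ℂ) (a : ι) (l l' : List ι) :
    Complex.exp (-α a) * wordTerm z ω (fun k => α k + ω a k) a l l' =
      (-1) ^ l.length * Complex.exp (-((a :: l).map α).sum + (l'.map α).sum +
        crossSum ω (a :: l) l' - pairSum ω (a :: l) + pairSum ω l') *
        (chainProd z (a :: l) * chainProd z (a :: l')) := by
  rw [wordTerm, crossSum_cons_left]
  simp only [sum_map_add_fun, pairSum, List.map_cons, List.sum_cons]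
  refine exp_mul_mul_exp_mul ?_ _ _
  ring

/-- The part of `wordTerm` in which the innermost letter comes from the right. -/
def wordTermRight (z : ι → ℂ) (ω : ι → ι → ℂ) (α : ι → ℂ) (i : ι) (l : List ι) : List ι → ℂ
  | [] => 0
  | b :: l' => (z i - z b)⁻¹ * (Complex.exp (α b) * wordTerm z ω (fun k => α k + ω b k) b l l')

/-- The part of `wordTerm` in which the innermost letter comes from the left. -/
def wordTermLeft (z : ι → ℂ) (ω : ι → ι → ℂ) (α : ι → ℂ) (i : ι) (l' : List ι) : List ι → ℂ
  | [] => 0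
  | a :: l => -((z i - z a)⁻¹ * (Complex.exp (-α a) * wordTerm z ω (fun k => α k + ω a k) a l l'))

/-- The next letter taken outwards from `i` is either the first of `l'` or the first of `l`; the two
cases are separated by expanding 1/((z_i - z_a)(z_i - z_b)) in partial fractions. If one list is
empty only one case remains, which is why not both may be empty. -/
theorem wordTerm_eq_add {ω : ι → ι → ℂ} (hω : ∀ a b, ω b a = -ω a b) (z : ι → ℂ) (α : ι → ℂ)
    (i : ι) (l l' : List ι) (hne : l ≠ [] ∨ l' ≠ [])
    (hia : ∀ a ∈ l, z i ≠ z a) (hib : ∀ b ∈ l', z i ≠ z b) (hab : ∀ a ∈ l, ∀ b ∈ l', z a ≠ z b) :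
    wordTerm z ω α i l l' = wordTermRight z ω α i l l' + wordTermLeft z ω α i l' l := by
  match l, l' with
  | [], [] => simp at hne
  | [], b :: l' =>
    simp only [wordTermRight, wordTermLeft, wordTerm_right_aux hω]
    simp only [wordTerm, chainProd]
    ring
  | a :: l, [] =>
    simp only [wordTermRight, wordTermLeft, wordTerm_left_aux]
    simp only [wordTerm, chainProd, List.length_cons]
    ring
  | a :: l, b :: l' =>
    simp only [wordTermRight, wordTermLeft, wordTerm_left_aux, wordTerm_right_aux hω]
    have h1 := sub_ne_zero.2 (hia a (by simp))
    have h2 := sub_ne_zero.2 (hib b (by simp))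
    have h3 := sub_ne_zero.2 (hab a (by simp) b (by simp))
    have h4 : (z i - z a)⁻¹ * (z i - z b)⁻¹ =
        (z i - z b)⁻¹ * (z b - z a)⁻¹ + (z i - z a)⁻¹ * (z a - z b)⁻¹ := by
      rw [← neg_sub (z a) (z b), inv_neg]
      field_simp
      ring
    simp only [wordTerm, chainProd, List.length_cons]
    linear_combination ((-1) ^ (l.length + 1) * Complex.exp (-((a :: l).map α).sum +
      ((b :: l').map α).sum + crossSum ω (a :: l) (b :: l') - pairSum ω (a :: l) +
      pairSum ω (b :: l')) * (chainProd z (a :: l) * chainProd z (b :: l'))) * h4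

theorem mem_of_mem_orderings {S : Finset ι} {l : List ι} (hl : l ∈ orderings S) {a : ι} :
    a ∈ l ↔ a ∈ S := by
  rw [mem_orderings] at hl
  rw [← Finset.mem_val, hl, Multiset.mem_coe]

variable [DecidableEq ι]

/-- The shuffle identity. The two exponentials of each sinh decide whether a letter goes to the
right or to the left half. Once `j` is placed, the induction continues with `j` in the role of `i`
and with `α + ω j`; general `α` is needed because it stores the pairings with all letters already
placed. -/
theorem sum_chainProd_mul_sinhProd {ω : ι → ι → ℂ} (hω : ∀ a b, ω b a = -ω a b) {z : ι → ℂ}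
    (hz : Function.Injective z) (S : Finset ι) :
    ∀ i ∉ S, ∀ α : ι → ℂ, ∑ l ∈ orderings S, chainProd z (i :: l) * sinhProd ω α l =
      ∑ A ∈ S.powerset, ∑ l ∈ orderings A, ∑ l' ∈ orderings (S \ A), wordTerm z ω α i l l' := by
  induction S using Finset.strongInduction with
  | H S ih =>
    intro i hi α
    by_cases hS : S = ∅
    · subst hS
      simp [orderings_empty, chainProd, sinhProd, wordTerm, crossSum, pairSum]
    have hsplit : ∀ A ∈ S.powerset, ∀ l ∈ orderings A, ∀ l' ∈ orderings (S \ A),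
        wordTerm z ω α i l l' = wordTermRight z ω α i l l' + wordTermLeft z ω α i l' l := by
      intro A hA l hl l' hl'
      rw [Finset.mem_powerset] at hA
      refine wordTerm_eq_add hω z α i l l' ?_ ?_ ?_ ?_
      · by_contra hne
        push Not at hne
        rw [hne.1, nil_mem_orderings] at hl
        rw [hne.2, nil_mem_orderings, hl, Finset.sdiff_empty] at hl'
        exact hS hl'
      · intro a ha h
        rw [mem_of_mem_orderings hl] at ha
        exact hi (hz h ▸ hA ha)
      · intro b hb h
        rw [mem_of_mem_orderings hl', Finset.mem_sdiff] at hb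
        exact hi (hz h ▸ hb.1)
      · intro a ha b hb h
        rw [mem_of_mem_orderings hl', Finset.mem_sdiff] at hb
        rw [mem_of_mem_orderings hl] at ha
        exact hb.2 (hz h ▸ ha)
    rw [Finset.sum_congr rfl fun A hA => Finset.sum_congr rfl fun l hl =>
      Finset.sum_congr rfl fun l' hl' => hsplit A hA l hl l' hl']
    simp only [Finset.sum_add_distrib]
    have hright : ∑ A ∈ S.powerset, ∑ l ∈ orderings A, ∑ l' ∈ orderings (S \ A),
        wordTermRight z ω α i l l' = ∑ j ∈ S, (z i - z j)⁻¹ * (Complex.exp (α j) *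
          ∑ l ∈ orderings (S.erase j), chainProd z (j :: l) *
            sinhProd ω (fun k => α k + ω j k) l) := by
      have : ∀ A ∈ S.powerset, ∑ l ∈ orderings A, ∑ l' ∈ orderings (S \ A),
          wordTermRight z ω α i l l' = ∑ j ∈ S \ A, ∑ l ∈ orderings A,
            ∑ l' ∈ orderings (S.erase j \ A), (z i - z j)⁻¹ * (Complex.exp (α j) *
              wordTerm z ω (fun k => α k + ω j k) j l l') := by
        intro A _
        rw [Finset.sum_comm (s := S \ A)]
        refine Finset.sum_congr rfl fun l _ => ?_
        rw [sum_orderings]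
        simp only [wordTermRight, ite_self, zero_add, Finset.erase_sdiff_comm]
      rw [Finset.sum_congr rfl this, sum_powerset_sum_notMem S fun j A => ∑ l ∈ orderings A,
            ∑ l' ∈ orderings (S.erase j \ A), (z i - z j)⁻¹ * (Complex.exp (α j) *
              wordTerm z ω (fun k => α k + ω j k) j l l')]
      refine Finset.sum_congr rfl fun j hj => ?_
      rw [ih _ (Finset.erase_ssubset hj) j (Finset.notMem_erase _ _)]
      simp only [Finset.mul_sum]
    have hleft : ∑ A ∈ S.powerset, ∑ l ∈ orderings A, ∑ l' ∈ orderings (S \ A),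
        wordTermLeft z ω α i l' l = ∑ j ∈ S, -((z i - z j)⁻¹ * (Complex.exp (-α j) *
          ∑ l ∈ orderings (S.erase j), chainProd z (j :: l) *
            sinhProd ω (fun k => α k + ω j k) l)) := by
      have : ∀ A ∈ S.powerset, ∑ l ∈ orderings A, ∑ l' ∈ orderings (S \ A),
          wordTermLeft z ω α i l' l = ∑ j ∈ A, ∑ l ∈ orderings (A.erase j),
            ∑ l' ∈ orderings (S.erase j \ A.erase j), -((z i - z j)⁻¹ * (Complex.exp (-α j) *
              wordTerm z ω (fun k => α k + ω j k) j l l')) := by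
        intro A _
        rw [sum_orderings]
        simp only [wordTermLeft, Finset.sum_const_zero, ite_self, zero_add]
        refine Finset.sum_congr rfl fun j hj => ?_
        rw [sdiff_eq_erase_sdiff_erase hj]
      rw [Finset.sum_congr rfl this, sum_powerset_sum_mem S fun j A => ∑ l ∈ orderings A,
            ∑ l' ∈ orderings (S.erase j \ A), -((z i - z j)⁻¹ * (Complex.exp (-α j) *
              wordTerm z ω (fun k => α k + ω j k) j l l'))]
      refine Finset.sum_congr rfl fun j hj => ?_
      rw [ih _ (Finset.erase_ssubset hj) j (Finset.notMem_erase _ _)]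
      simp only [Finset.mul_sum, Finset.sum_neg_distrib]
    rw [hright, hleft, ← Finset.sum_add_distrib, sum_orderings, if_neg hS, zero_add]
    refine Finset.sum_congr rfl fun j _ => ?_
    simp only [Finset.mul_sum]
    rw [← Finset.sum_neg_distrib, ← Finset.sum_add_distrib]
    refine Finset.sum_congr rfl fun l _ => ?_
    simp only [chainProd, sinhProd]
    ring

/-- The symmetric form of the sum: all orderings of `S`, or only those that start with `i`. -/
theorem sum_exp_pairSum_mul_chainProd {ω : ι → ι → ℂ} (hω : ∀ a b, ω b a = -ω a b) {z : ι → ℂ}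
    (hz : Function.Injective z) {S : Finset ι} {i : ι} (hi : i ∈ S) :
    ∑ l ∈ orderings S, Complex.exp (pairSum ω l) * chainProd z l =
      ∑ l ∈ orderings (S.erase i), chainProd z (i :: l) * sinhProd ω (ω i) l := by
  rw [sum_orderings_of_mem S i hi, sum_chainProd_mul_sinhProd hω hz _ i (Finset.notMem_erase _ _)]
  refine Finset.sum_congr rfl fun A _ => ?_
  -- The left half is enumerated outwards from `i`, hence in reverse of its order in the word.
  rw [← sum_orderings_reverse]
  simp only [exp_pairSum_mul_chainProd hω]

end Chain

/-! ### The symmetric form of Buryak's function -/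

section SymmetricForm

variable {ι : Type*}

/-- The antisymmetric form `x_a x_b (z_a - z_b) / 2`. -/
def weightForm (x z : ι → ℂ) (a b : ι) : ℂ := x a * x b * (z a - z b) / 2

theorem weightForm_antisymm (x z : ι → ℂ) (a b : ι) : weightForm x z b a = -weightForm x z a b := by
  unfold weightForm; ring

theorem chainProd_ofFn (z : ι → ℂ) {m : ℕ} (v : Fin (m + 1) → ι) :
    chainProd z (List.ofFn v) = ∏ k : Fin m, (z (v k.castSucc) - z (v k.succ))⁻¹ := by
  induction m with
  | zero => simp [chainProd]
  | succ m ih =>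
    have h := ih (fun k => v k.succ)
    rw [List.ofFn_succ] at h
    rw [List.ofFn_succ, List.ofFn_succ, chainProd, h, Fin.prod_univ_succ]
    rfl

theorem sinhProd_ofFn (ω : ι → ι → ℂ) {m : ℕ} (v : Fin m → ι) (α : ι → ℂ) :
    sinhProd ω α (List.ofFn v) =
      ∏ j, (Complex.exp (α (v j) + ∑ k, if k < j then ω (v k) (v j) else 0) -
        Complex.exp (-(α (v j) + ∑ k, if k < j then ω (v k) (v j) else 0))) := by
  induction m generalizing α with
  | zero => simp [sinhProd]
  | succ m ih =>
    rw [List.ofFn_succ, sinhProd, ih, Fin.prod_univ_succ]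
    congr 1
    · simp
    · refine Finset.prod_congr rfl fun j _ => ?_
      simp only [Fin.sum_univ_succ, Fin.succ_pos, if_true, Fin.succ_lt_succ_iff, add_assoc]

theorem prod_castSucc_eq {m : ℕ} (f : Fin (m + 2) → ℂ) :
    ∏ j : Fin (m + 1), f j.castSucc = f 0 * ∏ j ∈ Finset.Ioo 0 (Fin.last (m + 1)), f j := by
  have h1 : ∏ j : Fin (m + 1), f j.castSucc = ∏ j ∈ Finset.Ico 0 (Fin.last (m + 1)), f j := by
    refine (Finset.prod_map Finset.univ Fin.castSuccEmb f).symm.trans ?_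
    congr 1
    ext j
    refine Fin.lastCases ?_ (fun k => ?_) j
    · simp [Fin.castSucc_ne_last]
    · simp [Fin.castSucc_lt_last]
  rw [h1, ← Finset.Ioo_insert_left (Fin.last_pos), Finset.prod_insert Finset.left_notMem_Ioo]

/-- Each link contributes x_j x_{j+1}: interior entries occur twice and the two ends once. The
numerator cancels one copy of every interior entry and leaves the full product, symmetric in the
ordering. -/
theorem buryak_denominator {m : ℕ} {a x : Fin (m + 2) → ℂ} (hx : ∀ i, x i ≠ 0) :
    (∏ j ∈ Finset.Ioo 0 (Fin.last (m + 1)), x j) /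
      ∏ j : Fin (m + 1), (a j.castSucc * x j.succ - a j.succ * x j.castSucc) =
      (∏ j, x j)⁻¹ * ∏ j : Fin (m + 1), (a j.castSucc / x j.castSucc - a j.succ / x j.succ)⁻¹ := by
  have h1 : ∀ j : Fin (m + 1), a j.castSucc * x j.succ - a j.succ * x j.castSucc =
      x j.castSucc * x j.succ * (a j.castSucc / x j.castSucc - a j.succ / x j.succ) := by
    intro j
    have := hx j.castSucc
    have := hx j.succ
    field_simp
  simp_rw [h1, Finset.prod_mul_distrib, prod_castSucc_eq, Fin.prod_univ_succ x,
    Finset.prod_inv_distrib]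
  have h2 : ∏ j ∈ Finset.Ioo 0 (Fin.last (m + 1)), x j ≠ 0 :=
    Finset.prod_ne_zero_iff.2 fun j _ => hx j
  rw [div_eq_mul_inv, mul_inv, mul_inv, mul_inv, mul_inv]
  field_simp

variable [DecidableEq ι]

/-- The sum of `e^{∑_{a<b} ω(a,b)} ∏ 1/(z_a - z_{a+1})` over all orderings of `S`. -/
def symSum (ω : ι → ι → ℂ) (z : ι → ℂ) (S : Finset ι) : ℂ :=
  ∑ l ∈ orderings S, Complex.exp (pairSum ω l) * chainProd z l

theorem buryakP_eq_symSum {n : ℕ} (hn : 1 ≤ n) {a x : Fin n → ℂ} (hx : ∀ i, x i ≠ 0)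
    (hz : Function.Injective fun j => a j / x j) :
    buryakP n a x = (∏ j, x j)⁻¹ *
      symSum (weightForm x fun j => a j / x j) (fun j => a j / x j) Finset.univ := by
  match n, hn, a, x, hx, hz with
  | 1, _, a, x, _, _ =>
    rw [symSum, sum_orderings_univ]
    simp [buryakP, chainProd, pairSum]
  | m + 2, _, a, x, hx, hz =>
    set z := fun j => a j / x j with hzdef
    rw [symSum, sum_exp_pairSum_mul_chainProd (weightForm_antisymm x z) hz
      (Finset.mem_univ (0 : Fin (m + 2)))]
    -- Orderings of the remaining letters are viewed as the full orderings with head 0, to match the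
    -- condition τ(1) = 1.
    have hfirst : ∑ l ∈ orderings (Finset.univ.erase (0 : Fin (m + 2))), chainProd z (0 :: l) *
        sinhProd (weightForm x z) (weightForm x z 0) l =
        ∑ l ∈ orderings (Finset.univ : Finset (Fin (m + 2))), if l.head? = some 0 then
          chainProd z l * sinhProd (weightForm x z) (weightForm x z 0) l.tail else 0 := by
      rw [sum_orderings Finset.univ]
      rw [if_neg (Finset.univ_nonempty.ne_empty), zero_add]
      simp only [List.head?_cons, Option.some.injEq, List.tail_cons]
      refine Eq.symm ((Finset.sum_eq_single 0 ?_ ?_).trans ?_)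
      · intro i _ hi
        simp [hi]
      · simp
      · simp
    rw [hfirst, sum_orderings_univ, Finset.mul_sum, buryakP, Finset.sum_filter]
    refine Finset.sum_congr rfl fun τ _ => ?_
    have hhead : (List.ofFn τ).head? = some (τ 0) := by rw [List.ofFn_succ, List.head?_cons]
    rw [hhead]
    simp only [Option.some.injEq]
    split_ifs with h0
    · rw [mul_div_right_comm, buryak_denominator (a := fun j => a (τ j)) (x := fun j => x (τ j))
        fun i => hx _, chainProd_ofFn, List.ofFn_succ, List.tail_cons, sinhProd_ofFn,
        Equiv.prod_comp τ x, mul_assoc]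
      congr 2
      refine Finset.prod_congr rfl fun j _ => ?_
      -- The argument of ζ is twice the total pairing of the new letter with all its predecessors;
      -- the factor 2 cancels the halves in ζ. The predecessor at position 0 is the `α` of the
      -- rooted sum.
      have harg : (∑ k ∈ Finset.Iic j.castSucc, a (τ k)) * x (τ j.succ) -
          a (τ j.succ) * ∑ k ∈ Finset.Iic j.castSucc, x (τ k) =
          2 * (weightForm x z 0 (τ j.succ) +
            ∑ k : Fin (m + 1), if k < j then weightForm x z (τ k.succ) (τ j.succ) else 0) := by
        have h1 : weightForm x z 0 (τ j.succ) +
            (∑ k : Fin (m + 1), if k < j then weightForm x z (τ k.succ) (τ j.succ) else 0) =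
            ∑ k ∈ Finset.Iic j.castSucc, weightForm x z (τ k) (τ j.succ) := by
          have h2 : ∑ k ∈ Finset.Iic j.castSucc, weightForm x z (τ k) (τ j.succ) =
              ∑ k, if k ≤ j.castSucc then weightForm x z (τ k) (τ j.succ) else 0 := by
            rw [← Finset.sum_filter]
            congr 1
            ext k
            simp
          rw [h2, Fin.sum_univ_succ (n := m + 1)]
          simp only [Fin.zero_le, if_true, h0, Fin.succ_le_castSucc_iff]
        rw [h1, Finset.sum_mul, Finset.mul_sum, Finset.mul_sum, ← Finset.sum_sub_distrib]
        refine Finset.sum_congr rfl fun k _ => ?_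
        have h2 := hx (τ k)
        have h3 := hx (τ j.succ)
        simp only [weightForm, hzdef]
        field_simp
      rw [buryakZeta, harg, neg_div, mul_div_cancel_left₀ _ (two_ne_zero)]
    · rw [mul_zero]

end SymmetricForm

/-! ### Boundedness of the symmetric form -/

section Bound

variable {ι : Type*}

/-- The sum of `F l₁ l₂` over all ways to write a list as `l₁ ++ l₂`. -/
def cutSum : (List ι → List ι → ℂ) → List ι → ℂ
  | F, [] => F [] []
  | F, a :: l => F [] (a :: l) + cutSum (fun l₁ l₂ => F (a :: l₁) l₂) l

theorem cutSum_add (F G : List ι → List ι → ℂ) (l : List ι) :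
    cutSum (fun l₁ l₂ => F l₁ l₂ + G l₁ l₂) l = cutSum F l + cutSum G l := by
  induction l generalizing F G with
  | nil => rfl
  | cons a l ih => simp only [cutSum, ih]; ring

theorem cutSum_mul_left (c : ℂ) (F : List ι → List ι → ℂ) (l : List ι) :
    cutSum (fun l₁ l₂ => c * F l₁ l₂) l = c * cutSum F l := by
  induction l generalizing F with
  | nil => rfl
  | cons a l ih => simp only [cutSum, ih]; ring

theorem cutSum_mul_append (F : List ι → List ι → ℂ) (E : List ι → ℂ) (l : List ι) :
    cutSum (fun l₁ l₂ => F l₁ l₂ * E (l₁ ++ l₂)) l = cutSum F l * E l := by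
  induction l generalizing F E with
  | nil => rfl
  | cons a l ih =>
    simp only [cutSum, List.cons_append, List.nil_append]
    rw [ih (fun l₁ l₂ => F (a :: l₁) l₂) (fun l => E (a :: l))]
    ring

/-- An ordering of `S` with a cut is a subset `A` together with orderings of `A` and of its
complement. -/
theorem sum_orderings_cutSum [DecidableEq ι] (S : Finset ι) (F : List ι → List ι → ℂ) :
    ∑ l ∈ orderings S, cutSum F l =
      ∑ A ∈ S.powerset, ∑ l₁ ∈ orderings A, ∑ l₂ ∈ orderings (S \ A), F l₁ l₂ := by
  induction S using Finset.strongInduction generalizing F with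
  | H S ih =>
    simp_rw [fun A : Finset ι => sum_orderings A fun l₁ => ∑ l₂ ∈ orderings (S \ A), F l₁ l₂]
    rw [Finset.sum_add_distrib, Finset.sum_ite_eq', if_pos (Finset.empty_mem_powerset S),
      Finset.sdiff_empty, sum_orderings S (F [])]
    have h : ∑ A ∈ S.powerset, ∑ a ∈ A, ∑ l ∈ orderings (A.erase a), ∑ l₂ ∈ orderings (S \ A),
        F (a :: l) l₂ = ∑ a ∈ S, ∑ l ∈ orderings (S.erase a),
          cutSum (fun l₁ l₂ => F (a :: l₁) l₂) l := by
      refine Eq.trans ?_ ((sum_powerset_sum_mem S fun a A => ∑ l ∈ orderings A,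
        ∑ l₂ ∈ orderings (S.erase a \ A), F (a :: l) l₂).trans ?_)
      · refine Finset.sum_congr rfl fun A _ => Finset.sum_congr rfl fun a ha => ?_
        rw [sdiff_eq_erase_sdiff_erase ha]
      · exact Finset.sum_congr rfl fun a ha => (ih _ (Finset.erase_ssubset ha) _).symm
    rw [h, sum_orderings, add_assoc, ← Finset.sum_add_distrib]
    simp only [cutSum, Finset.sum_add_distrib]

theorem sum_map_mul_sub (x z : ι → ℂ) (b d : ι) (l : List ι) :
    (l.map fun k => x k * (z b - z k)).sum =
      (l.map x).sum * (z b - z d) + (l.map fun k => x k * (z d - z k)).sum := by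
  induction l with
  | nil => simp
  | cons a l ih => simp only [List.map_cons, List.sum_cons, ih]; ring

theorem cutSum_chainProd_aux (x : ι → ℂ) {z : ι → ℂ} (hz : Function.Injective z) (l : List ι) :
    ∀ b, (b :: l).Nodup →
      cutSum (fun l₁ l₂ => (l₂.map x).sum * chainProd z (b :: l₁) * chainProd z l₂) l =
        chainProd z (b :: l) * (l.map fun k => x k * (z b - z k)).sum := by
  induction l with
  | nil => intro b _; simp [cutSum]
  | cons d l ih =>
    intro b hb
    have hbd : z b - z d ≠ 0 := sub_ne_zero.2 fun h => by
      have := hz h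
      simp [this] at hb
    have h1 : (fun l₁ l₂ => (l₂.map x).sum * chainProd z (b :: d :: l₁) * chainProd z l₂) =
        fun l₁ l₂ => (z b - z d)⁻¹ * ((l₂.map x).sum * chainProd z (d :: l₁) * chainProd z l₂) := by
      funext l₁ l₂
      simp only [chainProd]
      ring
    rw [cutSum, h1, cutSum_mul_left, ih d (List.nodup_cons.1 hb).2]
    simp only [chainProd, List.map_cons, List.sum_cons]
    rw [sum_map_mul_sub x z b d l]
    field_simp
    ring

theorem sum_map_weightForm (x z : ι → ℂ) (b : ι) (l : List ι) :
    2 * (l.map (weightForm x z b)).sum = x b * (l.map fun k => x k * (z b - z k)).sum := by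
  induction l with
  | nil => simp
  | cons a l ih =>
    simp only [List.map_cons, List.sum_cons, mul_add, ih, weightForm]
    ring

theorem cutSum_chainProd_cons (x : ι → ℂ) {z : ι → ℂ} (hz : Function.Injective z) (l : List ι) :
    ∀ b, (b :: l).Nodup →
      cutSum (fun l₁ l₂ => ((b :: l₁).map x).sum * (l₂.map x).sum * chainProd z (b :: l₁) *
        chainProd z l₂) l = 2 * pairSum (weightForm x z) (b :: l) * chainProd z (b :: l) := by
  induction l with
  | nil => intro b _; simp [cutSum, pairSum]
  | cons d l ih =>
    intro b hb
    have hbd : z b - z d ≠ 0 := sub_ne_zero.2 fun h => by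
      have := hz h
      simp [this] at hb
    have h1 : (fun l₁ l₂ => ((b :: d :: l₁).map x).sum * (l₂.map x).sum *
        chainProd z (b :: d :: l₁) * chainProd z l₂) =
        fun l₁ l₂ => (z b - z d)⁻¹ * (x b *
          ((l₂.map x).sum * chainProd z (d :: l₁) * chainProd z l₂)) +
          (z b - z d)⁻¹ * (((d :: l₁).map x).sum * (l₂.map x).sum * chainProd z (d :: l₁) *
            chainProd z l₂) := by
      funext l₁ l₂
      simp only [chainProd, List.map_cons, List.sum_cons]
      ring
    have hn := (List.nodup_cons.1 hb).2
    rw [cutSum, h1, cutSum_add, cutSum_mul_left, cutSum_mul_left, cutSum_mul_left, ih d hn,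
      cutSum_chainProd_aux x hz l d hn]
    have h2 : 2 * pairSum (weightForm x z) (b :: d :: l) =
        2 * ((d :: l).map (weightForm x z b)).sum + 2 * pairSum (weightForm x z) (d :: l) := by
      rw [pairSum, mul_add]
    rw [h2, sum_map_weightForm, sum_map_mul_sub x z b d]
    simp only [chainProd, List.map_cons, List.sum_cons, List.map_nil, List.sum_nil]
    field_simp
    ring

/-- Cutting the link after position p multiplies the chain by z_p - z_{p+1}. Summing x_i x_j (z_p -
z_{p+1}) over i ≤ p < j telescopes to x_i x_j (z_i - z_j), twice the form. The two trivial cuts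
vanish because an empty list has x-sum 0. -/
theorem cutSum_chainProd (x : ι → ℂ) {z : ι → ℂ} (hz : Function.Injective z) {l : List ι}
    (hl : l.Nodup) :
    cutSum (fun l₁ l₂ => (l₁.map x).sum * (l₂.map x).sum * chainProd z l₁ * chainProd z l₂) l =
      2 * pairSum (weightForm x z) l * chainProd z l := by
  match l with
  | [] => simp [cutSum, pairSum]
  | b :: l =>
    rw [cutSum, cutSum_chainProd_cons x hz l b hl]
    simp

theorem pairSum_append (ω : ι → ι → ℂ) (l l' : List ι) :
    pairSum ω (l ++ l') = pairSum ω l + crossSum ω l l' + pairSum ω l' := by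
  induction l with
  | nil => simp [pairSum, crossSum]
  | cons a l ih =>
    simp only [List.cons_append, pairSum, ih, crossSum_cons_left, List.map_append, List.sum_append]
    ring

theorem pairSum_const_mul (c : ℂ) (ω : ι → ι → ℂ) (l : List ι) :
    pairSum (fun a b => c * ω a b) l = c * pairSum ω l := by
  induction l with
  | nil => simp [pairSum]
  | cons a l ih =>
    simp only [pairSum, ih, mul_add, List.sum_map_mul_left]

theorem nodup_of_mem_orderings {S : Finset ι} {l : List ι} (hl : l ∈ orderings S) : l.Nodup := by
  rw [mem_orderings] at hl
  rw [← Multiset.coe_nodup, ← hl]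
  exact S.nodup

variable [DecidableEq ι]

/-- Differentiation brings down `pairSum`, which the cut identity trades for the removal of one
link. The exponent then splits into the two pieces and their cross pairing, so no denominator
joining `A` to its complement survives. -/
theorem hasDerivAt_symSum (x : ι → ℂ) {z : ι → ℂ} (hz : Function.Injective z) (S : Finset ι)
    (θ : ℝ) :
    HasDerivAt (fun θ : ℝ => symSum (fun a b => θ * weightForm x z a b) z S)
      (∑ A ∈ S.powerset, 1 / 2 * (∑ i ∈ A, x i) * (∑ i ∈ S \ A, x i) *
        Complex.exp (θ * ∑ i ∈ A, ∑ j ∈ S \ A, weightForm x z i j) *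
        symSum (fun a b => θ * weightForm x z a b) z A *
        symSum (fun a b => θ * weightForm x z a b) z (S \ A)) θ := by
  set ω := weightForm x z with hω
  have hderiv : HasDerivAt (fun θ : ℝ => symSum (fun a b => θ * ω a b) z S)
      (∑ l ∈ orderings S, Complex.exp (θ * pairSum ω l) * pairSum ω l * chainProd z l) θ := by
    simp only [symSum, pairSum_const_mul]
    refine HasDerivAt.fun_sum fun l _ => HasDerivAt.mul_const ?_ _
    have h := ((hasDerivAt_id θ).ofReal_comp.mul_const (pairSum ω l)).cexp
    simpa using h
  convert hderiv using 1
  have h1 : ∀ l ∈ orderings S, Complex.exp (θ * pairSum ω l) * pairSum ω l * chainProd z l =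
      cutSum (fun l₁ l₂ => 1 / 2 * ((l₁.map x).sum * (l₂.map x).sum * chainProd z l₁ *
        chainProd z l₂) * Complex.exp (θ * pairSum ω (l₁ ++ l₂))) l := by
    intro l hl
    rw [cutSum_mul_append _ (fun l => Complex.exp (θ * pairSum ω l)), cutSum_mul_left,
      cutSum_chainProd x hz (nodup_of_mem_orderings hl)]
    ring
  rw [Finset.sum_congr rfl h1, sum_orderings_cutSum]
  refine Finset.sum_congr rfl fun A _ => ?_
  rw [symSum, symSum, mul_assoc, Finset.sum_mul_sum, Finset.mul_sum]
  refine Finset.sum_congr rfl fun l₁ hl₁ => ?_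
  rw [Finset.mul_sum]
  refine Finset.sum_congr rfl fun l₂ hl₂ => ?_
  rw [sum_map_of_mem_orderings hl₁, sum_map_of_mem_orderings hl₂, pairSum_append,
    pairSum_const_mul, pairSum_const_mul, crossSum, sum_map_of_mem_orderings hl₁]
  simp only [sum_map_of_mem_orderings hl₂, mul_add, Complex.exp_add]
  ring

/-- In the rooted form every term contains a factor 2 sinh 0. -/
theorem symSum_zero_of_one_lt_card {z : ι → ℂ} (hz : Function.Injective z) {S : Finset ι}
    (hS : 1 < S.card) : symSum (fun _ _ => 0) z S = 0 := by
  obtain ⟨i, hi⟩ := Finset.card_pos.1 (zero_lt_one.trans hS)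
  rw [symSum, sum_exp_pairSum_mul_chainProd (by simp) hz hi]
  refine Finset.sum_eq_zero fun l hl => ?_
  match l with
  | [] =>
    rw [nil_mem_orderings, ← Finset.card_eq_zero, Finset.card_erase_of_mem hi] at hl
    omega
  | j :: l => simp [sinhProd]

theorem symSum_eq_one_of_card_le_one (ω : ι → ι → ℂ) (z : ι → ℂ) {S : Finset ι}
    (hS : S.card ≤ 1) : symSum ω z S = 1 := by
  by_cases h0 : S = ∅
  · simp [h0, symSum, orderings_empty, pairSum, chainProd]
  · obtain ⟨i, rfl⟩ : ∃ i, S = {i} := Finset.card_eq_one.1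
      (le_antisymm hS (Finset.card_pos.2 (Finset.nonempty_iff_ne_empty.2 h0)))
    rw [symSum, sum_orderings]
    simp [orderings_empty, pairSum, chainProd]

/-- Single terms blow up where two points collide; the bound on the sum is insensitive to this. It
follows by induction on `S` from the value 0 at θ = 0 and the mean value inequality, and it sees `z`
only through the real parts of the form. -/
theorem exists_norm_symSum_le (x : ι → ℂ) (R : ℝ) (S : Finset ι) :
    ∃ C, 0 ≤ C ∧ ∀ z : ι → ℂ, Function.Injective z → (∀ a b, |(weightForm x z a b).re| ≤ R) →
      ∀ θ ∈ Set.Icc (0 : ℝ) 1, ‖symSum (fun a b => θ * weightForm x z a b) z S‖ ≤ C := by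
  induction S using Finset.strongInduction with
  | H S ih =>
    rcases le_or_gt S.card 1 with hS | hS
    · exact ⟨1, zero_le_one, fun z _ _ θ _ => by simp [symSum_eq_one_of_card_le_one _ _ hS]⟩
    -- A constant is attached to every set, with value 0 off the proper subsets of `S`, so that one
    -- formula covers the whole powerset.
    have ih' : ∀ A : Finset ι, ∃ C, 0 ≤ C ∧ (A ⊂ S → ∀ z : ι → ℂ, Function.Injective z →
        (∀ a b, |(weightForm x z a b).re| ≤ R) → ∀ θ ∈ Set.Icc (0 : ℝ) 1,
          ‖symSum (fun a b => θ * weightForm x z a b) z A‖ ≤ C) := by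
      intro A
      by_cases hA : A ⊂ S
      · obtain ⟨C, h0, h⟩ := ih A hA
        exact ⟨C, h0, fun _ => h⟩
      · exact ⟨0, le_rfl, fun h => absurd h hA⟩
    choose C hC0 hC using ih'
    refine ⟨∑ A ∈ S.powerset, 1 / 2 * ‖∑ i ∈ A, x i‖ * ‖∑ i ∈ S \ A, x i‖ *
      Real.exp (∑ i ∈ A, ∑ j ∈ S \ A, R) * C A * C (S \ A), ?_, ?_⟩
    · refine Finset.sum_nonneg fun A _ => ?_
      have := hC0 A
      have := hC0 (S \ A)
      positivity
    intro z hz hR θ hθ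
    have hmv := norm_image_sub_le_of_norm_deriv_le_segment'
      (fun t (_ : t ∈ Set.Icc (0 : ℝ) 1) => (hasDerivAt_symSum x hz S t).hasDerivWithinAt)
      (C := ∑ A ∈ S.powerset, 1 / 2 * ‖∑ i ∈ A, x i‖ * ‖∑ i ∈ S \ A, x i‖ *
      Real.exp (∑ i ∈ A, ∑ j ∈ S \ A, R) * C A * C (S \ A)) ?_ θ hθ
    · have h0 : symSum (fun a b => ((0 : ℝ) : ℂ) * weightForm x z a b) z S = 0 := by
        simp only [Complex.ofReal_zero, zero_mul]
        exact symSum_zero_of_one_lt_card hz hS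
      rw [h0, sub_zero, sub_zero] at hmv
      refine hmv.trans (mul_le_of_le_one_right ?_ hθ.2)
      refine Finset.sum_nonneg fun A _ => ?_
      have := hC0 A
      have := hC0 (S \ A)
      positivity
    · intro t ht
      have ht' : t ∈ Set.Icc (0 : ℝ) 1 := ⟨ht.1, ht.2.le⟩
      refine norm_sum_le_of_le _ fun A hA => ?_
      rw [Finset.mem_powerset] at hA
      have hCA := hC0 A
      have hCB := hC0 (S \ A)
      -- The terms `A = ∅` and `A = S`, out of reach of the induction, carry an empty x-sum and
      -- vanish.
      rcases Finset.eq_empty_or_nonempty A with rfl | hne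
      · simp only [Finset.sum_empty, mul_zero, zero_mul, norm_zero]
        positivity
      rcases hA.eq_or_ssubset with rfl | hss
      · simp only [Finset.sdiff_self, Finset.sum_empty, mul_zero, zero_mul, norm_zero]
        positivity
      simp only [norm_mul, Complex.norm_exp]
      gcongr
      · simp
      · rw [Complex.re_ofReal_mul, Complex.re_sum]
        simp only [Complex.re_sum]
        refine (le_abs_self _).trans ?_
        rw [abs_mul, abs_of_nonneg ht.1]
        refine (mul_le_of_le_one_left (abs_nonneg _) ht.2.le).trans ?_
        refine (Finset.abs_sum_le_sum_abs _ _).trans (Finset.sum_le_sum fun i _ => ?_)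
        exact (Finset.abs_sum_le_sum_abs _ _).trans (Finset.sum_le_sum fun j _ => hR i j)
      · exact hC A hss z hz hR t ht'
      · exact hC (S \ A) (Finset.sdiff_ssubset hA hne) z hz hR t ht'

end Bound

/-! ### Linear chains -/

section LinearChain

/-- The partial sums `y_0 + ⋯ + y_{k-1}`. -/
def prefixSum {m : ℕ} (y : Fin m → ℝ) (k : Fin (m + 1)) : ℝ :=
  ∑ l : Fin m, if l.castSucc < k then y l else 0

theorem prefixSum_zero {m : ℕ} (y : Fin m → ℝ) : prefixSum y 0 = 0 := by
  simp [prefixSum]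

theorem prefixSum_last {m : ℕ} (y : Fin m → ℝ) : prefixSum y (Fin.last m) = ∑ l, y l := by
  simp [prefixSum, Fin.castSucc_lt_last]

theorem prefixSum_succ {m : ℕ} (y : Fin m → ℝ) (k : Fin m) :
    prefixSum y k.succ = prefixSum y k.castSucc + y k := by
  unfold prefixSum
  have : ∀ l : Fin m, (if l.castSucc < k.succ then y l else 0) =
      (if l.castSucc < k.castSucc then y l else 0) + if l = k then y l else 0 := by
    intro l
    rcases lt_trichotomy l k with h | h | h
    · have h1 : l.castSucc < k.succ := Fin.castSucc_lt_succ_iff.2 h.le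
      simp [h1, h, h.ne]
    · simp [h]
    · have h1 : ¬ l.castSucc < k.succ := fun h' => absurd (Fin.castSucc_lt_succ_iff.1 h') h.not_ge
      simp [h1, h.ne', h.not_gt]
  simp_rw [this]
  rw [Finset.sum_add_distrib, Finset.sum_ite_eq']
  simp

theorem sum_succ_sub_castSucc {m : ℕ} (f : Fin (m + 1) → ℝ) :
    ∑ k : Fin m, (f k.succ - f k.castSucc) = f (Fin.last m) - f 0 := by
  have h1 := Fin.sum_univ_succ f
  have h2 := Fin.sum_univ_castSucc f
  rw [Finset.sum_sub_distrib]
  linarith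

/-- Half of the difference between the sum of the later and of the earlier entries. -/
def chainShift {m : ℕ} (y : Fin m → ℝ) (k : Fin m) : ℝ :=
  (∑ l, y l) / 2 - prefixSum y k.castSucc - y k / 2

/-- A midpoint rule: `chainShift` is Y/2 - t at the midpoint of the k-th interval of lengths y, the
integral of (Y/2 - t)² over [0, Y] is Y³/12, and each interval has error y_k³/12. -/
theorem sum_mul_chainShift_sq {m : ℕ} (y : Fin m → ℝ) :
    ∑ k, y k * chainShift y k ^ 2 = ((∑ k, y k) ^ 3 - ∑ k, y k ^ 3) / 12 := by
  have h := sum_succ_sub_castSucc fun k => -((∑ l, y l) / 2 - prefixSum y k) ^ 3 / 3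
  simp only [prefixSum_last, prefixSum_zero, prefixSum_succ] at h
  have h2 : ∀ k, y k * chainShift y k ^ 2 =
      (-((∑ l, y l) / 2 - (prefixSum y k.castSucc + y k)) ^ 3 / 3 -
        -((∑ l, y l) / 2 - prefixSum y k.castSucc) ^ 3 / 3) - y k ^ 3 / 12 := by
    intro k
    unfold chainShift
    ring
  simp_rw [h2]
  rw [Finset.sum_sub_distrib, h, ← Finset.sum_div]
  ring

theorem cons_eq_castSucc {m : ℕ} (s : Fin m → ℝ) (k : Fin (m + 1)) :
    (Fin.cons 0 (Fin.snoc s 0 : Fin (m + 1) → ℝ) : Fin (m + 2) → ℝ) k.castSucc =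
      (Fin.cons 0 s : Fin (m + 1) → ℝ) k := by
  refine Fin.cases ?_ (fun j => ?_) k
  · simp
  · rw [← Fin.succ_castSucc, Fin.cons_succ, Fin.snoc_castSucc, Fin.cons_succ]

/-- Summation by parts: consecutive shifts differ by minus half the sum of neighbouring entries. The
path starts and ends at 0, so there is no boundary term. -/
theorem sum_chainShift_mul {m : ℕ} (y : Fin (m + 1) → ℝ) (s : Fin m → ℝ) :
    ∑ k, chainShift y k * ((Fin.snoc s 0 : Fin (m + 1) → ℝ) k - (Fin.cons 0 s : Fin (m + 1) → ℝ) k) =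
      ∑ k, ((Fin.cons 0 s : Fin (m + 1) → ℝ) k + (Fin.snoc s 0 : Fin (m + 1) → ℝ) k) * y k / 2 := by
  have h := sum_succ_sub_castSucc fun k =>
    (Fin.cons 0 (Fin.snoc s 0 : Fin (m + 1) → ℝ) : Fin (m + 2) → ℝ) k *
      ((∑ l, y l) / 2 - prefixSum y k)
  simp only [prefixSum_last, prefixSum_zero, prefixSum_succ, Fin.cons_zero, Fin.cons_succ,
    cons_eq_castSucc] at h
  rw [← Fin.succ_last, Fin.cons_succ, Fin.snoc_last, zero_mul, zero_mul, sub_zero] at h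
  rw [← sub_eq_zero, ← Finset.sum_sub_distrib]
  refine Eq.trans (Finset.sum_congr rfl fun k _ => ?_) h
  unfold chainShift
  ring

/-- Expanding the square gives three parts. The shifts squared supply the cubic constants, the cross
term the linear drift (r+s)y/2, and the increments squared the heat kernel. -/
theorem prod_exp_chainShift {m : ℕ} {y : Fin (m + 1) → ℝ} (hy : ∀ k, 0 < y k) (s : Fin m → ℝ) :
    ∏ k, Real.exp (-y k * (chainShift y k + ((Fin.snoc s 0 : Fin (m + 1) → ℝ) k -
        (Fin.cons 0 s : Fin (m + 1) → ℝ) k) / y k) ^ 2 / 2) =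
      Real.exp (-(∑ k, y k) ^ 3 / 24) * (∏ k, Real.sqrt (2 * Real.pi * y k)) *
        ∏ k, airyKernel (y k) ((Fin.cons 0 s : Fin (m + 1) → ℝ) k)
          ((Fin.snoc s 0 : Fin (m + 1) → ℝ) k) := by
  have hK : ∀ k (r t : ℝ), Real.sqrt (2 * Real.pi * y k) * airyKernel (y k) r t =
      Real.exp (y k ^ 3 / 24 + (-(r - t) ^ 2 / (2 * y k) - (r + t) * y k / 2)) := by
    intro k r t
    have := hy k
    have : Real.sqrt (2 * Real.pi * y k) ≠ 0 := by positivity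
    unfold airyKernel
    rw [Real.exp_add]
    field_simp
  rw [mul_assoc, ← Finset.prod_mul_distrib]
  simp_rw [hK]
  rw [← Real.exp_sum, ← Real.exp_sum, ← Real.exp_add]
  congr 1
  have h1 := sum_mul_chainShift_sq y
  have h2 := sum_chainShift_mul y s
  set c := (Fin.cons 0 s : Fin (m + 1) → ℝ)
  set d := (Fin.snoc s 0 : Fin (m + 1) → ℝ)
  have h3 : ∀ k, -y k * (chainShift y k + (d k - c k) / y k) ^ 2 / 2 =
      -(y k * chainShift y k ^ 2) / 2 - chainShift y k * (d k - c k) +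
        -(c k - d k) ^ 2 / (2 * y k) := by
    intro k
    have := (hy k).ne'
    field_simp
    ring
  simp_rw [h3, Finset.sum_add_distrib, Finset.sum_sub_distrib]
  rw [h2, ← Finset.sum_div, Finset.sum_neg_distrib, h1, ← Finset.sum_div _ _ (24 : ℝ)]
  ring

/-- The coefficients of the linear forms `a_q / y_q - a_{q+1} / y_{q+1}`. -/
def chainCoeff {m : ℕ} (y : Fin (m + 1) → ℝ) (q : Fin m) (k : Fin (m + 1)) : ℝ :=
  (if k = q.castSucc then 1 / y k else 0) - if k = q.succ then 1 / y k else 0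

theorem sum_chainCoeff_mul {m : ℕ} (y a : Fin (m + 1) → ℝ) (q : Fin m) :
    ∑ k, chainCoeff y q k * a k = a q.castSucc / y q.castSucc - a q.succ / y q.succ := by
  simp only [chainCoeff, sub_mul, ite_mul, zero_mul, Finset.sum_sub_distrib, Finset.sum_ite_eq',
    Finset.mem_univ, if_true]
  ring

theorem sum_mul_chainCoeff {m : ℕ} (y : Fin (m + 1) → ℝ) (s : Fin m → ℝ) (k : Fin (m + 1)) :
    ∑ q, s q * chainCoeff y q k = ((Fin.snoc s 0 : Fin (m + 1) → ℝ) k -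
        (Fin.cons 0 s : Fin (m + 1) → ℝ) k) / y k := by
  simp only [chainCoeff, mul_sub, mul_ite, mul_zero, Finset.sum_sub_distrib]
  rw [sub_div]
  congr 1
  · refine Fin.lastCases ?_ (fun j => ?_) k
    · simp [fun q : Fin m => (Fin.castSucc_ne_last q).symm]
    · simp only [Fin.castSucc_inj, Finset.sum_ite_eq, Finset.mem_univ, if_true, Fin.snoc_castSucc]
      ring
  · refine Fin.cases ?_ (fun j => ?_) k
    · simp [fun q : Fin m => (Fin.succ_ne_zero q).symm]
    · simp only [Fin.succ_inj, Finset.sum_ite_eq, Finset.mem_univ, if_true, Fin.cons_succ]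
      ring

theorem integral_comp_perm {κ E : Type*} [Fintype κ] [NormedAddCommGroup E] [NormedSpace ℝ E]
    (σ : Equiv.Perm κ) (f : (κ → ℝ) → E) :
    ∫ a : κ → ℝ, f (a ∘ σ) = ∫ a, f a := by
  rw [← (volume_measurePreserving_piCongrLeft (fun _ : κ => ℝ) σ.symm).integral_comp' (g := f)]
  congr 1
  funext a
  congr 1
  funext j
  have := Equiv.piCongrLeft_apply_apply (fun _ : κ => ℝ) σ.symm a (σ j)
  simp only [Equiv.symm_apply_apply] at this
  exact this.symm

theorem integrable_comp_perm {κ : Type*} [Fintype κ] (σ : Equiv.Perm κ) {f : (κ → ℝ) → ℂ}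
    (hf : Integrable f) : Integrable fun a : κ → ℝ => f (a ∘ σ) := by
  have h := (volume_measurePreserving_piCongrLeft (fun _ : κ => ℝ) σ.symm).integrable_comp_emb
    (MeasurableEquiv.measurableEmbedding _) (g := f) |>.2 hf
  refine h.congr (ae_of_all _ fun a => ?_)
  simp only [Function.comp_apply]
  congr 1
  funext j
  have := Equiv.piCongrLeft_apply_apply (fun _ : κ => ℝ) σ.symm a (σ j)
  simp only [Equiv.symm_apply_apply] at this
  exact this

theorem pairSum_ofFn {ι : Type*} (ω : ι → ι → ℂ) {m : ℕ} (v : Fin m → ι) :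
    pairSum ω (List.ofFn v) = ∑ k, ∑ l, if k < l then ω (v k) (v l) else 0 := by
  induction m with
  | zero => simp [pairSum]
  | succ m ih =>
    rw [List.ofFn_succ, pairSum, ih, Fin.sum_univ_succ]
    congr 1
    · rw [Fin.sum_univ_succ]
      simp [List.sum_ofFn, List.map_ofFn]
    · refine Finset.sum_congr rfl fun k _ => ?_
      rw [Fin.sum_univ_succ]
      simp

theorem sum_lt_eq_prefixSum {m : ℕ} (y : Fin m → ℝ) (k : Fin m) :
    (∑ l, if k < l then y l else 0) = (∑ l, y l) - prefixSum y k.castSucc - y k := by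
  have : ∀ l, y l = (if k < l then y l else 0) + (if l.castSucc < k.castSucc then y l else 0) +
      if l = k then y l else 0 := by
    intro l
    rcases lt_trichotomy l k with h | h | h
    · simp [h, h.ne, h.not_gt]
    · simp [h]
    · simp [h, h.ne', h.not_gt]
  have h2 := Finset.sum_congr rfl fun l (_ : l ∈ Finset.univ) => this l
  rw [Finset.sum_add_distrib, Finset.sum_add_distrib, Finset.sum_ite_eq',
    if_pos (Finset.mem_univ _)] at h2
  rw [prefixSum]
  linarith

/-- The form is linear in `z`: a point is counted with plus half the weights after it and minus half
the weights before it. -/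
theorem pairSum_weightForm_ofFn {ι : Type*} (x : ι → ℝ) (z : ι → ℂ) {m : ℕ} (v : Fin m → ι) :
    pairSum (weightForm (fun j => (x j : ℂ)) z) (List.ofFn v) =
      ∑ k, (x (v k) * chainShift (fun k => x (v k)) k : ℝ) * z (v k) := by
  rw [pairSum_ofFn]
  have h1 : ∀ k l : Fin m, (if k < l then weightForm (fun j => (x j : ℂ)) z (v k) (v l) else 0) =
      (x (v k) : ℂ) * z (v k) / 2 * ((if k < l then x (v l) else 0 : ℝ) : ℂ) -
        (x (v l) : ℂ) * z (v l) / 2 * ((if k.castSucc < l.castSucc then x (v k) else 0 : ℝ) : ℂ) := by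
    intro k l
    simp only [Fin.castSucc_lt_castSucc_iff]
    split_ifs
    · unfold weightForm; ring
    · simp
  simp_rw [h1, Finset.sum_sub_distrib]
  rw [Finset.sum_comm (f := fun k l => (x (v l) : ℂ) * z (v l) / 2 *
    ((if k.castSucc < l.castSucc then x (v k) else 0 : ℝ) : ℂ)), ← Finset.sum_sub_distrib]
  refine Finset.sum_congr rfl fun k _ => ?_
  rw [← Finset.mul_sum, ← Finset.mul_sum, ← Complex.ofReal_sum, ← Complex.ofReal_sum,
    sum_lt_eq_prefixSum (fun l => x (v l)) k, ← prefixSum.eq_def (fun l => x (v l)) k.castSucc]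
  unfold chainShift
  push_cast
  ring

end LinearChain

open Filter Topology

/-! ### The Gaussian integral of the symmetric form -/

section GaussianSymmetric

variable {m : ℕ} {x : Fin (m + 1) → ℝ}

/-- The points `i a_j / x_j + ε j`, regularised so that they are distinct for `ε ≠ 0`. -/
def shiftedPoint (x a : Fin (m + 1) → ℝ) (ε : ℝ) (j : Fin (m + 1)) : ℂ :=
  Complex.I * (a j / x j : ℝ) + (ε * (j : ℕ) : ℝ)

/-- The weight of a pair of neighbours: `-1` on `[0, ∞)` for an ascent, `1` on `(-∞, 0]` for a
descent. -/
def stepWeight (i j : Fin (m + 1)) (s : ℝ) : ℝ := halfLineWeight (((i : ℕ) : ℝ) - ((j : ℕ) : ℝ)) s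

theorem measurable_stepWeight (i j : Fin (m + 1)) : Measurable (stepWeight i j) :=
  measurable_halfLineWeight _

theorem abs_stepWeight_le (i j : Fin (m + 1)) (s : ℝ) : |stepWeight i j s| ≤ 1 :=
  abs_halfLineWeight_le _ _

theorem cast_sub_cast_ne_zero {i j : Fin (m + 1)} (h : i ≠ j) :
    ((i : ℕ) : ℝ) - ((j : ℕ) : ℝ) ≠ 0 := by
  rw [sub_ne_zero]
  exact_mod_cast fun h' => h (Fin.ext h')

/-- The regularisation enters in two places only: as a real constant tending to 1, and as the real
part ε(σ_q - σ_{q+1}) of each denominator, nonzero since neighbours differ. -/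
theorem orderedTerm_eq (hx : ∀ i, 0 < x i) (σ : Equiv.Perm (Fin (m + 1))) (ε : ℝ)
    (a : Fin (m + 1) → ℝ) :
    ((∏ j, Real.exp (-(a j) ^ 2 / (2 * x j)) : ℝ) : ℂ) *
      (Complex.exp (pairSum (weightForm (fun j => (x j : ℂ)) (shiftedPoint x a ε)) (List.ofFn σ)) *
        chainProd (shiftedPoint x a ε) (List.ofFn σ)) =
    (Real.exp (ε * ∑ k, x (σ k) * chainShift (x ∘ σ) k * (σ k : ℕ)) : ℝ) *
      (((∏ j, Real.exp (-((a ∘ σ) j) ^ 2 / (2 * (x ∘ σ) j)) : ℝ) : ℂ) *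
        Complex.exp (Complex.I * (∑ k, chainShift (x ∘ σ) k * (a ∘ σ) k : ℝ)) *
        ∏ q : Fin m, (Complex.I * (∑ k, chainCoeff (x ∘ σ) q k * (a ∘ σ) k : ℝ) +
          (ε * (((σ q.castSucc : ℕ) : ℝ) - ((σ q.succ : ℕ) : ℝ)) : ℝ))⁻¹) := by
  have h1 : ∏ j, Real.exp (-((a ∘ σ) j) ^ 2 / (2 * (x ∘ σ) j)) =
      ∏ j, Real.exp (-(a j) ^ 2 / (2 * x j)) :=
    Equiv.prod_comp σ fun j => Real.exp (-(a j) ^ 2 / (2 * x j))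
  have h2 : pairSum (weightForm (fun j => (x j : ℂ)) (shiftedPoint x a ε)) (List.ofFn σ) =
      ((ε * ∑ k, x (σ k) * chainShift (x ∘ σ) k * (σ k : ℕ) : ℝ) : ℂ) +
        Complex.I * (∑ k, chainShift (x ∘ σ) k * (a ∘ σ) k : ℝ) := by
    rw [pairSum_weightForm_ofFn]
    push_cast
    rw [Finset.mul_sum, Finset.mul_sum, ← Finset.sum_add_distrib]
    refine Finset.sum_congr rfl fun k _ => ?_
    have : (x (σ k) : ℂ) ≠ 0 := by exact_mod_cast (hx _).ne'
    simp only [shiftedPoint, Function.comp_apply, Function.comp_def]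
    push_cast
    field_simp
    ring
  rw [h1, h2, chainProd_ofFn, Complex.exp_add, ← Complex.ofReal_exp]
  have h3 : ∀ q : Fin m, shiftedPoint x a ε (σ q.castSucc) - shiftedPoint x a ε (σ q.succ) =
      Complex.I * (∑ k, chainCoeff (x ∘ σ) q k * (a ∘ σ) k : ℝ) +
          (ε * (((σ q.castSucc : ℕ) : ℝ) - ((σ q.succ : ℕ) : ℝ)) : ℝ) := by
    intro q
    rw [sum_chainCoeff_mul]
    simp only [shiftedPoint, Function.comp_apply]
    push_cast
    ring
  simp_rw [h3]
  ring

theorem perm_castSucc_ne_succ (σ : Equiv.Perm (Fin (m + 1))) (q : Fin m) :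
    σ q.castSucc ≠ σ q.succ := fun h => (Fin.castSucc_lt_succ (i := q)).ne (σ.injective h)

theorem integrable_orderedTerm (hx : ∀ i, 0 < x i) (σ : Equiv.Perm (Fin (m + 1))) {ε : ℝ}
    (hε : 0 < ε) :
    Integrable fun a : Fin (m + 1) → ℝ => ((∏ j, Real.exp (-(a j) ^ 2 / (2 * x j)) : ℝ) : ℂ) *
      (Complex.exp (pairSum (weightForm (fun j => (x j : ℂ)) (shiftedPoint x a ε)) (List.ofFn σ)) *
        chainProd (shiftedPoint x a ε) (List.ofFn σ)) := by
  simp_rw [orderedTerm_eq hx σ ε]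
  refine Integrable.const_mul ?_ _
  exact integrable_comp_perm σ (integrable_gaussian_div (x := x ∘ σ) (chainShift (x ∘ σ))
    (chainCoeff (x ∘ σ)) (fun j => hx _)
    (fun q => mul_ne_zero hε.ne' (cast_sub_cast_ne_zero (perm_castSucc_ne_succ σ q))))

theorem integral_orderedTerm (hx : ∀ i, 0 < x i) (σ : Equiv.Perm (Fin (m + 1))) {ε : ℝ}
    (hε : 0 < ε) :
    ∫ a : Fin (m + 1) → ℝ, ((∏ j, Real.exp (-(a j) ^ 2 / (2 * x j)) : ℝ) : ℂ) *
      (Complex.exp (pairSum (weightForm (fun j => (x j : ℂ)) (shiftedPoint x a ε)) (List.ofFn σ)) *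
        chainProd (shiftedPoint x a ε) (List.ofFn σ)) =
      (Real.exp (ε * ∑ k, x (σ k) * chainShift (x ∘ σ) k * (σ k : ℕ)) *
        (Real.exp (-(∑ k, x k) ^ 3 / 24) * (∏ k, (2 * Real.pi * x k)) *
          ∫ s, (∏ q : Fin m, Real.exp (s q * (ε * (((σ q.castSucc : ℕ) : ℝ) - ((σ q.succ : ℕ) : ℝ))))) *
            pathIntegrand x stepWeight σ 0 s) : ℝ) := by
  simp_rw [orderedTerm_eq hx σ ε]
  rw [integral_const_mul, integral_comp_perm σ fun a =>
    (((∏ j, Real.exp (-(a j) ^ 2 / (2 * (x ∘ σ) j)) : ℝ) : ℂ) *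
        Complex.exp (Complex.I * (∑ k, chainShift (x ∘ σ) k * a k : ℝ)) *
        ∏ q : Fin m, (Complex.I * (∑ k, chainCoeff (x ∘ σ) q k * a k : ℝ) +
          (ε * (((σ q.castSucc : ℕ) : ℝ) - ((σ q.succ : ℕ) : ℝ)) : ℝ))⁻¹),
    integral_gaussian_div (x := x ∘ σ) (chainShift (x ∘ σ))
    (chainCoeff (x ∘ σ)) (fun j => hx _)
    (fun q => mul_ne_zero hε.ne' (cast_sub_cast_ne_zero (perm_castSucc_ne_succ σ q))),
    ← Complex.ofReal_mul]
  congr 2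
  rw [← integral_const_mul, ← integral_const_mul]
  congr 1
  funext s
  simp_rw [sum_mul_chainCoeff]
  rw [prod_exp_chainShift (y := x ∘ σ) fun k => hx _]
  -- Only the sign of the real part matters, so the weights do not depend on ε.
  simp_rw [halfLineWeight_const_mul hε]
  rw [Finset.prod_mul_distrib, pathIntegrand]
  have h1 : ∑ k, (x ∘ σ) k = ∑ k, x k := Equiv.sum_comp σ x
  have h2 : ∏ k, (2 * Real.pi * x k) = (∏ k, Real.sqrt (2 * Real.pi * (x ∘ σ) k)) *
      ∏ k, Real.sqrt (2 * Real.pi * (x ∘ σ) k) := by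
    rw [← Finset.prod_mul_distrib, ← Equiv.prod_comp σ]
    refine Finset.prod_congr rfl fun k _ => (Real.mul_self_sqrt ?_).symm
    have := hx (σ k)
    have := Real.pi_pos
    positivity
  rw [h1, h2]
  simp only [stepWeight, Function.comp_apply]
  ring

theorem tendsto_integral_orderedTerm (hx : ∀ i, 0 < x i) (σ : Equiv.Perm (Fin (m + 1))) :
    Tendsto (fun ε : ℝ => ∫ a : Fin (m + 1) → ℝ,
      ((∏ j, Real.exp (-(a j) ^ 2 / (2 * x j)) : ℝ) : ℂ) *
      (Complex.exp (pairSum (weightForm (fun j => (x j : ℂ)) (shiftedPoint x a ε)) (List.ofFn σ)) *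
        chainProd (shiftedPoint x a ε) (List.ofFn σ))) (𝓝[>] 0)
      (𝓝 ((Real.exp (-(∑ k, x k) ^ 3 / 24) * (∏ k, (2 * Real.pi * x k)) *
        pathIntegral x stepWeight (List.ofFn σ) 0 : ℝ) : ℂ)) := by
  have hev : ∀ᶠ ε : ℝ in 𝓝[>] 0, ((Real.exp (ε * ∑ k, x (σ k) * chainShift (x ∘ σ) k * (σ k : ℕ)) *
        (Real.exp (-(∑ k, x k) ^ 3 / 24) * (∏ k, (2 * Real.pi * x k)) *
          ∫ s, (∏ q : Fin m, Real.exp (s q * (ε * (((σ q.castSucc : ℕ) : ℝ) - ((σ q.succ : ℕ) : ℝ))))) *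
            pathIntegrand x stepWeight σ 0 s) : ℝ) : ℂ) = ∫ a : Fin (m + 1) → ℝ,
      ((∏ j, Real.exp (-(a j) ^ 2 / (2 * x j)) : ℝ) : ℂ) *
      (Complex.exp (pairSum (weightForm (fun j => (x j : ℂ)) (shiftedPoint x a ε)) (List.ofFn σ)) *
        chainProd (shiftedPoint x a ε) (List.ofFn σ)) := by
    filter_upwards [self_mem_nhdsWithin] with ε hε
    exact (integral_orderedTerm hx σ hε).symm
  refine Tendsto.congr' hev ?_
  refine (Complex.continuous_ofReal.tendsto _).comp ?_
  obtain ⟨hinteg, heq⟩ := integrable_and_integral_pathIntegrand hx stepWeight measurable_stepWeight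
    abs_stepWeight_le σ 0
  have h1 : Tendsto (fun ε : ℝ => Real.exp (ε * ∑ k, x (σ k) * chainShift (x ∘ σ) k * (σ k : ℕ)))
      (𝓝[>] 0) (𝓝 1) := by
    have : Continuous fun ε : ℝ =>
        Real.exp (ε * ∑ k, x (σ k) * chainShift (x ∘ σ) k * (σ k : ℕ)) := by fun_prop
    have h := (this.tendsto 0).mono_left (nhdsWithin_le_nhds (s := Set.Ioi 0))
    simpa using h
  have h2 : Tendsto (fun ε : ℝ => ∫ s, (∏ q : Fin m,
      Real.exp (s q * (ε * (((σ q.castSucc : ℕ) : ℝ) - ((σ q.succ : ℕ) : ℝ))))) *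
            pathIntegrand x stepWeight σ 0 s) (𝓝[>] 0)
      (𝓝 (pathIntegral x stepWeight (List.ofFn σ) 0)) := by
    rw [← heq]
    refine tendsto_integral_filter_of_dominated_convergence
      (fun s => |pathIntegrand x stepWeight σ 0 s|) ?_ ?_ hinteg.abs ?_
    · refine Eventually.of_forall fun ε => ?_
      exact Measurable.aestronglyMeasurable (by fun_prop) |>.mul hinteg.aestronglyMeasurable
    · filter_upwards [self_mem_nhdsWithin] with ε hε
      refine ae_of_all _ fun s => ?_
      rw [pathIntegrand, ← mul_assoc, norm_mul, abs_mul, Real.norm_eq_abs, Real.norm_eq_abs,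
        ← Finset.prod_mul_distrib, Finset.abs_prod, Finset.abs_prod, Finset.abs_prod]
      refine mul_le_mul_of_nonneg_right (Finset.prod_le_prod (fun _ _ => abs_nonneg _)
        fun q _ => ?_) (Finset.prod_nonneg fun _ _ => abs_nonneg _)
      rw [mul_comm]
      have h := halfLineWeight_mul_exp_abs_le
        (ε * (((σ q.castSucc : ℕ) : ℝ) - ((σ q.succ : ℕ) : ℝ))) (s q)
      rw [halfLineWeight_const_mul hε] at h
      exact h
    · refine ae_of_all _ fun s => ?_
      have : Continuous fun ε : ℝ => (∏ q : Fin m,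
        Real.exp (s q * (ε * (((σ q.castSucc : ℕ) : ℝ) - ((σ q.succ : ℕ) : ℝ))))) *
            pathIntegrand x stepWeight σ 0 s := by fun_prop
      have h := (this.tendsto 0).mono_left (nhdsWithin_le_nhds (s := Set.Ioi 0))
      simpa using h
  have h3 := h1.mul (h2.const_mul (Real.exp (-(∑ k, x k) ^ 3 / 24) * (∏ k, (2 * Real.pi * x k))))
  rwa [one_mul] at h3

end GaussianSymmetric

/-! ### Removing the regularisation -/

section GaussianSymmetricLimit

theorem measurable_chainProd {ι α : Type*} [MeasurableSpace α] {z : α → ι → ℂ}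
    (hz : ∀ i, Measurable fun a => z a i) (l : List ι) : Measurable fun a => chainProd (z a) l := by
  induction l with
  | nil => exact measurable_const
  | cons i l ih =>
    match l, ih with
    | [], _ => exact measurable_const
    | j :: l, ih => exact ((hz i).sub (hz j)).inv.mul ih

theorem measurable_pairSum {ι α : Type*} [MeasurableSpace α] {ω : α → ι → ι → ℂ}
    (hω : ∀ i j, Measurable fun a => ω a i j) (l : List ι) :
    Measurable fun a => pairSum (ω a) l := by
  induction l with
  | nil => exact measurable_const
  | cons i l ih =>
    refine Measurable.add ?_ ih
    clear ih
    induction l with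
    | nil => simp
    | cons j l ih =>
      simp only [List.map_cons, List.sum_cons]
      exact (hω i j).add ih

theorem measurable_symSum {ι α : Type*} [DecidableEq ι] [MeasurableSpace α] {z : α → ι → ℂ}
    {ω : α → ι → ι → ℂ} (hz : ∀ i, Measurable fun a => z a i)
    (hω : ∀ i j, Measurable fun a => ω a i j) (S : Finset ι) :
    Measurable fun a => symSum (ω a) (z a) S :=
  Finset.measurable_sum _ fun l _ =>
    (Complex.measurable_exp.comp (measurable_pairSum hω l)).mul (measurable_chainProd hz l)

theorem tendsto_chainProd {ι α : Type*} {F : Filter α} {z : α → ι → ℂ} {z₀ : ι → ℂ}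
    (hz : ∀ i, Tendsto (fun a => z a i) F (𝓝 (z₀ i))) (h₀ : Function.Injective z₀) {l : List ι}
    (hl : l.Nodup) : Tendsto (fun a => chainProd (z a) l) F (𝓝 (chainProd z₀ l)) := by
  induction l with
  | nil => exact tendsto_const_nhds
  | cons i l ih =>
    match l, ih, hl with
    | [], _, _ => exact tendsto_const_nhds
    | j :: l, ih, hl =>
      refine (((hz i).sub (hz j)).inv₀ ?_).mul (ih (List.nodup_cons.1 hl).2)
      refine sub_ne_zero.2 fun h => ?_
      have := h₀ h
      simp [this] at hl

theorem tendsto_pairSum {ι α : Type*} {F : Filter α} {ω : α → ι → ι → ℂ} {ω₀ : ι → ι → ℂ}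
    (hω : ∀ i j, Tendsto (fun a => ω a i j) F (𝓝 (ω₀ i j))) (l : List ι) :
    Tendsto (fun a => pairSum (ω a) l) F (𝓝 (pairSum ω₀ l)) := by
  induction l with
  | nil => exact tendsto_const_nhds
  | cons i l ih =>
    refine Tendsto.add ?_ ih
    clear ih
    induction l with
    | nil => exact tendsto_const_nhds
    | cons j l ih =>
      simp only [List.map_cons, List.sum_cons]
      exact (hω i j).add ih

theorem tendsto_symSum {ι α : Type*} [DecidableEq ι] {F : Filter α} {z : α → ι → ℂ} {z₀ : ι → ℂ}
    {ω : α → ι → ι → ℂ} {ω₀ : ι → ι → ℂ} (hz : ∀ i, Tendsto (fun a => z a i) F (𝓝 (z₀ i)))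
    (h₀ : Function.Injective z₀) (hω : ∀ i j, Tendsto (fun a => ω a i j) F (𝓝 (ω₀ i j)))
    (S : Finset ι) : Tendsto (fun a => symSum (ω a) (z a) S) F (𝓝 (symSum ω₀ z₀ S)) :=
  tendsto_finsetSum _ fun l hl =>
    ((Complex.continuous_exp.tendsto _).comp (tendsto_pairSum hω l)).mul
      (tendsto_chainProd hz h₀ (nodup_of_mem_orderings hl))

variable {m : ℕ} {x : Fin (m + 1) → ℝ}

theorem ae_injective_div (hx : ∀ i, 0 < x i) :
    ∀ᵐ a : Fin (m + 1) → ℝ, Function.Injective fun j => a j / x j := by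
  have h : ∀ i j : Fin (m + 1), i ≠ j → ∀ᵐ a : Fin (m + 1) → ℝ, a i / x i ≠ a j / x j := by
    intro i j hij
    let L : (Fin (m + 1) → ℝ) →ₗ[ℝ] ℝ :=
      (x i)⁻¹ • LinearMap.proj i - (x j)⁻¹ • LinearMap.proj j
    have hL : ∀ a, L a = a i / x i - a j / x j := by
      intro a
      simp [L, div_eq_inv_mul]
    have hne : LinearMap.ker L ≠ ⊤ := by
      intro htop
      have : Pi.single i (1 : ℝ) ∈ LinearMap.ker L := htop ▸ Submodule.mem_top
      rw [LinearMap.mem_ker, hL] at this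
      simp [Ne.symm hij] at this
      exact (hx i).ne' this
    have h0 := Measure.addHaar_submodule (volume : Measure (Fin (m + 1) → ℝ)) _ hne
    rw [ae_iff]
    refine measure_mono_null (fun a ha => ?_) h0
    simp only [ne_eq, not_not, Set.mem_ofPred_eq] at ha
    change a ∈ LinearMap.ker L
    rw [LinearMap.mem_ker, hL, ha, sub_self]
  have h' : ∀ᵐ a : Fin (m + 1) → ℝ, ∀ i j, i ≠ j → a i / x i ≠ a j / x j := by
    rw [ae_all_iff]; intro i
    rw [ae_all_iff]; intro j
    by_cases hij : i = j
    · simp [hij]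
    · filter_upwards [h i j hij] with a ha _ using ha
  filter_upwards [h'] with a ha i j hij
  by_contra hne
  exact ha i j hne hij

theorem shiftedPoint_injective_of_pos (a : Fin (m + 1) → ℝ) {ε : ℝ} (hε : 0 < ε) :
    Function.Injective (shiftedPoint x a ε) := by
  intro i j h
  have h1 := congrArg Complex.re h
  simp only [shiftedPoint, Complex.add_re, Complex.mul_re, Complex.I_re, Complex.I_im,
    Complex.ofReal_re, Complex.ofReal_im, zero_mul, mul_zero, sub_zero, zero_add] at h1
  have h2 := mul_left_cancel₀ hε.ne' h1
  exact Fin.ext (by exact_mod_cast h2)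

theorem shiftedPoint_injective_of_generic {a : Fin (m + 1) → ℝ}
    (ha : Function.Injective fun j => a j / x j) : Function.Injective (shiftedPoint x a 0) := by
  intro i j h
  have h1 := congrArg Complex.im h
  simp only [shiftedPoint, Complex.add_im, Complex.mul_im, Complex.I_re, Complex.I_im,
    Complex.ofReal_re, Complex.ofReal_im, zero_mul, one_mul, add_zero, zero_add] at h1
  exact ha h1

/-- The points i a_j / x_j contribute only imaginary parts to the form. Its real part is ε x_i x_j
(i - j) / 2, free of `a`, so the bound is uniform in `a` and in ε ≤ 1. -/
theorem exists_norm_symSum_shiftedPoint_le (x : Fin (m + 1) → ℝ) :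
    ∃ C, ∀ ε ∈ Set.Icc (0 : ℝ) 1, ∀ a, Function.Injective (shiftedPoint x a ε) →
      ‖symSum (weightForm (fun j => (x j : ℂ)) (shiftedPoint x a ε)) (shiftedPoint x a ε)
        Finset.univ‖ ≤ C := by
  obtain ⟨C, -, hC⟩ := exists_norm_symSum_le (fun j => (x j : ℂ))
    (∑ i, ∑ j, |x i * x j * (((i : ℕ) : ℝ) - ((j : ℕ) : ℝ)) / 2|)
    (Finset.univ : Finset (Fin (m + 1)))
  refine ⟨C, fun ε hε a ha => ?_⟩
  have h := hC (shiftedPoint x a ε) ha ?_ 1 ⟨zero_le_one, le_rfl⟩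
  · simpa only [Complex.ofReal_one, one_mul] using h
  · intro i j
    have h1 : (weightForm (fun j => (x j : ℂ)) (shiftedPoint x a ε) i j).re =
        ε * (x i * x j * (((i : ℕ) : ℝ) - ((j : ℕ) : ℝ)) / 2) := by
      have : weightForm (fun j => (x j : ℂ)) (shiftedPoint x a ε) i j =
          ((ε * (x i * x j * (((i : ℕ) : ℝ) - ((j : ℕ) : ℝ)) / 2) : ℝ) : ℂ) +
            ((x i * x j * (a i / x i - a j / x j) / 2 : ℝ) : ℂ) * Complex.I := by
        simp only [weightForm, shiftedPoint]
        push_cast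
        ring
      rw [this, Complex.add_re, Complex.re_ofReal_mul]
      simp
    rw [h1, abs_mul, abs_of_nonneg hε.1]
    refine (mul_le_of_le_one_left (abs_nonneg _) hε.2).trans ?_
    refine le_trans ?_ (Finset.single_le_sum (f := fun i => ∑ j,
      |x i * x j * (((i : ℕ) : ℝ) - ((j : ℕ) : ℝ)) / 2|)
      (fun i _ => Finset.sum_nonneg fun j _ => abs_nonneg _) (Finset.mem_univ i))
    exact Finset.single_le_sum (f := fun j => |x i * x j * (((i : ℕ) : ℝ) - ((j : ℕ) : ℝ)) / 2|)
      (fun j _ => abs_nonneg _) (Finset.mem_univ j)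

theorem measurable_shiftedPoint (x : Fin (m + 1) → ℝ) (ε : ℝ) (j : Fin (m + 1)) :
    Measurable fun a => shiftedPoint x a ε j := by
  unfold shiftedPoint
  fun_prop

theorem aestronglyMeasurable_gaussian_symSum (x : Fin (m + 1) → ℝ) (ε : ℝ) :
    AEStronglyMeasurable (fun a : Fin (m + 1) → ℝ =>
      ((∏ j, Real.exp (-(a j) ^ 2 / (2 * x j)) : ℝ) : ℂ) *
        symSum (weightForm (fun j => (x j : ℂ)) (shiftedPoint x a ε)) (shiftedPoint x a ε)
          Finset.univ) := by
  refine Measurable.aestronglyMeasurable (Measurable.mul (by fun_prop) ?_)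
  refine measurable_symSum (measurable_shiftedPoint x ε) (fun i j => ?_) _
  have := measurable_shiftedPoint x ε
  unfold weightForm
  exact ((((this i).sub (this j))).const_mul _).div_const _

theorem integrable_gaussian_real (hx : ∀ i, 0 < x i) :
    Integrable fun a : Fin (m + 1) → ℝ => ∏ j, Real.exp (-(a j) ^ 2 / (2 * x j)) :=
  Integrable.fintype_prod (f := fun j (a : ℝ) => Real.exp (-a ^ 2 / (2 * x j)))
    fun j => integrable_exp_neg_sq_div (hx j)

theorem integrable_gaussian_symSum (hx : ∀ i, 0 < x i) :
    Integrable fun a : Fin (m + 1) → ℝ =>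
      ((∏ j, Real.exp (-(a j) ^ 2 / (2 * x j)) : ℝ) : ℂ) *
        symSum (weightForm (fun j => (x j : ℂ)) (shiftedPoint x a 0)) (shiftedPoint x a 0)
          Finset.univ := by
  obtain ⟨C, hC⟩ := exists_norm_symSum_shiftedPoint_le x
  refine ((integrable_gaussian_real hx).mul_const C).mono'
    (aestronglyMeasurable_gaussian_symSum x 0) ?_
  filter_upwards [ae_injective_div hx] with a ha
  rw [norm_mul, Complex.norm_real, Real.norm_of_nonneg
    (Finset.prod_nonneg fun j _ => (Real.exp_pos _).le)]
  exact mul_le_mul_of_nonneg_left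
    (hC 0 ⟨le_rfl, zero_le_one⟩ a (shiftedPoint_injective_of_generic ha))
    (Finset.prod_nonneg fun j _ => (Real.exp_pos _).le)

/-- The limit ε → 0+ is computed twice. On the whole sum the uniform bound gives dominated
convergence. For ε > 0 the sum may be split into orderings, whose integrals converge one by one,
although a term with a pole is not integrable at ε = 0. -/
theorem integral_gaussian_symSum (hx : ∀ i, 0 < x i) :
    ∫ a : Fin (m + 1) → ℝ, ((∏ j, Real.exp (-(a j) ^ 2 / (2 * x j)) : ℝ) : ℂ) *
        symSum (weightForm (fun j => (x j : ℂ)) (shiftedPoint x a 0)) (shiftedPoint x a 0)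
          Finset.univ =
      (Real.exp (-(∑ k, x k) ^ 3 / 24) * (∏ k, (2 * Real.pi * x k)) *
        ∑ l ∈ orderings (Finset.univ : Finset (Fin (m + 1))),
          pathIntegral x stepWeight l 0 : ℝ) := by
  obtain ⟨C, hC⟩ := exists_norm_symSum_shiftedPoint_le x
  have hlim : Tendsto (fun ε : ℝ => ∫ a : Fin (m + 1) → ℝ,
      ((∏ j, Real.exp (-(a j) ^ 2 / (2 * x j)) : ℝ) : ℂ) *
        symSum (weightForm (fun j => (x j : ℂ)) (shiftedPoint x a ε)) (shiftedPoint x a ε)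
          Finset.univ) (𝓝[>] 0) (𝓝 (∫ a : Fin (m + 1) → ℝ,
      ((∏ j, Real.exp (-(a j) ^ 2 / (2 * x j)) : ℝ) : ℂ) *
        symSum (weightForm (fun j => (x j : ℂ)) (shiftedPoint x a 0)) (shiftedPoint x a 0)
          Finset.univ)) := by
    refine tendsto_integral_filter_of_dominated_convergence
      (fun a => (∏ j, Real.exp (-(a j) ^ 2 / (2 * x j))) * C) ?_ ?_
      ((integrable_gaussian_real hx).mul_const C) ?_
    · exact Eventually.of_forall fun ε => aestronglyMeasurable_gaussian_symSum x ε
    · filter_upwards [Ioc_mem_nhdsGT (zero_lt_one' ℝ)] with ε hε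
      refine ae_of_all _ fun a => ?_
      rw [norm_mul, Complex.norm_real, Real.norm_of_nonneg
        (Finset.prod_nonneg fun j _ => (Real.exp_pos _).le)]
      exact mul_le_mul_of_nonneg_left
        (hC ε ⟨hε.1.le, hε.2⟩ a (shiftedPoint_injective_of_pos a hε.1))
        (Finset.prod_nonneg fun j _ => (Real.exp_pos _).le)
    · filter_upwards [ae_injective_div hx] with a ha
      refine Tendsto.const_mul _ ?_
      have hz : ∀ i, Tendsto (fun ε => shiftedPoint x a ε i) (𝓝[>] 0) (𝓝 (shiftedPoint x a 0 i)) := by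
        intro i
        have : Continuous fun ε => shiftedPoint x a ε i := by
          unfold shiftedPoint
          fun_prop
        exact (this.tendsto 0).mono_left nhdsWithin_le_nhds
      refine tendsto_symSum hz (shiftedPoint_injective_of_generic ha) (fun i j => ?_) _
      exact (((hz i).sub (hz j)).const_mul _).div_const _
  refine tendsto_nhds_unique hlim ?_
  have hsum := tendsto_finsetSum (Finset.univ : Finset (Equiv.Perm (Fin (m + 1)))) fun σ _ =>
    tendsto_integral_orderedTerm hx σ
  rw [sum_orderings_univ, Finset.mul_sum, Complex.ofReal_sum]
  refine Tendsto.congr' ?_ hsum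
  filter_upwards [self_mem_nhdsWithin] with ε hε
  rw [← integral_finsetSum _ fun σ _ => integrable_orderedTerm hx σ hε]
  refine integral_congr_ae (ae_of_all _ fun a => ?_)
  simp only [symSum]
  rw [sum_orderings_univ, Finset.mul_sum]

theorem buryakIntegrand_ae_eq (hx : ∀ i, 0 < x i) :
    buryakIntegrand (m + 1) x =ᵐ[volume] fun a => ((∏ j, x j : ℝ) : ℂ)⁻¹ *
      (((∏ j, Real.exp (-(a j) ^ 2 / (2 * x j)) : ℝ) : ℂ) *
        symSum (weightForm (fun j => (x j : ℂ)) (shiftedPoint x a 0)) (shiftedPoint x a 0)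
          Finset.univ) := by
  filter_upwards [ae_injective_div hx] with a ha
  have hz : (fun j => Complex.I * (a j : ℂ) / (x j : ℂ)) = shiftedPoint x a 0 := by
    funext j
    simp only [shiftedPoint]
    push_cast
    ring
  rw [buryakIntegrand, buryakP_eq_symSum (by omega) (fun i => by exact_mod_cast (hx i).ne')
    (hz ▸ shiftedPoint_injective_of_generic ha), hz, Complex.ofReal_prod _ x]
  ring

theorem integrable_buryakIntegrand (hx : ∀ i, 0 < x i) :
    Integrable (buryakIntegrand (m + 1) x) :=
  ((integrable_gaussian_symSum hx).const_mul _).congr (buryakIntegrand_ae_eq hx).symm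

theorem buryakF_eq (hx : ∀ i, 0 < x i) :
    buryakF (m + 1) x =
      (((2 * Real.pi) ^ (((m + 1 : ℕ) : ℝ) / 2) / ∏ j, Real.sqrt (x j) : ℝ) : ℂ) *
        (((∑ j, x j)⁻¹ * ∑ l ∈ orderings (Finset.univ : Finset (Fin (m + 1))),
          pathIntegral x stepWeight l 0 : ℝ) : ℂ) := by
  have hpi := Real.pi_pos
  rw [buryakF, integral_congr_ae (buryakIntegrand_ae_eq hx), integral_const_mul,
    integral_gaussian_symSum hx, ← Complex.ofReal_inv, ← Complex.ofReal_mul, ← Complex.ofReal_mul,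
    ← Complex.ofReal_mul]
  congr 1
  have hX : 0 < ∑ j, x j := Finset.sum_pos (fun i _ => hx i) Finset.univ_nonempty
  have h1 : ∏ k, (2 * Real.pi * x k) =
      (∏ k, Real.sqrt (2 * Real.pi * x k)) * ∏ k, Real.sqrt (2 * Real.pi * x k) := by
    rw [← Finset.prod_mul_distrib]
    refine Finset.prod_congr rfl fun k _ => (Real.mul_self_sqrt ?_).symm
    have := hx k
    positivity
  have h2 : ∏ k, Real.sqrt (2 * Real.pi * x k) =
      (2 * Real.pi) ^ (((m + 1 : ℕ) : ℝ) / 2) * ∏ k, Real.sqrt (x k) := by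
    simp_rw [Real.sqrt_mul (by positivity : (0 : ℝ) ≤ 2 * Real.pi)]
    rw [Finset.prod_mul_distrib, Finset.prod_const, Finset.card_univ, Fintype.card_fin,
      Real.sqrt_eq_rpow, ← Real.rpow_natCast, ← Real.rpow_mul (by positivity)]
    congr 2
    ring
  have h3 : ∏ k, x k = (∏ k, Real.sqrt (x k)) * ∏ k, Real.sqrt (x k) := by
    rw [← Finset.prod_mul_distrib]
    exact Finset.prod_congr rfl fun k _ => (Real.mul_self_sqrt (hx k).le).symm
  -- The cubic prefactor of Buryak's function is exactly cancelled by the one left over from the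
  -- kernels.
  have h4 : Real.exp (-(∑ k, x k) ^ 3 / 24) * Real.exp ((∑ k, x k) ^ 3 / 24) = 1 := by
    rw [← Real.exp_add]
    ring_nf
    exact Real.exp_zero
  have h5 : ∏ k, Real.sqrt (x k) ≠ 0 :=
    Finset.prod_ne_zero_iff.2 fun k _ => (Real.sqrt_pos.2 (hx k)).ne'
  have h6 : (2 * Real.pi) ^ (((m + 1 : ℕ) : ℝ) / 2) ≠ 0 :=
    (Real.rpow_pos_of_pos (by positivity) _).ne'
  rw [h1, h2, h3]
  generalize Real.exp (-(∑ k, x k) ^ 3 / 24) = E at *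
  generalize (2 * Real.pi) ^ (((m + 1 : ℕ) : ℝ) / 2) = P at *
  generalize ∏ k, Real.sqrt (x k) = Q at *
  generalize ∑ l ∈ orderings (Finset.univ : Finset (Fin (m + 1))), pathIntegral x stepWeight l 0 = V
  field_simp
  linear_combination V * h4

end GaussianSymmetricLimit

/-! ### Merging the blocks of descents -/

section Merge

variable {ι : Type*} {x : ι → ℝ} {h : ι → ι → ℝ → ℝ}

/-- The variant of `pathIntegral` in which the first kernel and the first weight are prescribed. -/
def headIntegral (x : ι → ℝ) (h : ι → ι → ℝ → ℝ) (y : ℝ) (g : ι → ℝ → ℝ) : List ι → ℝ → ℝ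
  | [], r => airyKernel y r 0
  | j :: l, r => ∫ s, g j s * (airyKernel y r s * pathIntegral x h (j :: l) s)

theorem pathIntegral_cons (x : ι → ℝ) (h : ι → ι → ℝ → ℝ) (i : ι) (l : List ι) (r : ℝ) :
    pathIntegral x h (i :: l) r = headIntegral x h (x i) (h i) l r := by
  cases l <;> rfl

/-- A kernel integrated against a path over the whole line is absorbed into the first kernel. -/
theorem integral_airyKernel_mul_pathIntegral (hx : ∀ i, 0 < x i) (hm : ∀ i j, Measurable (h i j))
    (h1 : ∀ i j s, |h i j s| ≤ 1) {y : ℝ} (hy : 0 < y) (j : ι) (l : List ι) (r : ℝ) :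
    ∫ s, airyKernel y r s * pathIntegral x h (j :: l) s =
      headIntegral x h (y + x j) (h j) l r := by
  match l with
  | [] => exact integral_airyKernel_mul hy (hx j) r 0
  | k :: l =>
    obtain ⟨hpm, hpb⟩ := pathIntegral_measurable_and_abs_le hx hm h1 l k
    have hX := sum_map_pos hx k l
    set X := ((k :: l).map x).sum
    -- Majorant for Fubini: the tail of the path is replaced by a single kernel of its total
    -- parameter.
    have hdom : Integrable (fun p : ℝ × ℝ =>
        airyKernel y r p.1 * (airyKernel (x j) p.1 p.2 * airyKernel X p.2 0))
        (volume.prod volume) := by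
      have hmeas : Measurable (fun p : ℝ × ℝ =>
          airyKernel y r p.1 * (airyKernel (x j) p.1 p.2 * airyKernel X p.2 0)) :=
        (measurable_airyKernel _ measurable_const measurable_fst).mul
          ((measurable_airyKernel _ measurable_fst measurable_snd).mul
            (measurable_airyKernel _ measurable_snd measurable_const))
      refine (integrable_prod_iff hmeas.aestronglyMeasurable).2 ⟨ae_of_all _ fun s => ?_, ?_⟩
      · exact (integrable_airyKernel_mul (hx j) hX s 0).const_mul (airyKernel y r s)
      · have : (fun s => ∫ t, ‖airyKernel y r s * (airyKernel (x j) s t * airyKernel X t 0)‖) =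
            fun s => airyKernel y r s * airyKernel (x j + X) s 0 := by
          funext s
          simp_rw [Real.norm_eq_abs, fun t => abs_of_nonneg (mul_nonneg (airyKernel_nonneg y r s)
            (mul_nonneg (airyKernel_nonneg (x j) s t) (airyKernel_nonneg X t 0)))]
          rw [integral_const_mul, integral_airyKernel_mul (hx j) hX]
        rw [this]
        exact integrable_airyKernel_mul hy (add_pos (hx j) hX) r 0
    have hinteg : Integrable (Function.uncurry fun s t =>
        airyKernel y r s * (h j k t * (airyKernel (x j) s t * pathIntegral x h (k :: l) t)))
        (volume.prod volume) := by
      refine hdom.mono' ?_ (ae_of_all _ fun p => ?_)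
      · exact ((measurable_airyKernel _ measurable_const measurable_fst).mul
          (((hm j k).comp measurable_snd).mul
            ((measurable_airyKernel _ measurable_fst measurable_snd).mul
              (hpm.comp measurable_snd)))).aestronglyMeasurable
      · simp only [Function.uncurry, norm_mul, Real.norm_eq_abs,
          abs_of_nonneg (airyKernel_nonneg _ _ _)]
        refine mul_le_mul_of_nonneg_left ?_ (airyKernel_nonneg _ _ _)
        refine (mul_le_of_le_one_left (mul_nonneg (airyKernel_nonneg _ _ _) (abs_nonneg _))
          (h1 j k _)).trans ?_
        exact mul_le_mul_of_nonneg_left (hpb _) (airyKernel_nonneg _ _ _)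
    simp only [pathIntegral, headIntegral]
    simp_rw [← integral_const_mul]
    rw [integral_integral_swap hinteg]
    refine integral_congr_ae (ae_of_all _ fun t => ?_)
    simp only
    rw [← integral_airyKernel_mul hy (hx j), ← integral_mul_const, ← integral_const_mul]
    refine integral_congr_ae (ae_of_all _ fun s => ?_)
    simp only
    ring

/-- A nonempty set is its maximum together with a set of smaller elements; this identifies
decreasing runs with sets. -/
theorem sum_powerset_max {n : ℕ} (S : Finset (Fin n)) (f : Finset (Fin n) → ℝ) :
    ∑ j ∈ S, ∑ B ∈ (S.erase j).powerset with ∀ b ∈ B, b < j, f (insert j B) =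
      ∑ B ∈ S.powerset with B.Nonempty, f B := by
  simp_rw [Finset.sum_filter]
  rw [← sum_powerset_sum_mem S fun j B => if ∀ b ∈ B, b < j then f (insert j B) else 0]
  refine Finset.sum_congr rfl fun B _ => ?_
  split_ifs with hB
  · rw [Finset.sum_eq_single (B.max' hB)]
    · rw [if_pos, Finset.insert_erase (B.max'_mem hB)]
      intro b hb
      exact Finset.lt_max'_of_mem_erase_max' B hB hb
    · intro a ha hne
      refine if_neg fun hlt => ?_
      have h1 := hlt (B.max' hB) (Finset.mem_erase.2 ⟨hne.symm, B.max'_mem hB⟩)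
      exact absurd (B.le_max' a ha) h1.not_ge
    · exact fun hn => absurd (B.max'_mem hB) hn
  · rw [Finset.not_nonempty_iff_eq_empty.1 hB, Finset.sum_empty]

/-- The sum of `f` over all sequences of `ℓ` nonempty disjoint blocks with union `S`. -/
def sumBlocks [DecidableEq ι] : ℕ → Finset ι → (List (Finset ι) → ℝ) → ℝ
  | 0, S, f => if S = ∅ then f [] else 0
  | ℓ + 1, S, f => ∑ B ∈ S.powerset with B.Nonempty, sumBlocks ℓ (S \ B) fun L => f (B :: L)

theorem sumBlocks_integral [DecidableEq ι] (ℓ : ℕ) (S : Finset ι) (f : List (Finset ι) → ℝ → ℝ)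
    (hf : ∀ L, Integrable (f L)) :
    Integrable (fun s => sumBlocks ℓ S fun L => f L s) ∧
      ∫ s, sumBlocks ℓ S (fun L => f L s) = sumBlocks ℓ S fun L => ∫ s, f L s := by
  induction ℓ generalizing S f with
  | zero =>
    simp only [sumBlocks]
    split_ifs
    · exact ⟨hf [], rfl⟩
    · simp
  | succ ℓ ih =>
    simp only [sumBlocks]
    have h := fun B : Finset ι => ih (S \ B) (fun L => f (B :: L)) fun L => hf _
    refine ⟨integrable_finsetSum _ fun B _ => (h B).1, ?_⟩
    rw [integral_finsetSum _ fun B _ => (h B).1]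
    exact Finset.sum_congr rfl fun B _ => (h B).2

theorem sumBlocks_mul_left [DecidableEq ι] (c : ℝ) (ℓ : ℕ) (S : Finset ι)
    (f : List (Finset ι) → ℝ) : sumBlocks ℓ S (fun L => c * f L) = c * sumBlocks ℓ S f := by
  induction ℓ generalizing S f with
  | zero => simp [sumBlocks]
  | succ ℓ ih =>
    simp only [sumBlocks, Finset.mul_sum]
    exact Finset.sum_congr rfl fun B _ => ih _ _

/-- The sum of `x` over a block; the value at the empty block is chosen to be positive. -/
def blockWeight [DecidableEq ι] (x : ι → ℝ) (B : Finset ι) : ℝ := if B = ∅ then 1 else ∑ i ∈ B, x i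

theorem blockWeight_pos [DecidableEq ι] (hx : ∀ i, 0 < x i) (B : Finset ι) :
    0 < blockWeight x B := by
  unfold blockWeight
  split_ifs with hB
  · exact one_pos
  · exact Finset.sum_pos (fun i _ => hx i) (Finset.nonempty_iff_ne_empty.2 hB)

theorem blockWeight_of_nonempty [DecidableEq ι] {B : Finset ι} (hB : B.Nonempty) :
    blockWeight x B = ∑ i ∈ B, x i := if_neg hB.ne_empty

/-- The weight `-1` on `[0, ∞)`. -/
def blockStep (_ _ : Finset ι) (s : ℝ) : ℝ := halfLineWeight (-1) s

theorem measurable_blockStep (A B : Finset ι) : Measurable (blockStep A B) :=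
  measurable_halfLineWeight _

theorem abs_blockStep_le (A B : Finset ι) (s : ℝ) : |blockStep A B s| ≤ 1 :=
  abs_halfLineWeight_le _ _

/-- The contribution of all sequences of at most `N` blocks with union `S` that follow an initial
block of total size `y`. -/
def blocksAfter [DecidableEq ι] (x : ι → ℝ) (N : ℕ) (y : ℝ) (S : Finset ι) (r : ℝ) : ℝ :=
  ∑ ℓ ∈ Finset.range (N + 1), sumBlocks ℓ S fun L =>
    headIntegral (blockWeight x) blockStep y (blockStep ∅) L r

theorem blocksAfter_empty [DecidableEq ι] (N : ℕ) (y r : ℝ) :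
    blocksAfter x N y ∅ r = airyKernel y r 0 := by
  rw [blocksAfter, Finset.sum_eq_single 0]
  · simp [sumBlocks, headIntegral]
  · intro ℓ _ hℓ
    obtain ⟨k, rfl⟩ := Nat.exists_eq_succ_of_ne_zero hℓ
    rw [sumBlocks]
    refine Finset.sum_eq_zero fun B hB => ?_
    simp only [Finset.powerset_empty, Finset.mem_filter, Finset.mem_singleton] at hB
    exact absurd hB.1 hB.2.ne_empty
  · simp

/-- Splits off the next block. Since `S` is nonempty, at least one block follows, which uses up one
unit of the bound `N + 1`. -/
theorem blocksAfter_succ [DecidableEq ι] (hx : ∀ i, 0 < x i) (N : ℕ) {y : ℝ} (hy : 0 < y)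
    {S : Finset ι} (hS : S ≠ ∅) (r : ℝ) :
    blocksAfter x (N + 1) y S r = ∫ s, halfLineWeight (-1) s * (airyKernel y r s *
      ∑ B ∈ S.powerset with B.Nonempty, blocksAfter x N (∑ i ∈ B, x i) (S \ B) s) := by
  have hinteg : ∀ (B : Finset ι) (L : List (Finset ι)), Integrable fun s =>
      halfLineWeight (-1) s * (airyKernel y r s *
        pathIntegral (blockWeight x) blockStep (B :: L) s) := fun B L =>
    integrable_pathIntegral_step (blockWeight_pos hx) measurable_blockStep abs_blockStep_le
      (measurable_halfLineWeight _) (abs_halfLineWeight_le _) hy B L r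
  have hsum := fun (ℓ : ℕ) (B : Finset ι) => sumBlocks_integral ℓ (S \ B) _ (hinteg B)
  have hpt : ∀ s, halfLineWeight (-1) s * (airyKernel y r s *
      ∑ B ∈ S.powerset with B.Nonempty, blocksAfter x N (∑ i ∈ B, x i) (S \ B) s) =
      ∑ B ∈ S.powerset with B.Nonempty, ∑ ℓ ∈ Finset.range (N + 1), sumBlocks ℓ (S \ B) fun L =>
        halfLineWeight (-1) s * (airyKernel y r s *
          pathIntegral (blockWeight x) blockStep (B :: L) s) := by
    intro s
    rw [Finset.mul_sum, Finset.mul_sum]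
    refine Finset.sum_congr rfl fun B hB => ?_
    rw [blocksAfter, Finset.mul_sum, Finset.mul_sum]
    refine Finset.sum_congr rfl fun ℓ _ => ?_
    rw [sumBlocks_mul_left, sumBlocks_mul_left]
    simp_rw [pathIntegral_cons, blockWeight_of_nonempty (Finset.mem_filter.1 hB).2]
    rfl
  simp_rw [hpt]
  rw [integral_finsetSum _ fun B _ => integrable_finsetSum _ fun ℓ _ => (hsum ℓ B).1]
  simp_rw [fun B => integral_finsetSum (Finset.range (N + 1)) fun ℓ _ => (hsum ℓ B).1,
    fun ℓ B => (hsum ℓ B).2]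
  rw [Finset.sum_comm, blocksAfter, Finset.sum_range_succ']
  simp only [sumBlocks, if_neg hS, add_zero, headIntegral]
  rfl

end Merge

/-! ### From orderings to ordered set partitions -/

section MergeOrderings

variable {m : ℕ} {x : Fin (m + 1) → ℝ}

theorem stepWeight_of_lt {i j : Fin (m + 1)} (hij : i < j) :
    stepWeight i j = halfLineWeight (-1) := by
  have h1 : (((i : ℕ) : ℝ) - ((j : ℕ) : ℝ)) < 0 := sub_neg.2 (by exact_mod_cast hij)
  funext s
  rw [stepWeight, halfLineWeight_of_neg h1, halfLineWeight_of_neg (by norm_num)]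

/-- The identity 1_{(-∞,0]} = 1 - 1_{[0,∞)}; it fails only at the origin, a null set. -/
theorem stepWeight_of_gt {i j : Fin (m + 1)} (hij : j < i) {s : ℝ} (hs : s ≠ 0) :
    stepWeight i j s = halfLineWeight (-1) s + 1 := by
  have h1 : 0 < (((i : ℕ) : ℝ) - ((j : ℕ) : ℝ)) := sub_pos.2 (by exact_mod_cast hij)
  rw [stepWeight, halfLineWeight_of_pos h1, halfLineWeight_of_neg (by norm_num)]
  rcases lt_or_gt_of_ne hs with h | h
  · simp [h.le, h.not_ge]
  · simp [h.le, h.not_ge]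

/-- At a descent the summand -1_{[0,∞)} closes the current block before `j`, and the summand 1 fuses
`j` into it. At an ascent only the first option exists. -/
theorem headIntegral_cons_stepWeight (hx : ∀ i, 0 < x i) {y : ℝ} (hy : 0 < y)
    {i j : Fin (m + 1)} (hij : i ≠ j) (l : List (Fin (m + 1))) (r : ℝ) :
    headIntegral x stepWeight y (stepWeight i) (j :: l) r =
      (∫ s, halfLineWeight (-1) s * (airyKernel y r s * pathIntegral x stepWeight (j :: l) s)) +
        if j < i then headIntegral x stepWeight (y + x j) (stepWeight j) l r else 0 := by
  rw [headIntegral]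
  rcases lt_or_gt_of_ne hij with hlt | hlt
  · rw [if_neg hlt.not_gt, add_zero, stepWeight_of_lt hlt]
  · rw [if_pos hlt, ← integral_airyKernel_mul_pathIntegral hx measurable_stepWeight
      abs_stepWeight_le hy, ← integral_add
      (integrable_pathIntegral_step hx measurable_stepWeight abs_stepWeight_le
        (measurable_halfLineWeight _) (abs_halfLineWeight_le _) hy j l r)]
    · refine integral_congr_ae ?_
      filter_upwards [Measure.ae_ne volume (0 : ℝ)] with s hs
      rw [stepWeight_of_gt hlt hs]
      ring
    · simpa using integrable_pathIntegral_step hx measurable_stepWeight abs_stepWeight_le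
        (measurable_const (a := (1 : ℝ))) (by simp) hy j l r

/-- Here `y` is the weight of the current block so far and `i` its last letter. Letters still to be
fused must come in decreasing order below `i`, so they are recorded by a set `B` alone. Any `N` at
least the cardinality is allowed because the induction is used with two different bounds, and
surplus block counts contribute nothing. -/
theorem sum_headIntegral_eq (hx : ∀ i, 0 < x i) (S : Finset (Fin (m + 1))) :
    ∀ N, S.card ≤ N → ∀ i ∉ S, ∀ y, 0 < y → ∀ r,
      ∑ l ∈ orderings S, headIntegral x stepWeight y (stepWeight i) l r =
        ∑ B ∈ S.powerset with ∀ b ∈ B, b < i, blocksAfter x N (y + ∑ b ∈ B, x b) (S \ B) r := by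
  induction S using Finset.strongInduction with
  | H S ih =>
    intro N hN i hi y hy r
    rcases Finset.eq_empty_or_nonempty S with rfl | hne
    · simp [orderings_empty, headIntegral, Finset.sum_filter, blocksAfter_empty]
    obtain ⟨M, rfl⟩ : ∃ M, N = M + 1 :=
      Nat.exists_eq_succ_of_ne_zero (by have := Finset.card_pos.2 hne; omega)
    have hcard : ∀ j ∈ S, (S.erase j).card ≤ M := fun j hj => by
      rw [Finset.card_erase_of_mem hj]; omega
    have hij : ∀ j ∈ S, i ≠ j := fun j hj h => hi (h ▸ hj)
    rw [sum_orderings, if_neg hne.ne_empty, zero_add]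
    have hstep : ∀ j ∈ S, ∑ l ∈ orderings (S.erase j),
        headIntegral x stepWeight y (stepWeight i) (j :: l) r =
        (∑ l ∈ orderings (S.erase j), ∫ s, halfLineWeight (-1) s *
          (airyKernel y r s * pathIntegral x stepWeight (j :: l) s)) +
        if j < i then ∑ l ∈ orderings (S.erase j),
          headIntegral x stepWeight (y + x j) (stepWeight j) l r else 0 := by
      intro j hj
      rw [Finset.sum_congr rfl fun l _ => headIntegral_cons_stepWeight hx hy (hij j hj) l r,
        Finset.sum_add_distrib]
      split_ifs <;> simp
    rw [Finset.sum_congr rfl hstep, Finset.sum_add_distrib]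
    -- The block is closed: the next letter `j` opens a new one and is its maximum. This is the term
    -- `B = ∅`.
    have hfirst : ∑ j ∈ S, ∑ l ∈ orderings (S.erase j), ∫ s, halfLineWeight (-1) s *
          (airyKernel y r s * pathIntegral x stepWeight (j :: l) s) =
        blocksAfter x (M + 1) y S r := by
      rw [blocksAfter_succ hx M hy hne.ne_empty]
      have hinteg : ∀ (j : Fin (m + 1)) (l : List (Fin (m + 1))), Integrable fun s =>
          halfLineWeight (-1) s * (airyKernel y r s * pathIntegral x stepWeight (j :: l) s) :=
        fun j l => integrable_pathIntegral_step hx measurable_stepWeight abs_stepWeight_le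
          (measurable_halfLineWeight _) (abs_halfLineWeight_le _) hy j l r
      simp_rw [← fun j => integral_finsetSum (orderings (S.erase j)) fun l _ => hinteg j l]
      rw [← integral_finsetSum _ fun j _ => integrable_finsetSum _ fun l _ => hinteg j l]
      refine integral_congr_ae (ae_of_all _ fun s => ?_)
      simp only [← Finset.mul_sum]
      congr 2
      rw [← sum_powerset_max S fun B => blocksAfter x M (∑ i ∈ B, x i) (S \ B) s]
      refine Finset.sum_congr rfl fun j hj => ?_
      simp_rw [pathIntegral_cons]
      rw [ih _ (Finset.erase_ssubset hj) M (hcard j hj) j (Finset.notMem_erase _ _) _ (hx j)]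
      refine Finset.sum_congr rfl fun B hB => ?_
      have hjB : j ∉ B := fun h => lt_irrefl j ((Finset.mem_filter.1 hB).2 j h)
      rw [Finset.sum_insert hjB, Finset.sdiff_insert, Finset.erase_sdiff_comm]
    -- The letter `j < i` is fused: `j` is the maximum of what is absorbed from now on, giving the
    -- nonempty `B`.
    have hsecond : (∑ j ∈ S, if j < i then ∑ l ∈ orderings (S.erase j),
          headIntegral x stepWeight (y + x j) (stepWeight j) l r else 0) =
        ∑ B ∈ S.powerset with B.Nonempty, if ∀ b ∈ B, b < i then
          blocksAfter x (M + 1) (y + ∑ b ∈ B, x b) (S \ B) r else 0 := by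
      rw [← sum_powerset_max S fun B => if ∀ b ∈ B, b < i then
          blocksAfter x (M + 1) (y + ∑ b ∈ B, x b) (S \ B) r else 0]
      refine Finset.sum_congr rfl fun j hj => ?_
      rw [ih _ (Finset.erase_ssubset hj) (M + 1) ((hcard j hj).trans (Nat.le_succ M)) j
        (Finset.notMem_erase _ _) _ (add_pos hy (hx j))]
      split_ifs with hji
      · refine Finset.sum_congr rfl fun B hB => ?_
        have hB' := (Finset.mem_filter.1 hB).2
        have hjB : j ∉ B := fun h => lt_irrefl j (hB' j h)
        rw [if_pos, Finset.sum_insert hjB, Finset.sdiff_insert, Finset.erase_sdiff_comm, add_assoc]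
        intro b hb
        rcases Finset.mem_insert.1 hb with rfl | hb
        · exact hji
        · exact (hB' b hb).trans hji
      · symm
        refine Finset.sum_eq_zero fun B _ => if_neg fun h => hji (h j (Finset.mem_insert_self _ _))
    rw [hfirst, hsecond, Finset.sum_filter, Finset.sum_filter,
      ← Finset.add_sum_erase _ _ (Finset.empty_mem_powerset S),
      ← Finset.add_sum_erase (a := ∅) (s := S.powerset) (f := fun B => if ∀ b ∈ B, b < i then
          blocksAfter x (M + 1) (y + ∑ b ∈ B, x b) (S \ B) r else 0) (Finset.empty_mem_powerset S)]
    simp only [Finset.not_nonempty_empty, if_false, zero_add, Finset.notMem_empty,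
      false_implies, implies_true, if_true, Finset.sum_empty, add_zero, Finset.sdiff_empty]
    congr 1
    refine Finset.sum_congr rfl fun B hB => ?_
    rw [if_pos (Finset.nonempty_iff_ne_empty.2 (Finset.ne_of_mem_erase hB))]

theorem sum_pathIntegral_orderings (hx : ∀ i, 0 < x i) (r : ℝ) :
    ∑ l ∈ orderings (Finset.univ : Finset (Fin (m + 1))), pathIntegral x stepWeight l r =
      ∑ ℓ ∈ Finset.range (m + 1), sumBlocks (ℓ + 1) Finset.univ fun L =>
        pathIntegral (blockWeight x) blockStep L r := by
  rw [sum_orderings, if_neg Finset.univ_nonempty.ne_empty, zero_add]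
  have h1 : ∀ j ∈ (Finset.univ : Finset (Fin (m + 1))),
      ∑ l ∈ orderings (Finset.univ.erase j), pathIntegral x stepWeight (j :: l) r =
        ∑ B ∈ (Finset.univ.erase j).powerset with ∀ b ∈ B, b < j,
          blocksAfter x m (∑ b ∈ insert j B, x b) (Finset.univ \ insert j B) r := by
    intro j hj
    simp_rw [pathIntegral_cons]
    rw [sum_headIntegral_eq hx _ m (by simp [Finset.card_erase_of_mem]) j
      (Finset.notMem_erase _ _) _ (hx j)]
    refine Finset.sum_congr rfl fun B hB => ?_
    have hjB : j ∉ B := fun h => lt_irrefl j ((Finset.mem_filter.1 hB).2 j h)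
    rw [Finset.sum_insert hjB, Finset.sdiff_insert, Finset.erase_sdiff_comm]
  rw [Finset.sum_congr rfl h1, sum_powerset_max Finset.univ fun B =>
    blocksAfter x m (∑ b ∈ B, x b) (Finset.univ \ B) r]
  simp only [sumBlocks]
  rw [Finset.sum_comm]
  refine Finset.sum_congr rfl fun B hB => ?_
  rw [blocksAfter]
  simp_rw [pathIntegral_cons, blockWeight_of_nonempty (Finset.mem_filter.1 hB).2]
  rfl

end MergeOrderings

/-! ### Cyclic integrals -/

section Cyclic

variable {ℓ : ℕ} {y : Fin ℓ → ℝ}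

/-- The factor `i (f_j/y_j - f_{j+1}/y_{j+1}) - (y_j + y_{j+1})/2` of the cyclic integrand. -/
def cyclicFactor (y f : Fin ℓ → ℝ) (j : Fin ℓ) : ℂ :=
  Complex.I * ((f j / y j - f (finRotate ℓ j) / y (finRotate ℓ j) : ℝ) : ℂ) -
    (((y j + y (finRotate ℓ j)) / 2 : ℝ) : ℂ)

theorem cyclicIntegrand_eq (y f : Fin ℓ → ℝ) :
    cyclicIntegrand y f = ((∏ j, y j : ℝ) : ℂ)⁻¹ *
      (((∏ j, Real.exp (-(f j) ^ 2 / (2 * y j)) : ℝ) : ℂ) * ∏ j, (cyclicFactor y f j)⁻¹) := by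
  rw [cyclicIntegrand, Finset.prod_div_distrib, Complex.ofReal_div, Finset.prod_inv_distrib]
  simp only [cyclicFactor]
  ring

/-- The coefficients of the linear forms `f_q / y_q - f_{q+1} / y_{q+1}`. -/
def cyclicCoeff (y : Fin ℓ → ℝ) (q k : Fin ℓ) : ℝ :=
  (if k = q then 1 / y k else 0) - if k = finRotate ℓ q then 1 / y k else 0

theorem sum_cyclicCoeff_mul (y f : Fin ℓ → ℝ) (q : Fin ℓ) :
    ∑ k, cyclicCoeff y q k * f k = f q / y q - f (finRotate ℓ q) / y (finRotate ℓ q) := by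
  simp only [cyclicCoeff, sub_mul, ite_mul, zero_mul, Finset.sum_sub_distrib, Finset.sum_ite_eq',
    Finset.mem_univ, if_true]
  ring

theorem sum_mul_cyclicCoeff (y s : Fin ℓ → ℝ) (k : Fin ℓ) :
    ∑ q, s q * cyclicCoeff y q k = (s k - s ((finRotate ℓ).symm k)) / y k := by
  simp only [cyclicCoeff, mul_sub, mul_ite, mul_zero, Finset.sum_sub_distrib,
    ← Equiv.symm_apply_eq, Finset.sum_ite_eq, Finset.mem_univ, if_true]
  ring

theorem gaussian_mul_cyclicFactor (y f : Fin ℓ → ℝ) :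
    ((∏ j, Real.exp (-(f j) ^ 2 / (2 * y j)) : ℝ) : ℂ) * ∏ j, (cyclicFactor y f j)⁻¹ =
      ((∏ j, Real.exp (-(f j) ^ 2 / (2 * y j)) : ℝ) : ℂ) *
        Complex.exp (Complex.I * (∑ j, (0 : Fin ℓ → ℝ) j * f j : ℝ)) *
        ∏ q, (Complex.I * (∑ j, cyclicCoeff y q j * f j : ℝ) +
          (-((y q + y (finRotate ℓ q)) / 2) : ℝ))⁻¹ := by
  simp only [sum_cyclicCoeff_mul, cyclicFactor, Pi.zero_apply, zero_mul, Finset.sum_const_zero,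
    Complex.ofReal_zero, mul_zero, Complex.exp_zero, mul_one, Complex.ofReal_neg, sub_eq_add_neg]

theorem neg_half_add_neg (hy : ∀ j, 0 < y j) (q : Fin ℓ) :
    -((y q + y (finRotate ℓ q)) / 2) < 0 := by
  have h1 := hy q
  have h2 := hy (finRotate ℓ q)
  linarith

theorem integrable_gaussian_mul_cyclicFactor (hy : ∀ j, 0 < y j) :
    Integrable fun f : Fin ℓ → ℝ =>
      ((∏ j, Real.exp (-(f j) ^ 2 / (2 * y j)) : ℝ) : ℂ) * ∏ j, (cyclicFactor y f j)⁻¹ := by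
  simp_rw [gaussian_mul_cyclicFactor]
  exact integrable_gaussian_div 0 (cyclicCoeff y) hy fun q => (neg_half_add_neg hy q).ne

theorem integrable_cyclicIntegrand (hy : ∀ j, 0 < y j) : Integrable (cyclicIntegrand y) := by
  have h := (integrable_gaussian_mul_cyclicFactor hy).const_mul ((∏ j, y j : ℝ) : ℂ)⁻¹
  exact h.congr (ae_of_all _ fun f => (cyclicIntegrand_eq y f).symm)

theorem measurableSet_orthant : MeasurableSet {s : Fin ℓ → ℝ | ∀ j, 0 ≤ s j} := by
  have : {s : Fin ℓ → ℝ | ∀ j, 0 ≤ s j} = Set.Ici 0 := by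
    ext s
    simp [Pi.le_def]
  rw [this]
  exact measurableSet_Ici

/-- The cyclic product of exponents of the Airy kernels on the orthant. -/
def orthantIntegrand (y s : Fin ℓ → ℝ) : ℝ :=
  Set.indicator {s : Fin ℓ → ℝ | ∀ j, 0 ≤ s j} (fun s => Real.exp (-∑ j,
    ((s j - s (finRotate ℓ j)) ^ 2 / (2 * y j) + (s j + s (finRotate ℓ j)) * y j / 2))) s

/-- All real parts are negative, so each variable runs over [0,∞) with weight -1. The real parts
give the linear drift and the Gaussian Fourier transforms give the squared increments. -/
theorem integral_gaussian_mul_cyclicFactor (hy : ∀ j, 0 < y j) :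
    ∫ f : Fin ℓ → ℝ,
      ((∏ j, Real.exp (-(f j) ^ 2 / (2 * y j)) : ℝ) : ℂ) * ∏ j, (cyclicFactor y f j)⁻¹ =
      ((∏ j, Real.sqrt (2 * Real.pi * y j)) * ((-1) ^ ℓ * ∫ s, orthantIntegrand y s) : ℝ) := by
  simp_rw [gaussian_mul_cyclicFactor]
  rw [integral_gaussian_div 0 (cyclicCoeff y) hy fun q => (neg_half_add_neg hy q).ne]
  congr 2
  -- The variable s_q belongs to the link from q to q+1, so y_k joins s_{k-1} to s_k; rotating the
  -- variables restores the convention s_k, s_{k+1}.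
  rw [← integral_comp_perm (finRotate ℓ).symm (orthantIntegrand y), ← integral_const_mul]
  congr 1
  funext s
  simp_rw [sum_mul_cyclicCoeff, halfLineWeight_of_neg (neg_half_add_neg hy _), Pi.zero_apply,
    zero_add]
  rw [orthantIntegrand, Finset.prod_mul_distrib]
  by_cases hs : ∀ j, 0 ≤ s j
  · have hs' : s ∘ (finRotate ℓ).symm ∈ {s : Fin ℓ → ℝ | ∀ j, 0 ≤ s j} := fun j => hs _
    rw [Set.indicator_of_mem hs', Finset.prod_congr rfl fun q _ => if_pos (hs q),
      Finset.prod_const, Finset.card_univ, Fintype.card_fin, mul_assoc, ← Real.exp_sum,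
      ← Real.exp_sum, ← Real.exp_add]
    congr 2
    simp only [Function.comp_apply, Equiv.symm_apply_apply]
    have h1 : ∑ q, s q * -((y q + y (finRotate ℓ q)) / 2) =
        -∑ k, (s ((finRotate ℓ).symm k) + s k) * y k / 2 := by
      have h2 : ∑ k, s ((finRotate ℓ).symm k) * y k = ∑ q, s q * y (finRotate ℓ q) := by
        rw [← Equiv.sum_comp (finRotate ℓ)]
        simp only [Equiv.symm_apply_apply]
      have h3 : ∑ k, (s ((finRotate ℓ).symm k) + s k) * y k / 2 =
          (∑ k, s ((finRotate ℓ).symm k) * y k + ∑ k, s k * y k) / 2 := by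
        rw [← Finset.sum_add_distrib, Finset.sum_div]
        exact Finset.sum_congr rfl fun k _ => by ring
      rw [h3, h2, ← Finset.sum_add_distrib, Finset.sum_div, ← Finset.sum_neg_distrib]
      exact Finset.sum_congr rfl fun k _ => by ring
    rw [h1, Finset.sum_add_distrib, neg_add, add_comm]
    congr 1
    rw [← Finset.sum_neg_distrib]
    refine Finset.sum_congr rfl fun k _ => ?_
    have := (hy k).ne'
    field_simp
    ring
  · have hs' : s ∘ (finRotate ℓ).symm ∉ {s : Fin ℓ → ℝ | ∀ j, 0 ≤ s j} := fun h => hs fun j => by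
      simpa only [Function.comp_apply, Equiv.symm_apply_apply] using h (finRotate ℓ j)
    rw [Set.indicator_of_notMem hs', mul_zero]
    push Not at hs
    obtain ⟨j, hj⟩ := hs
    rw [Finset.prod_eq_zero (Finset.mem_univ j) (if_neg hj.not_ge), zero_mul, zero_mul]

/-- On the orthant the squares and half of the linear terms can be dropped, leaving a product of
exponentials. -/
theorem integrableOn_okounkovIntegrand (hy : ∀ j, 0 < y j) :
    IntegrableOn (okounkovIntegrand y) {s | ∀ j, 0 ≤ s j} := by
  have h1 : Integrable fun s : Fin ℓ → ℝ =>
      ∏ j, (Set.Ici (0 : ℝ)).indicator (fun t => Real.exp (-(y j / 2) * t)) (s j) := by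
    refine Integrable.fintype_prod
      (f := fun j => (Set.Ici (0 : ℝ)).indicator (fun t => Real.exp (-(y j / 2) * t))) fun j => ?_
    rw [integrable_indicator_iff measurableSet_Ici, integrableOn_Ici_iff_integrableOn_Ioi]
    exact exp_neg_integrableOn_Ioi 0 (half_pos (hy j))
  refine h1.integrableOn.mono' ?_ ?_
  · refine Measurable.aestronglyMeasurable ?_
    unfold okounkovIntegrand
    fun_prop
  · refine (ae_restrict_iff' measurableSet_orthant).2 (ae_of_all _ fun s hs => ?_)
    rw [Finset.prod_congr rfl fun j _ =>
        Set.indicator_of_mem (show s j ∈ Set.Ici (0 : ℝ) from hs j) _,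
      ← Real.exp_sum, okounkovIntegrand, Real.norm_of_nonneg (Real.exp_pos _).le,
      Real.exp_le_exp, ← Finset.sum_neg_distrib]
    refine Finset.sum_le_sum fun j _ => ?_
    have h2 := hy j
    have h3 : 0 ≤ s j := hs j
    have h4 : 0 ≤ s (finRotate ℓ j) := hs _
    have h5 : 0 ≤ (s j - s (finRotate ℓ j)) ^ 2 / (4 * y j) := by positivity
    have h6 : 0 ≤ s (finRotate ℓ j) * y j := by positivity
    nlinarith

/-- Under s ↦ t s the linear terms are unchanged and the quadratic ones gain t³ = 2, turning 4y into
2y; t^ℓ is the Jacobian. -/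
theorem integral_okounkovIntegrand_scaled {t : ℝ} (ht : 0 < t) (ht3 : t ^ 3 = 2)
    (hy : ∀ j, 0 < y j) :
    ∫ s in {s : Fin ℓ → ℝ | ∀ j, 0 ≤ s j}, okounkovIntegrand (fun j => y j / t) s =
      t ^ ℓ * ∫ s, orthantIntegrand y s := by
  rw [← integral_indicator measurableSet_orthant]
  set F := Set.indicator {s : Fin ℓ → ℝ | ∀ j, 0 ≤ s j} (okounkovIntegrand fun j => y j / t)
  have h1 := Measure.integral_comp_smul (volume : Measure (Fin ℓ → ℝ)) F t
  have h2 : ∀ s, F (t • s) = orthantIntegrand y s := by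
    intro s
    have hmem : t • s ∈ {s : Fin ℓ → ℝ | ∀ j, 0 ≤ s j} ↔ s ∈ {s : Fin ℓ → ℝ | ∀ j, 0 ≤ s j} := by
      simp [mul_nonneg_iff_of_pos_left ht]
    unfold orthantIntegrand
    by_cases hs : s ∈ {s : Fin ℓ → ℝ | ∀ j, 0 ≤ s j}
    · rw [Set.indicator_of_mem hs]
      refine (Set.indicator_of_mem (hmem.2 hs) _).trans ?_
      rw [okounkovIntegrand]
      congr 2
      refine Finset.sum_congr rfl fun j _ => ?_
      have := (hy j).ne'
      simp only [Pi.smul_apply, smul_eq_mul]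
      congr 1
      · have h3 : (t * s j - t * s (finRotate ℓ j)) ^ 2 / (4 * (y j / t)) =
            t ^ 3 * (s j - s (finRotate ℓ j)) ^ 2 / (4 * y j) := by
          field_simp
        rw [h3, ht3]
        field_simp
        ring
      · field_simp
    · rw [Set.indicator_of_notMem hs]
      exact Set.indicator_of_notMem (fun h => hs (hmem.1 h)) _
  simp_rw [h2] at h1
  rw [h1, Module.finrank_fin_fun, smul_eq_mul, abs_of_pos (by positivity)]
  field_simp

theorem cyclicIntegral_eq_okounkovE (hy : ∀ j, 0 < y j) :
    cyclicIntegral y = (-1) ^ ℓ * (okounkovE (fun j => y j / (2 : ℝ) ^ (1 / 3 : ℝ)) : ℂ) := by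
  set t : ℝ := (2 : ℝ) ^ (1 / 3 : ℝ) with htdef
  have hpi := Real.pi_pos
  have ht : 0 < t := Real.rpow_pos_of_pos two_pos _
  have ht3 : t ^ 3 = 2 := by
    rw [htdef, ← Real.rpow_natCast, ← Real.rpow_mul two_pos.le]
    norm_num
  rw [okounkovE, integral_okounkovIntegrand_scaled ht ht3 hy, cyclicIntegral]
  simp_rw [cyclicIntegrand_eq]
  rw [integral_const_mul, integral_gaussian_mul_cyclicFactor hy]
  have h1 : (∑ j, (y j / t) ^ 3) / 12 = (∑ j, y j ^ 3) / 24 := by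
    simp_rw [div_pow, ht3]
    rw [← Finset.sum_div]
    ring
  have h2 : ∏ j, Real.sqrt (4 * Real.pi * (y j / t)) =
      t ^ ℓ * ∏ j, Real.sqrt (2 * Real.pi * y j) := by
    have h3 : ∀ j, Real.sqrt (4 * Real.pi * (y j / t)) = t * Real.sqrt (2 * Real.pi * y j) := by
      intro j
      -- Since 4/t = 2t², each normalising root yields a factor t, which cancels the Jacobian.
      have h4 : 4 * Real.pi * (y j / t) = t ^ 2 * (2 * Real.pi * y j) := by
        field_simp
        rw [ht3]
        ring
      rw [h4, Real.sqrt_mul (by positivity), Real.sqrt_sq ht.le]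
    simp_rw [h3]
    rw [Finset.prod_mul_distrib, Finset.prod_const, Finset.card_univ, Fintype.card_fin]
  have h5 : (2 * Real.pi) ^ ℓ * ∏ j, y j =
      (∏ j, Real.sqrt (2 * Real.pi * y j)) * ∏ j, Real.sqrt (2 * Real.pi * y j) := by
    rw [← Finset.prod_mul_distrib, Finset.prod_congr rfl fun k _ =>
      Real.mul_self_sqrt (by have := hy k; positivity : 0 ≤ 2 * Real.pi * y k)]
    rw [Finset.prod_mul_distrib, Finset.prod_const, Finset.card_univ, Fintype.card_fin]
  have h6 : ∏ j, Real.sqrt (2 * Real.pi * y j) ≠ 0 := Finset.prod_ne_zero_iff.2 fun k _ => by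
    have := hy k
    positivity
  rw [h1, h2]
  have h7 : Real.exp ((∑ j, y j ^ 3) / 24) / (2 * Real.pi) ^ ℓ * ((∏ j, y j)⁻¹ *
      ((∏ j, Real.sqrt (2 * Real.pi * y j)) * ((-1) ^ ℓ * ∫ s, orthantIntegrand y s))) =
      (-1) ^ ℓ * (Real.exp ((∑ j, y j ^ 3) / 24) / (t ^ ℓ * ∏ j, Real.sqrt (2 * Real.pi * y j)) *
        (t ^ ℓ * ∫ s, orthantIntegrand y s)) := by
    have h8 : ((2 * Real.pi) ^ ℓ)⁻¹ * (∏ j, y j)⁻¹ =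
        (∏ j, Real.sqrt (2 * Real.pi * y j))⁻¹ * (∏ j, Real.sqrt (2 * Real.pi * y j))⁻¹ := by
      rw [← mul_inv, h5, mul_inv]
    have h9 : (∏ j, Real.sqrt (2 * Real.pi * y j)) * (∏ j, Real.sqrt (2 * Real.pi * y j))⁻¹ = 1 :=
      mul_inv_cancel₀ h6
    have h10 : t ^ ℓ * (t ^ ℓ)⁻¹ = 1 := mul_inv_cancel₀ (pow_pos ht ℓ).ne'
    generalize ∏ j, Real.sqrt (2 * Real.pi * y j) = Q at *
    generalize Real.exp ((∑ j, y j ^ 3) / 24) = E at *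
    generalize ∫ s, orthantIntegrand y s = J at *
    rw [div_eq_mul_inv, div_eq_mul_inv, mul_inv]
    linear_combination (E * Q * (-1) ^ ℓ * J) * h8 + (E * (-1) ^ ℓ * J * Q⁻¹) * h9 -
      ((-1) ^ ℓ * E * Q⁻¹ * J) * h10
  rw [← Complex.ofReal_inv, ← Complex.ofReal_mul, ← Complex.ofReal_mul, h7]
  push_cast
  rfl

end Cyclic

/-! ### Cutting cyclic integrals open -/

section CutOpen

variable {k : ℕ} {y : Fin (k + 1) → ℝ}

/-- The integral over `s ∈ [0, ∞)^k` of the product of the kernels along the path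
`0, s_1, …, s_k, 0`, with the sign `(-1)^k`. -/
def linearIntegral (y : Fin (k + 1) → ℝ) : ℝ :=
  ∫ s, pathIntegrand y (fun _ _ => halfLineWeight (-1)) id 0 s

theorem finRotate_castSucc (q : Fin k) : finRotate (k + 1) q.castSucc = q.succ := by
  rw [finRotate_apply, Fin.coeSucc_eq_succ]

theorem gaussian_mul_linearFactor (y f : Fin (k + 1) → ℝ) :
    ((∏ j, Real.exp (-(f j) ^ 2 / (2 * y j)) : ℝ) : ℂ) *
        ∏ q : Fin k, (cyclicFactor y f q.castSucc)⁻¹ =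
      ((∏ j, Real.exp (-(f j) ^ 2 / (2 * y j)) : ℝ) : ℂ) *
        Complex.exp (Complex.I * (∑ j, (0 : Fin (k + 1) → ℝ) j * f j : ℝ)) *
        ∏ q, (Complex.I * (∑ j, chainCoeff y q j * f j : ℝ) +
          (-((y q.castSucc + y q.succ) / 2) : ℝ))⁻¹ := by
  simp only [sum_chainCoeff_mul, cyclicFactor, Pi.zero_apply, zero_mul, Finset.sum_const_zero,
    Complex.ofReal_zero, mul_zero, Complex.exp_zero, mul_one, Complex.ofReal_neg, sub_eq_add_neg,
    finRotate_castSucc]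

theorem neg_half_add_neg_succ (hy : ∀ j, 0 < y j) (q : Fin k) :
    -((y q.castSucc + y q.succ) / 2) < 0 := by
  have h1 := hy q.castSucc
  have h2 := hy q.succ
  linarith

theorem integrable_gaussian_mul_linearFactor (hy : ∀ j, 0 < y j) :
    Integrable fun f : Fin (k + 1) → ℝ =>
      ((∏ j, Real.exp (-(f j) ^ 2 / (2 * y j)) : ℝ) : ℂ) *
        ∏ q : Fin k, (cyclicFactor y f q.castSucc)⁻¹ := by
  simp_rw [gaussian_mul_linearFactor]
  exact integrable_gaussian_div 0 (chainCoeff y) hy fun q => (neg_half_add_neg_succ hy q).ne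

/-- Unlike on Buryak's side there is no phase: the drift comes from the real parts of the k
remaining factors. Hence the cubic constant is the sum of the y_j³, not the cube of the sum. -/
theorem integral_gaussian_mul_linearFactor (hy : ∀ j, 0 < y j) :
    ∫ f : Fin (k + 1) → ℝ, ((∏ j, Real.exp (-(f j) ^ 2 / (2 * y j)) : ℝ) : ℂ) *
        ∏ q : Fin k, (cyclicFactor y f q.castSucc)⁻¹ =
      (Real.exp (-(∑ j, y j ^ 3) / 24) * (∏ j, (2 * Real.pi * y j)) * linearIntegral y : ℝ) := by
  have hpi := Real.pi_pos
  simp_rw [gaussian_mul_linearFactor]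
  rw [integral_gaussian_div 0 (chainCoeff y) hy fun q => (neg_half_add_neg_succ hy q).ne,
    linearIntegral, ← integral_const_mul, ← integral_const_mul]
  congr 2
  funext s
  simp_rw [sum_mul_chainCoeff, halfLineWeight_of_neg (neg_half_add_neg_succ hy _), Pi.zero_apply,
    zero_add]
  rw [pathIntegrand, halfLineWeight_of_neg (by norm_num : (-1 : ℝ) < 0), Finset.prod_mul_distrib]
  set c := (Fin.cons 0 s : Fin (k + 1) → ℝ) with hc
  set d := (Fin.snoc s 0 : Fin (k + 1) → ℝ) with hd
  have hK : ∀ j, airyKernel (y j) (c j) (d j) =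
      (Real.sqrt (2 * Real.pi * y j))⁻¹ *
        Real.exp (y j ^ 3 / 24 + (-(c j - d j) ^ 2 / (2 * y j) - (c j + d j) * y j / 2)) := by
    intro j
    unfold airyKernel
    rw [Real.exp_add]
    ring
  have h2 : ∏ j, (2 * Real.pi * y j) = (∏ j, Real.sqrt (2 * Real.pi * y j)) *
      ∏ j, Real.sqrt (2 * Real.pi * y j) := by
    rw [← Finset.prod_mul_distrib]
    refine Finset.prod_congr rfl fun j _ => (Real.mul_self_sqrt ?_).symm
    have := hy j
    positivity
  have h3 : ∏ j, Real.sqrt (2 * Real.pi * y j) ≠ 0 := Finset.prod_ne_zero_iff.2 fun j _ => by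
    have := hy j
    positivity
  have h4 : ∑ q : Fin k, s q * -((y q.castSucc + y q.succ) / 2) =
      -∑ j, (c j + d j) * y j / 2 := by
    have h5 : ∑ j, c j * y j = ∑ q : Fin k, s q * y q.succ := by
      rw [Fin.sum_univ_succ]
      simp [hc]
    have h6 : ∑ j, d j * y j = ∑ q : Fin k, s q * y q.castSucc := by
      rw [Fin.sum_univ_castSucc]
      simp [hd]
    have h7 : ∑ j, (c j + d j) * y j / 2 = (∑ j, c j * y j + ∑ j, d j * y j) / 2 := by
      rw [← Finset.sum_add_distrib, Finset.sum_div]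
      exact Finset.sum_congr rfl fun j _ => by ring
    rw [h7, h5, h6, ← Finset.sum_add_distrib, Finset.sum_div, ← Finset.sum_neg_distrib]
    exact Finset.sum_congr rfl fun q _ => by ring
  have h8 : (∏ q : Fin k, Real.exp (s q * -((y q.castSucc + y q.succ) / 2))) *
      ∏ j, Real.exp (-y j * ((d j - c j) / y j) ^ 2 / 2) =
      Real.exp (-(∑ j, y j ^ 3) / 24) *
      ∏ j, Real.exp (y j ^ 3 / 24 + (-(c j - d j) ^ 2 / (2 * y j) - (c j + d j) * y j / 2)) := by
    rw [← Real.exp_sum, ← Real.exp_sum, ← Real.exp_sum, ← Real.exp_add, ← Real.exp_add, h4]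
    congr 1
    rw [Finset.sum_add_distrib, Finset.sum_sub_distrib, ← Finset.sum_div _ _ (24 : ℝ)]
    have h9 : ∀ j, -y j * ((d j - c j) / y j) ^ 2 / 2 = -(c j - d j) ^ 2 / (2 * y j) := by
      intro j
      have := (hy j).ne'
      field_simp
      ring
    simp_rw [h9]
    ring
  simp only [id_eq]
  simp_rw [hK]
  rw [Finset.prod_mul_distrib (f := fun j => (Real.sqrt (2 * Real.pi * y j))⁻¹),
    Finset.prod_inv_distrib, h2, mul_assoc (∏ q : Fin k, _), h8]
  field_simp

theorem cyclicFactor_add (y f : Fin (k + 1) → ℝ) (c j : Fin (k + 1)) :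
    cyclicFactor y f (j + c) =
      cyclicFactor (y ∘ Equiv.addRight c) (f ∘ Equiv.addRight c) j := by
  simp only [cyclicFactor, finRotate_apply, Function.comp_apply, Equiv.coe_addRight,
    add_right_comm]

theorem cyclicFactor_ne_zero (hy : ∀ j, 0 < y j) (f : Fin (k + 1) → ℝ) (j : Fin (k + 1)) :
    cyclicFactor y f j ≠ 0 := by
  intro h
  have h1 := congrArg Complex.re h
  simp only [cyclicFactor, Complex.sub_re, Complex.mul_re, Complex.I_re, Complex.I_im,
    Complex.ofReal_re, Complex.ofReal_im, zero_mul, mul_zero, sub_zero, zero_sub,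
    Complex.zero_re] at h1
  have := neg_half_add_neg hy j
  linarith

/-- The imaginary parts cancel around the cycle, and each y_j is counted with one half from both of
its links. -/
theorem sum_cyclicFactor (y f : Fin (k + 1) → ℝ) :
    ∑ j, cyclicFactor y f j = -((∑ j, y j : ℝ) : ℂ) := by
  simp only [cyclicFactor]
  rw [Finset.sum_sub_distrib, ← Finset.mul_sum, ← Complex.ofReal_sum, ← Complex.ofReal_sum,
    Finset.sum_sub_distrib, Equiv.sum_comp (finRotate (k + 1)) fun j => f j / y j, sub_self,
    ← Finset.sum_div, Finset.sum_add_distrib, Equiv.sum_comp (finRotate (k + 1)) y]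
  push_cast
  ring

/-- The factor -∑ y_j is written as the sum of all denominators; each summand cancels one of them
and opens the cycle there. -/
theorem neg_sum_mul_prod_cyclicFactor (hy : ∀ j, 0 < y j) (f : Fin (k + 1) → ℝ) :
    -((∑ j, y j : ℝ) : ℂ) *
      (((∏ j, Real.exp (-(f j) ^ 2 / (2 * y j)) : ℝ) : ℂ) * ∏ j, (cyclicFactor y f j)⁻¹) =
    ∑ c, (((∏ j, Real.exp (-((f ∘ Equiv.addRight c) j) ^ 2 /
        (2 * (y ∘ Equiv.addRight c) j)) : ℝ) : ℂ) *
      ∏ q : Fin k, (cyclicFactor (y ∘ Equiv.addRight c) (f ∘ Equiv.addRight c) q.castSucc)⁻¹) := by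
  -- The cancelled index is written as `last + c`, so that after rotation by `c` it is always the
  -- closing link that disappears.
  rw [← sum_cyclicFactor y f, ← Equiv.sum_comp (Equiv.addLeft (Fin.last k)), Finset.sum_mul]
  refine Finset.sum_congr rfl fun c _ => ?_
  have h1 : ∏ j, Real.exp (-((f ∘ Equiv.addRight c) j) ^ 2 / (2 * (y ∘ Equiv.addRight c) j)) =
      ∏ j, Real.exp (-(f j) ^ 2 / (2 * y j)) :=
    Equiv.prod_comp (Equiv.addRight c) fun j => Real.exp (-(f j) ^ 2 / (2 * y j))
  have h2 : ∏ j, (cyclicFactor y f j)⁻¹ =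
      ∏ j, (cyclicFactor (y ∘ Equiv.addRight c) (f ∘ Equiv.addRight c) j)⁻¹ := by
    rw [← Equiv.prod_comp (Equiv.addRight c)]
    simp only [Equiv.coe_addRight, cyclicFactor_add]
  have h3 := cyclicFactor_ne_zero (y := y ∘ Equiv.addRight c) (fun j => hy _)
    (f ∘ Equiv.addRight c) (Fin.last k)
  rw [h1, h2, Fin.prod_univ_castSucc (f := fun j =>
    (cyclicFactor (y ∘ Equiv.addRight c) (f ∘ Equiv.addRight c) j)⁻¹), Equiv.coe_addLeft,
    cyclicFactor_add, mul_left_comm, mul_left_comm (cyclicFactor _ _ _), mul_inv_cancel₀ h3,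
    mul_one]

theorem neg_cyclicIntegral_eq (hy : ∀ j, 0 < y j) :
    -cyclicIntegral y =
      (((∑ j, y j)⁻¹ * ∑ c : Fin (k + 1), linearIntegral (y ∘ Equiv.addRight c) : ℝ) : ℂ) := by
  have hpi := Real.pi_pos
  have hY : 0 < ∑ j, y j := Finset.sum_pos (fun i _ => hy i) Finset.univ_nonempty
  have hprod : ∏ j, y j ≠ 0 := Finset.prod_ne_zero_iff.2 fun j _ => (hy j).ne'
  have h1 : -((∑ j, y j : ℝ) : ℂ) * ∫ f : Fin (k + 1) → ℝ,
      ((∏ j, Real.exp (-(f j) ^ 2 / (2 * y j)) : ℝ) : ℂ) * ∏ j, (cyclicFactor y f j)⁻¹ =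
      (Real.exp (-(∑ j, y j ^ 3) / 24) * (∏ j, (2 * Real.pi * y j)) *
        ∑ c : Fin (k + 1), linearIntegral (y ∘ Equiv.addRight c) : ℝ) := by
    rw [← integral_const_mul]
    simp_rw [neg_sum_mul_prod_cyclicFactor hy]
    rw [integral_finsetSum _ fun c _ => integrable_comp_perm (Equiv.addRight c)
      (integrable_gaussian_mul_linearFactor (y := y ∘ Equiv.addRight c) fun j => hy _),
      Finset.mul_sum, Complex.ofReal_sum]
    refine Finset.sum_congr rfl fun c _ => ?_
    rw [integral_comp_perm (Equiv.addRight c) fun f =>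
      ((∏ j, Real.exp (-(f j) ^ 2 / (2 * (y ∘ Equiv.addRight c) j)) : ℝ) : ℂ) *
        ∏ q : Fin k, (cyclicFactor (y ∘ Equiv.addRight c) f q.castSucc)⁻¹,
      integral_gaussian_mul_linearFactor (y := y ∘ Equiv.addRight c) fun j => hy _]
    congr 3
    · congr 3
      exact Equiv.sum_comp (Equiv.addRight c) fun j => y j ^ 3
    · exact Equiv.prod_comp (Equiv.addRight c) fun j => 2 * Real.pi * y j
  rw [cyclicIntegral]
  simp_rw [cyclicIntegrand_eq]
  rw [integral_const_mul]
  have h2 : ∫ f : Fin (k + 1) → ℝ,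
      ((∏ j, Real.exp (-(f j) ^ 2 / (2 * y j)) : ℝ) : ℂ) * ∏ j, (cyclicFactor y f j)⁻¹ =
      -(((∑ j, y j)⁻¹ * (Real.exp (-(∑ j, y j ^ 3) / 24) * (∏ j, (2 * Real.pi * y j)) *
        ∑ c : Fin (k + 1), linearIntegral (y ∘ Equiv.addRight c)) : ℝ) : ℂ) := by
    have hYc : ((∑ j, y j : ℝ) : ℂ) ≠ 0 := by exact_mod_cast hY.ne'
    rw [Complex.ofReal_mul, ← h1, Complex.ofReal_inv]
    field_simp
  have h3 : Real.exp ((∑ j, y j ^ 3) / 24) * Real.exp (-(∑ j, y j ^ 3) / 24) = 1 := by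
    rw [← Real.exp_add, neg_div, add_neg_cancel, Real.exp_zero]
  rw [h2, mul_neg, mul_neg, neg_neg, ← Complex.ofReal_inv, ← Complex.ofReal_mul,
    ← Complex.ofReal_mul]
  congr 1
  rw [Finset.prod_mul_distrib, Finset.prod_const, Finset.card_univ, Fintype.card_fin]
  generalize Real.exp ((∑ j, y j ^ 3) / 24) = E at *
  generalize Real.exp (-(∑ j, y j ^ 3) / 24) = E' at *
  generalize ∑ c : Fin (k + 1), linearIntegral (y ∘ Equiv.addRight c) = Λ
  field_simp
  linear_combination Λ * h3

end CutOpen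

/-! ### Sums over ordered and cyclically ordered partitions -/

section Partitions

open Classical in
theorem sumBlocks_eq_sum {n : ℕ} (ℓ : ℕ) (S : Finset (Fin n)) (f : List (Finset (Fin n)) → ℝ) :
    sumBlocks ℓ S f = ∑ I : Fin ℓ → Finset (Fin n) with
      (∀ j, (I j).Nonempty) ∧ (∀ j k, j ≠ k → Disjoint (I j) (I k)) ∧ ∀ i, i ∈ S ↔ ∃ j, i ∈ I j,
        f (List.ofFn I) := by
  induction ℓ generalizing S f with
  | zero =>
    rw [sumBlocks, Finset.sum_filter, Fintype.sum_unique]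
    simp only [List.ofFn_zero, IsEmpty.forall_iff, IsEmpty.exists_iff, true_and, iff_false,
      Finset.eq_empty_iff_forall_notMem]
  | succ ℓ ih =>
    rw [sumBlocks, Finset.sum_filter, Finset.sum_filter,
      ← Equiv.sum_comp (Fin.consEquiv fun _ => Finset (Fin n)), Fintype.sum_prod_type,
      ← Finset.sum_subset (Finset.subset_univ S.powerset)]
    · refine Finset.sum_congr rfl fun B hB => ?_
      rw [Finset.mem_powerset] at hB
      split_ifs with hne
      · rw [ih, Finset.sum_filter]
        refine Finset.sum_congr rfl fun I _ => ?_
        have hcons : (Fin.consEquiv fun _ => Finset (Fin n)) (B, I) =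
          (Fin.cons B I : Fin (ℓ + 1) → Finset (Fin n)) := rfl
        rw [hcons, List.ofFn_succ, Fin.cons_zero]
        simp only [Fin.cons_succ]
        refine if_congr ?_ rfl rfl
        simp only [Fin.forall_fin_succ, Fin.exists_fin_succ, Fin.cons_zero, Fin.cons_succ]
        constructor
        · rintro ⟨h1, h2, h3⟩
          have hdisj : ∀ j, Disjoint B (I j) := fun j => by
            rw [Finset.disjoint_right]
            exact fun i hi => (Finset.mem_sdiff.1 ((h3 i).2 ⟨j, hi⟩)).2
          refine ⟨⟨hne, h1⟩, ⟨⟨fun h => absurd rfl h, fun j _ => hdisj j⟩,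
            fun j => ⟨fun _ => (hdisj j).symm, fun k hjk => h2 j k fun h => hjk (h ▸ rfl)⟩⟩,
            fun i => ?_⟩
          rw [← h3 i, Finset.mem_sdiff]
          by_cases hi : i ∈ B
          · simp [hi, hB hi]
          · simp [hi]
        · rintro ⟨⟨-, h1⟩, ⟨⟨-, h2⟩, h3⟩, h4⟩
          refine ⟨h1, fun j k hjk => (h3 j).2 k fun h => hjk (Fin.succ_injective _ h), fun i => ?_⟩
          rw [Finset.mem_sdiff, h4 i]
          constructor
          · rintro ⟨h | h, hi⟩
            · exact absurd h hi
            · exact h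
          · rintro ⟨j, hj⟩
            exact ⟨Or.inr ⟨j, hj⟩, fun hi => Finset.disjoint_left.1 (h2 j (Fin.succ_ne_zero j).symm)
              hi hj⟩
      · symm
        refine Finset.sum_eq_zero fun I _ => if_neg ?_
        rintro ⟨h1, -, -⟩
        exact hne (h1 0)
    · intro B _ hB
      refine Finset.sum_eq_zero fun I _ => if_neg ?_
      rintro ⟨-, -, h3⟩
      exact hB (Finset.mem_powerset.2 fun i hi => (h3 i).2 ⟨0, hi⟩)

theorem sumBlocks_univ {n : ℕ} (ℓ : ℕ) (f : List (Finset (Fin n)) → ℝ) :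
    sumBlocks ℓ Finset.univ f = ∑ I : OrderedSetPartition n ℓ, f (List.ofFn I.1) := by
  classical
  rw [sumBlocks_eq_sum]
  refine Finset.sum_bij' (fun I hI => (⟨I, ?_⟩ : OrderedSetPartition n ℓ)) (fun I _ => I.1)
    ?_ ?_ ?_ ?_ ?_
  · have h := (Finset.mem_filter.1 hI).2
    exact ⟨h.1, h.2.1, fun i => (h.2.2 i).1 (Finset.mem_univ i)⟩
  · intros; exact Finset.mem_univ _
  · intro I _
    exact Finset.mem_filter.2 ⟨Finset.mem_univ _, I.2.1, I.2.2.1,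
      fun i => ⟨fun _ => I.2.2.2 i, fun _ => Finset.mem_univ i⟩⟩
  · intros; rfl
  · intros; rfl
  · intros; rfl

/-- Rotation of the blocks of an ordered partition. -/
def OrderedSetPartition.rotate {n k : ℕ} (I : OrderedSetPartition n (k + 1)) (c : Fin (k + 1)) :
    OrderedSetPartition n (k + 1) :=
  ⟨fun j => I.1 (j + c), fun j => I.2.1 _,
    fun j j' h => I.2.2.1 _ _ fun h' => h (add_right_cancel h'),
    fun i => by
      obtain ⟨j, hj⟩ := I.2.2.2 i
      exact ⟨j - c, show i ∈ I.1 (j - c + c) by rwa [sub_add_cancel]⟩⟩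

theorem finRotate_pow_apply {k : ℕ} (t : ℕ) (j : Fin (k + 1)) :
    (finRotate (k + 1) ^ t) j = j + Fin.ofNat (k + 1) t := by
  induction t with
  | zero => simp
  | succ t ih =>
    rw [pow_succ', Equiv.Perm.mul_apply, ih, finRotate_apply, add_assoc]
    congr 1
    ext
    simp [Fin.val_add, Fin.ofNat]

/-- Blocks are nonempty and disjoint, hence distinct, so already the first block determines the
rotation. -/
theorem OrderedSetPartition.rotate_injective {n k : ℕ} (I : OrderedSetPartition n (k + 1)) :
    Function.Injective I.rotate := by
  intro c d h
  by_contra hne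
  have h1 : I.1 (0 + c) = I.1 (0 + d) := congrFun (congrArg Subtype.val h) 0
  rw [zero_add, zero_add] at h1
  have h2 := I.2.2.1 c d hne
  rw [← h1, disjoint_self] at h2
  exact (I.2.1 c).ne_empty h2

open Classical in
-- Each class is a free orbit of the cyclic group, so it is parametrised exactly once by the
-- rotations of a representative.
theorem sum_orderedSetPartition {n k : ℕ} (f : OrderedSetPartition n (k + 1) → ℝ)
    (g : CyclicSetPartition n (k + 1) → ℝ)
    (hfg : ∀ I, ∑ c, f (I.rotate c) = g (Quotient.mk _ I)) :
    ∑ I, f I = ∑ c, g c := by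
  rw [← Finset.sum_fiberwise Finset.univ
    (fun I : OrderedSetPartition n (k + 1) => (Quotient.mk _ I : CyclicSetPartition n (k + 1))) f]
  refine Finset.sum_congr rfl fun C _ => ?_
  obtain ⟨I, rfl⟩ := Quotient.exists_rep C
  rw [← hfg I]
  symm
  refine Finset.sum_bij (fun c _ => I.rotate c) ?_ ?_ ?_ ?_
  · intro c _
    refine Finset.mem_filter.2 ⟨Finset.mem_univ _,
      Quotient.sound (Setoid.symm ⟨c.val, fun j => ?_⟩)⟩
    rw [finRotate_pow_apply, Fin.ofNat_val_eq_self]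
    rfl
  · intro c _ d _ h
    exact I.rotate_injective h
  · intro J hJ
    obtain ⟨t, ht⟩ := Setoid.symm (Quotient.exact (Finset.mem_filter.1 hJ).2)
    refine ⟨Fin.ofNat (k + 1) t, Finset.mem_univ _, Subtype.ext (funext fun j => ?_)⟩
    rw [ht, finRotate_pow_apply]
    rfl
  · intros; rfl

theorem blockSum_pos {n ℓ : ℕ} {x : Fin n → ℝ} (hx : ∀ i, 0 < x i) (I : OrderedSetPartition n ℓ)
    (j : Fin ℓ) : 0 < I.blockSum x j :=
  Finset.sum_pos (fun i _ => hx i) (I.2.1 j)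

theorem sum_blockSum {n ℓ : ℕ} (x : Fin n → ℝ) (I : OrderedSetPartition n ℓ) :
    ∑ j, I.blockSum x j = ∑ i, x i := by
  classical
  simp only [OrderedSetPartition.blockSum]
  rw [← Finset.sum_biUnion fun j _ k _ hjk => I.2.2.1 j k hjk]
  congr 1
  ext i
  simpa using I.2.2.2 i

theorem pathIntegral_ofFn_blocks {n k : ℕ} {x : Fin n → ℝ} (hx : ∀ i, 0 < x i)
    (I : OrderedSetPartition n (k + 1)) :
    pathIntegral (blockWeight x) blockStep (List.ofFn I.1) 0 = linearIntegral (I.blockSum x) := by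
  rw [← (integrable_and_integral_pathIntegrand (blockWeight_pos hx) blockStep measurable_blockStep
    abs_blockStep_le I.1 0).2, linearIntegral]
  simp only [pathIntegrand, blockWeight_of_nonempty (I.2.1 _)]
  rfl

theorem sum_linearIntegral_eq {n k : ℕ} {x : Fin n → ℝ} (hx : ∀ i, 0 < x i) :
    (((∑ i, x i)⁻¹ * ∑ I : OrderedSetPartition n (k + 1), linearIntegral (I.blockSum x) : ℝ) : ℂ) =
      ∑ c : CyclicSetPartition n (k + 1), -c.integral x := by
  have hrot : ∀ (I : OrderedSetPartition n (k + 1)) (c : Fin (k + 1)),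
      (I.rotate c).blockSum x = I.blockSum x ∘ Equiv.addRight c := fun I c => rfl
  have hneg : ∀ I : OrderedSetPartition n (k + 1),
      -(CyclicSetPartition.integral x (Quotient.mk _ I)) =
        (((∑ i, x i)⁻¹ * ∑ c : Fin (k + 1), linearIntegral ((I.rotate c).blockSum x) : ℝ) : ℂ) := by
    intro I
    have h := neg_cyclicIntegral_eq (blockSum_pos hx I)
    rw [sum_blockSum] at h
    exact h
  -- The cyclic integrals are real, so the comparison of sums can be made over the reals.
  have hre : ∀ c : CyclicSetPartition n (k + 1),
      -c.integral x = (((-c.integral x).re : ℝ) : ℂ) := by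
    intro c
    obtain ⟨I, rfl⟩ := Quotient.exists_rep c
    rw [hneg I, Complex.ofReal_re]
  rw [Finset.sum_congr rfl fun c _ => hre c, ← Complex.ofReal_sum, Finset.mul_sum]
  congr 1
  refine sum_orderedSetPartition _ _ fun I => ?_
  rw [hneg I, Complex.ofReal_re, Finset.mul_sum]

end Partitions

end

/-! ### The main theorem -/

theorem mainTheorem3 (n : ℕ) (hn : 1 ≤ n) (x : Fin n → ℝ) (hx : ∀ i, 0 < x i) :
    (Integrable (buryakIntegrand n x) ∧
      buryakF n x =
        (((2 * Real.pi) ^ ((n : ℝ) / 2) / ∏ j, Real.sqrt (x j) : ℝ) : ℂ) *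
          ∑ ℓ ∈ Finset.Icc 1 n, ∑ c : CyclicSetPartition n ℓ, -c.integral x) ∧
    ∀ (ℓ : ℕ) (I : OrderedSetPartition n ℓ),
      Integrable (cyclicIntegrand (I.blockSum x)) ∧
      IntegrableOn (okounkovIntegrand fun j => I.blockSum x j / (2 : ℝ) ^ (1 / 3 : ℝ))
        {s | ∀ j, 0 ≤ s j} ∧
      cyclicIntegral (I.blockSum x) =
        (-1) ^ ℓ * (okounkovE (fun j => I.blockSum x j / (2 : ℝ) ^ (1 / 3 : ℝ)) : ℂ) := by
  refine ⟨?_, fun ℓ I => ⟨integrable_cyclicIntegrand (blockSum_pos hx I),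
    integrableOn_okounkovIntegrand fun j =>
      div_pos (blockSum_pos hx I j) (Real.rpow_pos_of_pos two_pos _),
    cyclicIntegral_eq_okounkovE (blockSum_pos hx I)⟩⟩
  obtain ⟨m, rfl⟩ : ∃ m, n = m + 1 := Nat.exists_eq_succ_of_ne_zero (by omega)
  refine ⟨integrable_buryakIntegrand hx, ?_⟩
  rw [buryakF_eq hx, sum_pathIntegral_orderings hx, Finset.mul_sum, Complex.ofReal_sum]
  congr 1
  -- The block count is reindexed as ℓ + 1, since the comparison of linear and cyclic integrals is
  -- stated for a positive number of blocks.
  rw [← Finset.Ico_add_one_right_eq_Icc, Finset.sum_Ico_eq_sum_range]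
  refine Finset.sum_congr rfl fun ℓ _ => ?_
  rw [add_comm 1 ℓ, ← sum_linearIntegral_eq hx, sumBlocks_univ]
  simp only [pathIntegral_ofFn_blocks hx]
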